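/- Let $m \ge 1$, $s \ge 2$, $n \ge 3$ be integers and let $r \in \mathbb{Z}_n^*$ satisfy $r^{ms} = \pm 1$. Let $\overline{\mathrm{CPM}}(m,s,n;r)$ be the graph whose vertices are the pairs $\langle i; \mathbf v\rangle$ with $i \in \mathbb{Z}_{ms}$ and $\mathbf v = (v_0,\dots,v_{s-1}) \in \mathbb{Z}_n^s$, with adjacencies $\langle i;\mathbf v\rangle \sim \langle i+1; \mathbf v \pm r^i \mathbf e_\ell\rangle$, where $\ell$ is $i$ mod $s$ and $\mathbf e_\ell$ is the $\ell$-th standard vector. Let $\Gamma = \mathrm{CPM}(m,s,n;r)$ be its connected component containing $\langle 0;\mathbf 0\rangle$. Let $\bar G$ be the group of permutations of the pairs $\langle i;\mathbf v\rangle$ generated by $$\bar\sigma\colon \langle i;\mathbf v\rangle \mapsto \langle i+1;(rv_{s-1},rv_0,\dots,rv_{s-2})\rangle,\qquad \bar\rho_0\colon\langle i;\mathbf v\rangle\mapsto\langle i;\mathbf v+\mathbf e_0\rangle,\qquad \bar\tau_0\colon\langle i;\mathbf v\rangle\mapsto\langle i;(-v_0,v_1,\dots,v_{s-1})\rangle,$$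 and let $G \le \mathrm{Aut}(\Gamma)$ be the group of the restrictions to $V(\Gamma)$ of the elements of $\bar G$ that preserve $V(\Gamma)$. For odd $k$ and $q \in \mathbb{Z}_k^*$ let $\beta_{k,q}(x,y,z) = \bigl(y-qz,\ 2^{-1}(x+y+qz),\ 2^{-1}(z-q^{-1}x+q^{-1}y)\bigr)$ on $\mathbb{Z}_k^3$. Let $\nu_4$ be the automorphism of the 4-cube $\mathrm{CPM}(2,2,4;1)$ which fixes $\langle 0;(0,0)\rangle$, $\langle 1;(1,0)\rangle$ and $\langle 3;(0,3)\rangle$ and interchanges $\langle 1;(3,0)\rangle$ with $\langle 3;(0,1)\rangle$ (these conditions determine it). **Theorem.** Suppose that $\Gamma$ is $2$-arc-transitive, that is, $\mathrm{Aut}(\Gamma)$ is transitive on the triples $(a,b,c)$ of vertices with $a\sim b\sim c$ and $a\ne c$. Then all vertex stabilizers in $\mathrm{Aut}(\Gamma)$ have order $24$, $s=2$, and $\mathrm{Aut}(\Gamma) = \langle G, \nu\rangle$, where $\nu\in \mathrm{Aut}(\Gamma)$ is an involution; moreover one of the following three cases occurs, and $\nu$ is given as stated there. 1. $m = 1$,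 $n = 4$, and $\nu$ is obtained from $\nu_4$ by means of the isomorphism $\langle i;\mathbf v\rangle\mapsto\langle i \bmod 2;\mathbf v\rangle$ of $\mathrm{CPM}(2,2,4;r)=\mathrm{CPM}(2,2,4;1)$ onto $\Gamma$. 2. $m = n$ is odd, $r^2 = \pm1$, and, if $\langle i;(y,z)\rangle$ is identified with $\langle i \bmod 2; (i \bmod n, y, z)\rangle \in \mathbb{Z}_2\times\mathbb{Z}_n^3$, then $\langle e;\mathbf u\rangle\nu = \langle e;\beta_{n,r^{-1}}(\mathbf u)\rangle$. 3. $m = 2k$ with $k$ odd, $n = 2m$, $1 + r^2 = m$ in $\mathbb{Z}_n$, and, if $\langle i;(y,z)\rangle$ is identified with $(i,y,z)\in\mathbb{Z}_{4k}^3$, then $\nu$ acts as $\nu_4$ modulo $4$ and as $\beta_{k,q}$ modulo $k$, where $q$ is the residue modulo $k$ of that one of $r$, $-r$ which is congruent to $3$ modulo $4$. -/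

import Mathlib

/-- Vertices `⟨i; v⟩` with `i ∈ ℤ_{ms}` and `v ∈ ℤ_n^s`. The components of `v` are indexed by
`ZMod s` (that is, by the residues `0, …, s - 1`), so that `ℓ = i mod s` is itself an index. -/
abbrev CPMVertex (m s n : ℕ) : Type := ZMod (m * s) × (ZMod s → ZMod n)

namespace CPMVertex

variable {m s n : ℕ}

/-- The vertex `⟨0; 0⟩`. -/
def zero (m s n : ℕ) : CPMVertex m s n := (0, 0)

/-- `y` is one of the two vertices `⟨i + 1; v ± r^i e_ℓ⟩`, where `x = ⟨i; v⟩`, `ℓ = i mod s`. -/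
def IsNext (r : (ZMod n)ˣ) (x y : CPMVertex m s n) : Prop :=
  y.1 = x.1 + 1 ∧
    (y.2 = x.2 + Pi.single (x.1.cast : ZMod s) ((r : ZMod n) ^ x.1.val) ∨
     y.2 = x.2 - Pi.single (x.1.cast : ZMod s) ((r : ZMod n) ^ x.1.val))

end CPMVertex

/-- The whole (possibly disconnected) graph on all the pairs `⟨i; v⟩`, with
`⟨i; v⟩ ∼ ⟨i + 1; v ± r^i e_ℓ⟩`. -/
def CPMbar (m s n : ℕ) (r : (ZMod n)ˣ) : SimpleGraph (CPMVertex m s n) :=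
  SimpleGraph.fromRel (CPMVertex.IsNext r)

/-- The vertex set of the connected component of `⟨0; 0⟩`. -/
def CPMSet (m s n : ℕ) (r : (ZMod n)ˣ) : Set (CPMVertex m s n) :=
  ((CPMbar m s n r).connectedComponentMk (CPMVertex.zero m s n)).supp

/-- The graph `CPM(m, s, n; r)`: the connected component of `⟨0; 0⟩`. -/
def CPM (m s n : ℕ) (r : (ZMod n)ˣ) : SimpleGraph (CPMSet m s n r) :=
  (CPMbar m s n r).induce (CPMSet m s n r)

/-- The group of automorphisms of the graph `CPM(m, s, n; r)`, under composition. -/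
abbrev CPMAut (m s n : ℕ) (r : (ZMod n)ˣ) : Type := CPM m s n r ≃g CPM m s n r

/-- `(a, b, c)` is a 2-arc of `Γ`. -/
def SimpleGraph.IsTwoArc {V : Type*} (Γ : SimpleGraph V) (a b c : V) : Prop :=
  Γ.Adj a b ∧ Γ.Adj b c ∧ a ≠ c

/-- The automorphism group of `Γ` is transitive on the 2-arcs of `Γ`. -/
def SimpleGraph.IsTwoArcTransitive {V : Type*} (Γ : SimpleGraph V) : Prop :=
  ∀ a b c a' b' c' : V, Γ.IsTwoArc a b c → Γ.IsTwoArc a' b' c' →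
    ∃ φ : Γ ≃g Γ, φ a = a' ∧ φ b = b' ∧ φ c = c'

section HalfArcTransitiveGroup

variable {m s n : ℕ}

/-- `⟨i; v⟩ ↦ ⟨i; v + e_ℓ⟩`. -/
def rhoBar (ℓ : ZMod s) : Equiv.Perm (CPMVertex m s n) where
  toFun x := (x.1, x.2 + Pi.single ℓ 1)
  invFun x := (x.1, x.2 - Pi.single ℓ 1)
  left_inv x := by simp
  right_inv x := by simp

/-- `⟨i; v⟩ ↦ ⟨i; (v_0, …, v_{ℓ-1}, -v_ℓ, v_{ℓ+1}, …, v_{s-1})⟩`. -/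
def tauBar (ℓ : ZMod s) : Equiv.Perm (CPMVertex m s n) where
  toFun x := (x.1, Function.update x.2 ℓ (-x.2 ℓ))
  invFun x := (x.1, Function.update x.2 ℓ (-x.2 ℓ))
  left_inv x := by simp
  right_inv x := by simp

/-- `⟨i; v⟩ ↦ ⟨i + 1; (r v_{s-1}, r v_0, …, r v_{s-2})⟩`. -/
def sigmaBar (r : (ZMod n)ˣ) : Equiv.Perm (CPMVertex m s n) where
  toFun x := (x.1 + 1, fun j => (r : ZMod n) * x.2 (j - 1))
  invFun x := (x.1 - 1, fun j => ((r⁻¹ : (ZMod n)ˣ) : ZMod n) * x.2 (j + 1))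
  left_inv x := by simp
  right_inv x := by simp

/-- The permutation group generated by `σ`, `ρ_0` and `τ_0` on all the pairs `⟨i; v⟩`. -/
def CPMGbar (m s n : ℕ) (r : (ZMod n)ˣ) : Subgroup (Equiv.Perm (CPMVertex m s n)) :=
  Subgroup.closure {sigmaBar r, rhoBar 0, tauBar 0}

/-- The group `G`: the automorphisms of `CPM(m, s, n; r)` that are restrictions of elements of
`CPMGbar m s n r` (which then preserve the vertex set of `CPM(m, s, n; r)`). -/
def CPMG (m s n : ℕ) (r : (ZMod n)ˣ) : Subgroup (CPMAut m s n r) where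
  carrier := {φ | ∃ g ∈ CPMGbar m s n r, ∀ x : CPMSet m s n r, g x = φ x}
  mul_mem' := by
    rintro φ ψ ⟨g, hg, hφ⟩ ⟨h, hh, hψ⟩
    refine ⟨g * h, mul_mem hg hh, fun x => ?_⟩
    rw [Equiv.Perm.mul_apply, hψ, hφ]
    rfl
  one_mem' := ⟨1, one_mem _, fun _ => rfl⟩
  inv_mem' := by
    rintro φ ⟨g, hg, hφ⟩
    refine ⟨g⁻¹, inv_mem hg, fun x => ?_⟩
    rw [Equiv.Perm.inv_eq_iff_eq, hφ]
    exact congrArg Subtype.val (φ.apply_symm_apply x).symm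

end HalfArcTransitiveGroup

section Involution

variable {m s n : ℕ} {r : (ZMod n)ˣ}

/-- For `k` odd and `q` a unit, the map
`(x, y, z) ↦ (y - q z, 2⁻¹ (x + y + q z), 2⁻¹ (z - q⁻¹ x + q⁻¹ y))` of `ℤ_k^3`. -/
def cpmBeta {k : ℕ} (q : ZMod k) (u : ZMod k × ZMod k × ZMod k) : ZMod k × ZMod k × ZMod k :=
  let (x, y, z) := u
  (y - q * z, 2⁻¹ * (x + y + q * z), 2⁻¹ * (z - q⁻¹ * x + q⁻¹ * y))

/-- The 4-cycle `0, 1, 2, 3` of `ℤ_4` as the 2-cube: `gray` of `(0,0), (1,0), (1,1), (0,1)` is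
`0, 1, 2, 3`. -/
def gray : Bool → Bool → ZMod 4
  | false, false => 0
  | true, false => 1
  | true, true => 2
  | false, true => 3

/-- The first coordinate of the inverse of `gray`. -/
def grayFst (a : ZMod 4) : Bool := a = 1 || a = 2

/-- The second coordinate of the inverse of `gray`. -/
def graySnd (a : ZMod 4) : Bool := a = 2 || a = 3

/-- Is `a ∈ ℤ_4` odd? -/
def oddFour (a : ZMod 4) : Bool := a = 1 || a = 3

/-- The involution `ν_4` of the 4-cube `CPM(2, 2, 4; 1)`, whose vertices are written as
`(x, y, z) ∈ ℤ_4^3`. In a vertex, `y` is odd if and only if `x ∈ {1, 2}` and `z` is odd if and only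
if `x ∈ {2, 3}`; thus `y` and `z` determine `x = gray (oddFour y) (oddFour z)`. Through
`y = gray a b`, `z = gray c d` the graph is the 4-cube on the quadruples `(a, b, c, d)`, and `ν_4`
is the reflection interchanging `b` and `c`. It fixes the vertices `(0,0,0)`, `(1,1,0)`, `(3,0,3)`
and interchanges `(1,3,0)` with `(3,0,1)`. -/
def nuFour (u : ZMod 4 × ZMod 4 × ZMod 4) : ZMod 4 × ZMod 4 × ZMod 4 :=
  let (_, y, z) := u
  let y' := gray (grayFst y) (grayFst z)
  let z' := gray (graySnd y) (graySnd z)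
  (gray (oddFour y') (oddFour z'), y', z')

/-- For `s = 2`: the triple `(i, v_0, v_1)`, for `x = ⟨i; (v_0, v_1)⟩`, with all its entries reduced
modulo `k`. -/
def cpmTriple (k : ℕ) (x : CPMVertex m s n) : ZMod k × ZMod k × ZMod k :=
  (x.1.cast, (x.2 0).cast, (x.2 1).cast)

/-- The involution of `CPM(n, 2, n; r)`, `n` odd, `r² = ± 1`: identifying `i ∈ ℤ_{2n}` with
`(i mod 2, i mod n)`, it is `⟨e; u⟩ ↦ ⟨e; β u⟩` for `e ∈ ℤ_2`, `u ∈ ℤ_n^3`, where `β` is the map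
`cpmBeta` for `q = r⁻¹`. (For `r = 1` this is `ν` itself; for the other `r` it is the conjugate of
the one for `r = 1` by the isomorphism `⟨i; (v_0, v_1)⟩ ↦ ⟨i; (v_0, r v_1)⟩` of `CPM(n, 2, n; 1)`
onto `CPM(n, 2, n; r)`.) -/
def IsNuOdd (ν : CPMAut m s n r) : Prop :=
  ∀ x : CPMSet m s n r,
    ((ν x).1.1.cast : ZMod 2) = x.1.1.cast ∧
    cpmTriple n (ν x).1 = cpmBeta ((r⁻¹ : (ZMod n)ˣ) : ZMod n) (cpmTriple n x.1)

/-- The residue modulo `k` of whichever of `r`, `-r` is `3` modulo `4` (where `4k = n`). -/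
def nuEvenQ (k : ℕ) (r : (ZMod n)ˣ) : ZMod k :=
  if ((r : ZMod n).cast : ZMod 4) = 3 then (r : ZMod n).cast else -(r : ZMod n).cast

/-- The involution of `CPM(m, 2, 2m; r)`, `m = 2k`, `k` odd, `r² + 1 = m`: on the vertices written
as triples in `ℤ_{4k}^3`, it acts as `ν_4` modulo `4` and as `β` modulo `k`, where `β` is the map
`cpmBeta` for `q ≡ ± r`, the sign being such that `± r ≡ 3 (mod 4)`. -/
def IsNuEven (k : ℕ) (ν : CPMAut m s n r) : Prop :=
  ∀ x : CPMSet m s n r,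
    cpmTriple 4 (ν x).1 = nuFour (cpmTriple 4 x.1) ∧
    cpmTriple k (ν x).1 = cpmBeta (nuEvenQ k r) (cpmTriple k x.1)

/-- The involution of `CPM(1, 2, 4; ± 1)`: it is `ν_4`, carried over by the isomorphism
`⟨i; v⟩ ↦ ⟨i mod 2; v⟩` of `CPM(2, 2, 4; ± 1)` onto `CPM(1, 2, 4; ± 1)`. So `⟨i; v⟩` is the image of
`⟨j; v⟩`, where the residue `j ∈ ℤ_4` is determined by the parities of `v_0` and `v_1`
and is not used by `nuFour`. -/
def IsNuCube (ν : CPMAut m s n r) : Prop :=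
  ∀ x : CPMSet m s n r,
    let w := nuFour (cpmTriple 4 x.1)
    ((ν x).1.1.cast : ZMod 2) = w.1.cast ∧
    (((ν x).1.2 0).cast : ZMod 4) = w.2.1 ∧ (((ν x).1.2 1).cast : ZMod 4) = w.2.2

end Involution

/-!
The graph `CPM(m, s, n; r)` has valency 4, and its full cover is `ℤ × ℤ_n^s`, where the first
coordinate, the height, is not reduced modulo `m s`. A walk is a word of steps (up or down, with a
sign), and a word is closed if and only if its net height is a multiple of `m s` and certain
polynomials with small integral coefficients vanish at `r ^ s` (`CPMVertex.closed_iff`).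

*Restriction of `s` and of `r`.* If the graph is 2-arc-transitive, then whether and how the
extensions of a 2-arc lie on closed walks of a given length without backtracking does not depend
on the 2-arc (`CPMVertex.exists_ext_map`). There always are closed walks of length 8 with the
shape of a commutator, which treat the 2-arcs that go down and up again differently from the
directed ones. The comparison of the closed walks of length 4, 6 and 8 through the various 2-arcs
yields `s = 2` (`CPMVertex.eq_two`), `m ≤ 2` if `n = 4`, and `2 r ^ 2 = ±2` if `n ≠ 4`
(`CPMVertex.twoSq`).

*Four colours.* Let `s = 2` and let `κ = ±r ^ 2` satisfy `2 κ = 2` and `κ ^ m = 1`. An edge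
changes one of the two coordinates, and after division by a weight `κ ^ j` or `κ ^ j r` it does so
by `±1`; this colours the edges with four colours such that the steps along three edges of
different colours have an involution as their product. So a path with three different colours lies
on a hexagon. It follows that the graph itself tells whether the first and the last edge of a path
of length 3 have the same colour, and automorphisms permute the colours
(`SimpleGraph.RigidColouring`, `CPMVertex.exists_rigidColouring`). An automorphism is therefore
determined by the image of one vertex and a permutation of the four colours. The maps `τ` induce
transpositions, 2-arc-transitivity makes all the transpositions conjugate, and the stabilizer of a
vertex is the symmetric group of degree 4, of order 24. The automorphism `ν` that fixes `⟨0; 0⟩`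
and interchanges one colour of each of the two coordinates is an involution and, together with
`G`, generates everything (`CPMVertex.exists_acts_and_closure`).

*The parameters and `ν`.* The automorphism `ν` maps coloured walks from `⟨0; 0⟩` to the walks with
permuted colours, and a walk is closed if and only if its image is. Two series of such walks give
the equations that determine the parameters (`CPMVertex.parameters`). Finally `β` modulo an odd
number with `κ = 1`, and `ν₄` modulo 4 with `κ = -1`, permute the colours as `ν` does, so that
they agree with `ν` by induction along the edges (`CPMVertex.isNuOdd_of_acts`,
`CPMVertex.isNuEven_of_acts`, `CPMVertex.isNuCube_of_acts`). For `m = 1` and `n = 4` the graph is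
the 4-cube, whose colouring by directions takes the place of the one above
(`CPMVertex.cubeColouring`).
-/

/-! ### The cover of the graph -/

/-- The closed walk `p` of length `k` in `Γ` without backtracking (cyclically) begins with
`x₀, …, x₄`. The walk is encoded as a `k`-periodic sequence of vertices. -/
def SimpleGraph.NBCycle {V : Type*} (Γ : SimpleGraph V) (k : ℕ) (x₀ x₁ x₂ x₃ x₄ : V) : Prop :=
  ∃ p : ℕ → V, (∀ i, Γ.Adj (p i) (p (i + 1))) ∧ (∀ i, p i ≠ p (i + 2)) ∧ (∀ i, p (i + k) = p i) ∧
    p 0 = x₀ ∧ p 1 = x₁ ∧ p 2 = x₂ ∧ p 3 = x₃ ∧ p 4 = x₄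

namespace CPMVertex

/-- The standing assumptions on the parameters of the graph `CPM(m, s, n; r)`. -/
structure Admissible (m s n : ℕ) (r : (ZMod n)ˣ) : Prop where
  hm : 1 ≤ m
  hs : 2 ≤ s
  hn : 3 ≤ n
  hr : r ^ (m * s) = 1 ∨ r ^ (m * s) = -1

/-- A step of a walk: the first component tells whether the step goes up (from level `h` to level
`h + 1`), the second one is the sign of the displacement. -/
abbrev Step := Bool × Bool

/-- The sign encoded by a Boolean. -/
def sg (b : Bool) : ℤ := if b then 1 else -1

/-- The inverse of a step. -/
def rev (t : Step) : Step := (!t.1, !t.2)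

/-- The level of the edge traversed by the step `t` from height `h`. -/
def lvl (t : Step) (h : ℤ) : ℤ := if t.1 then h else h - 1

/-- The height after the step `t` from height `h`. -/
def nxt (t : Step) (h : ℤ) : ℤ := if t.1 then h + 1 else h - 1

/-- The step `t` on the cover `ℤ × ℤ_n^s`, where the first coordinate `i ∈ ℤ_{ms}` of a vertex is
lifted to `ℤ`. -/
def move {s n : ℕ} (r : (ZMod n)ˣ) (t : Step) (X : ℤ × (ZMod s → ZMod n)) :
    ℤ × (ZMod s → ZMod n) :=
  (nxt t X.1,
    X.2 + Pi.single (lvl t X.1 : ZMod s)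
      ((sg t.2 : ZMod n) * ((r ^ lvl t X.1 : (ZMod n)ˣ) : ZMod n)))

/-- The projection of the cover `ℤ × ℤ_n^s` onto the vertices. -/
def proj (m : ℕ) {s n : ℕ} (X : ℤ × (ZMod s → ZMod n)) : CPMVertex m s n :=
  ((X.1 : ZMod (m * s)), X.2)

variable {m s n : ℕ} {r : (ZMod n)ˣ}

theorem proj_surjective (x : CPMVertex m s n) : ∃ X, proj m X = x :=
  ⟨((x.1.cast : ℤ), x.2), Prod.ext (by simp [proj]) rfl⟩

@[simp] theorem move_rev (t : Step) (X : ℤ × (ZMod s → ZMod n)) :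
    move r (rev t) (move r t X) = X := by
  rcases t with ⟨_ | _, _ | _⟩ <;> ext <;> simp [move, rev, nxt, lvl, sg, Pi.single_apply] <;>
    split_ifs <;> simp

theorem Admissible.neZero (H : Admissible m s n r) : NeZero (m * s) :=
  ⟨Nat.mul_ne_zero (by have := H.hm; omega) (by have := H.hs; omega)⟩

/-- Since `r ^ (m s) = ±1`, the unit `r ^ h`, `h ∈ ℤ`, depends up to sign only on `h` modulo
`m s`. -/
theorem Admissible.pow_val (H : Admissible m s n r) (h : ℤ) :
    r ^ ((h : ZMod (m * s)).val) = r ^ h ∨ r ^ ((h : ZMod (m * s)).val) = -r ^ h := by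
  have := H.neZero
  have h1 : (((h : ZMod (m * s)).val : ℕ) : ℤ) = h % ((m * s : ℕ) : ℤ) := ZMod.val_intCast h
  have h2 : r ^ h = r ^ ((h : ZMod (m * s)).val) * (r ^ (m * s)) ^ (h / ((m * s : ℕ) : ℤ)) := by
    rw [← zpow_natCast r, h1, ← zpow_natCast r (m * s), ← zpow_mul, ← zpow_add,
      Int.emod_add_mul_ediv]
  rcases H.hr with h3 | h3
  · left; rw [h2, h3]; simp
  · rw [h2, h3]
    rcases Int.even_or_odd (h / ((m * s : ℕ) : ℤ)) with h4 | h4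
    · left; rw [h4.neg_one_zpow]; simp
    · right; rw [h4.neg_one_zpow]; simp

/-- The two displacements of the edges that go up from the residue of `h` are those of the steps
that go up from the height `h`. -/
theorem single_lift (H : Admissible m s n r) (h : ℤ) (v w : ZMod s → ZMod n) :
    (w = v + Pi.single ((h : ZMod (m * s)).cast : ZMod s) ((r : ZMod n) ^ (h : ZMod (m * s)).val) ∨
     w = v - Pi.single ((h : ZMod (m * s)).cast : ZMod s) ((r : ZMod n) ^ (h : ZMod (m * s)).val)) ↔
    ∃ b, w = v + Pi.single (h : ZMod s) ((sg b : ZMod n) * ((r ^ h : (ZMod n)ˣ) : ZMod n)) := by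
  have h1 : ((h : ZMod (m * s)).cast : ZMod s) = h := ZMod.cast_intCast (Dvd.intro_left m rfl) h
  rw [h1, ← Units.val_pow_eq_pow_val]
  rcases H.pow_val h with h2 | h2 <;> rw [h2] <;> simp [sg, sub_eq_add_neg, Pi.single_neg, or_comm]

/-- The neighbours of the projection of `X` are the projections of the ends of the steps from `X`.
-/
theorem adj_proj_iff (H : Admissible m s n r) (X : ℤ × (ZMod s → ZMod n)) (y : CPMVertex m s n) :
    (CPMbar m s n r).Adj (proj m X) y ↔ ∃ t, y = proj m (move r t X) := by
  have h1 : Fact (1 < m * s) := ⟨by nlinarith [H.hm, H.hs]⟩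
  have hup : IsNext r (proj m X) y ↔ ∃ b, y = proj m (move r (true, b) X) := by
    rw [IsNext, proj, single_lift H]
    simp [move, proj, nxt, lvl, Prod.ext_iff]
  have hdown : IsNext r y (proj m X) ↔ ∃ b, y = proj m (move r (false, b) X) := by
    rw [IsNext, proj]
    have key : ((X.1 : ZMod (m * s)) = y.1 + 1) ↔ y.1 = ((X.1 - 1 : ℤ) : ZMod (m * s)) := by
      push_cast; rw [eq_sub_iff_add_eq, eq_comm]
    simp only [key]
    constructor
    · rintro ⟨h2, h3⟩
      rw [h2] at h3
      obtain ⟨b, hb⟩ := (single_lift H _ _ _).1 h3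
      refine ⟨!b, Prod.ext h2 ?_⟩
      simp only [proj, move, lvl, hb]
      cases b <;> simp [sg, Pi.single_neg]
    · rintro ⟨b, hb⟩
      have h2 : y.1 = ((X.1 - 1 : ℤ) : ZMod (m * s)) := by rw [hb]; simp [proj, move, nxt]
      refine ⟨h2, ?_⟩
      rw [h2]
      refine (single_lift H _ _ _).2 ⟨!b, ?_⟩
      rw [hb]
      simp only [proj, move, lvl]
      cases b <;> simp [sg, Pi.single_neg]
  rw [CPMbar, SimpleGraph.fromRel_adj, hup, hdown]
  constructor
  · rintro ⟨-, ⟨b, hb⟩ | ⟨b, hb⟩⟩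
    exacts [⟨_, hb⟩, ⟨_, hb⟩]
  · rintro ⟨⟨_ | _, b⟩, hb⟩
    · refine ⟨fun h => ?_, Or.inr ⟨b, hb⟩⟩
      have := congrArg Prod.fst (h.trans hb)
      simp [proj, move, nxt, eq_sub_iff_add_eq] at this
    · refine ⟨fun h => ?_, Or.inl ⟨b, hb⟩⟩
      have := congrArg Prod.fst (h.trans hb)
      simp [proj, move, nxt] at this

theorem adj_move (H : Admissible m s n r) (X : ℤ × (ZMod s → ZMod n)) (t : Step) :
    (CPMbar m s n r).Adj (proj m X) (proj m (move r t X)) :=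
  (adj_proj_iff H X _).2 ⟨t, rfl⟩

/-- Edges going up and edges going down from a vertex change different coordinates. -/
theorem fst_eq_of_proj_move_eq (H : Admissible m s n r) {X Y : ℤ × (ZMod s → ZMod n)} {t t' : Step}
    (hXY : proj m X = proj m Y) (h : proj m (move r t X) = proj m (move r t' Y)) : t.1 = t'.1 := by
  have : Fact (1 < s) := ⟨H.hs⟩
  have : Fact (1 < n) := ⟨by have := H.hn; omega⟩
  have h2 : X.2 = Y.2 := (Prod.ext_iff.1 hXY).2
  have h1 : (X.1 : ZMod s) = (Y.1 : ZMod s) := by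
    have h3 : (X.1 : ZMod (m * s)) = (Y.1 : ZMod (m * s)) := (Prod.ext_iff.1 hXY).1
    have h4 := congrArg (ZMod.castHom (Dvd.intro_left m rfl : s ∣ m * s) (ZMod s)) h3
    simpa using h4
  have h3 := congrArg Prod.snd h
  simp only [proj, move, h2, add_right_inj] at h3
  have hne : ∀ (b : Bool) (L : ℤ), (sg b : ZMod n) * ((r ^ L : (ZMod n)ˣ) : ZMod n) ≠ 0 := by
    intro b L; cases b <;> simp [sg]
  by_contra hne'
  have h4 := congrFun h3 (lvl t X.1 : ZMod s)
  rw [Pi.single_eq_same, Pi.single_eq_of_ne] at h4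
  · exact hne _ _ h4
  · rcases t with ⟨_ | _, _⟩ <;> rcases t' with ⟨_ | _, _⟩ <;>
      simp [lvl, h1, eq_sub_iff_add_eq] at hne' ⊢

/-- The graph is regular of valency 4: as `n ≥ 3`, different steps lead to different vertices. -/
theorem step_eq_of_proj_move_eq (H : Admissible m s n r) {X : ℤ × (ZMod s → ZMod n)} {t t' : Step}
    (h : proj m (move r t X) = proj m (move r t' X)) : t = t' := by
  have h1 := fst_eq_of_proj_move_eq H rfl h
  refine Prod.ext h1 ?_
  have h3 := congrArg Prod.snd h
  simp only [proj, move, add_right_inj, lvl, h1, Pi.single_inj, Units.mul_left_inj] at h3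
  have h2 : ((2 : ℕ) : ZMod n) ≠ 0 := by
    rw [Ne, ZMod.natCast_eq_zero_iff]
    intro h5; have := Nat.le_of_dvd (by norm_num) h5; have := H.hn; omega
  rcases t with ⟨_, _ | _⟩ <;> rcases t' with ⟨_, _ | _⟩ <;> simp [sg] at h3 ⊢
  · exact h2 (by push_cast; linear_combination -h3)
  · exact h2 (by push_cast; linear_combination h3)

theorem proj_move_move_eq_iff (H : Admissible m s n r) {X : ℤ × (ZMod s → ZMod n)} {t t' : Step} :
    proj m (move r t' (move r t X)) = proj m X ↔ t' = rev t := by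
  constructor
  · intro h
    apply step_eq_of_proj_move_eq H
    rw [h, move_rev]
  · rintro rfl; rw [move_rev]

end CPMVertex

/-! ### Walks as words of steps -/

namespace CPMVertex

/-- The end of the walk with steps `w` that starts at `X`, on the cover. -/
def run {s n : ℕ} (r : (ZMod n)ˣ) : List Step → ℤ × (ZMod s → ZMod n) → ℤ × (ZMod s → ZMod n)
  | [], X => X
  | t :: w, X => run r w (move r t X)

/-- The levels of the edges of a walk from height `h`, with the signs of their displacements. -/
def lvls : ℤ → List Step → List (ℤ × ℤ)
  | _, [] => []
  | h, t :: w => (lvl t h, sg t.2) :: lvls (nxt t h) w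

/-- The difference of the heights of the end and of the start of a walk. -/
def net : List Step → ℤ
  | [] => 0
  | t :: w => sg t.1 + net w

/-- The sum of the signs of the steps of `w` at level `L`, for a walk that starts at height `0`. -/
def coef (w : List Step) (L : ℤ) : ℤ := ((lvls 0 w).map fun p => if p.1 = L then p.2 else 0).sum

/-- The walk with steps `w` is closed in the graph on all the pairs `⟨i; v⟩`. By vertex-transitivity
this does not depend on its start, so height `0` is used. -/
def Closed (m s n : ℕ) (r : (ZMod n)ˣ) (w : List Step) : Prop :=
  ((m * s : ℕ) : ℤ) ∣ net w ∧ ∀ c : ZMod s, ((lvls 0 w).map fun p =>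
    if (p.1 : ZMod s) = c then (p.2 : ZMod n) * ((r ^ p.1 : (ZMod n)ˣ) : ZMod n) else 0).sum = 0

/-- No step of `w` is followed by its inverse. -/
def nb : List Step → Bool
  | t :: t' :: w => t' != rev t && nb (t' :: w)
  | _ => true

/-- The walk `w` does not backtrack, not even at its ends if they have the same height. -/
def good (w : List Step) : Bool :=
  nb w && (net w != 0 || w.head? != w.getLast?.map rev)

variable {m s n : ℕ} {r : (ZMod n)ˣ}

theorem run_append (w w' : List Step) (X : ℤ × (ZMod s → ZMod n)) :
    run r (w ++ w') X = run r w' (run r w X) := by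
  induction w generalizing X with
  | nil => rfl
  | cons t w ih => exact ih _

theorem run_fst (w : List Step) (X : ℤ × (ZMod s → ZMod n)) : (run r w X).1 = X.1 + net w := by
  induction w generalizing X with
  | nil => simp [run, net]
  | cons t w ih =>
    rw [run, ih, net]
    rcases t with ⟨_ | _, _⟩ <;> simp [move, nxt, sg] <;> ring

theorem lvls_add (w : List Step) (h k : ℤ) :
    lvls (h + k) w = (lvls h w).map fun p => (p.1 + k, p.2) := by
  induction w generalizing h with
  | nil => rfl
  | cons t w ih =>
    have h1 : nxt t (h + k) = nxt t h + k := by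
      rcases t with ⟨_ | _, _⟩ <;> simp [nxt] <;> ring
    have h2 : lvl t (h + k) = lvl t h + k := by
      rcases t with ⟨_ | _, _⟩ <;> simp [lvl]; ring
    rw [lvls, lvls, h1, h2, ih, List.map_cons]

/-- The displacement of a walk from the height `h` is, up to a shift of the coordinates, `r ^ h`
times that of the walk from the height `0`. -/
theorem run_snd (w : List Step) (X : ℤ × (ZMod s → ZMod n)) (c : ZMod s) :
    (run r w X).2 (c + X.1) = X.2 (c + X.1) + ((r ^ X.1 : (ZMod n)ˣ) : ZMod n) *
      ((lvls 0 w).map fun p => if (p.1 : ZMod s) = c then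
        (p.2 : ZMod n) * ((r ^ p.1 : (ZMod n)ˣ) : ZMod n) else 0).sum := by
  have key : ∀ (w : List Step) (X : ℤ × (ZMod s → ZMod n)) (c : ZMod s),
      (run r w X).2 c = X.2 c + ((lvls X.1 w).map fun p => if (p.1 : ZMod s) = c then
        (p.2 : ZMod n) * ((r ^ p.1 : (ZMod n)ˣ) : ZMod n) else 0).sum := by
    intro w
    induction w with
    | nil => intro X c; simp [run, lvls]
    | cons t w ih =>
      intro X c
      rw [run, ih, lvls, List.map_cons, List.sum_cons, ← add_assoc]
      congr 1
      simp [move, Pi.single_apply, eq_comm]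
  rw [key, ← zero_add X.1, lvls_add, zero_add, List.map_map, ← List.sum_map_mul_left]
  congr 3
  funext p
  simp only [Function.comp]
  push_cast
  simp only [add_left_inj, zpow_add, Units.val_mul]
  split_ifs <;> ring

theorem proj_run_eq_iff (w : List Step) (X : ℤ × (ZMod s → ZMod n)) :
    proj m (run r w X) = proj m X ↔ Closed m s n r w := by
  rw [Closed, proj, proj, Prod.ext_iff, run_fst]
  refine and_congr ?_ ?_
  · rw [← ZMod.intCast_zmod_eq_zero_iff_dvd]; simp
  · constructor
    · intro h c
      have h1 := run_snd (r := r) w X c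
      simp only at h
      rw [h, left_eq_add] at h1
      exact (Units.mul_right_eq_zero _).1 h1
    · intro h
      funext c
      have h1 := run_snd (r := r) w X (c - X.1)
      rw [h, sub_add_cancel] at h1
      simpa using h1

theorem run_eq_of_closed {w : List Step} (hw : Closed m s n r w) (h0 : net w = 0)
    (X : ℤ × (ZMod s → ZMod n)) : run r w X = X :=
  Prod.ext (by rw [run_fst, h0, add_zero]) (Prod.ext_iff.1 ((proj_run_eq_iff (m := m) w X).2 hw)).2

theorem run_take_succ (w : List Step) (X : ℤ × (ZMod s → ZMod n)) {i : ℕ} (hi : i < w.length) :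
    run r (w.take (i + 1)) X = move r w[i] (run r (w.take i) X) := by
  rw [List.take_succ_eq_append_getElem hi, run_append]; rfl

theorem nb_iff (w : List Step) :
    nb w = true ↔ ∀ (i : ℕ) (h : i + 1 < w.length), w[i + 1] ≠ rev w[i] := by
  induction w with
  | nil => simp [nb]
  | cons t w ih =>
    cases w with
    | nil => simp [nb]
    | cons t' w =>
      rw [nb, Bool.and_eq_true, ih]
      constructor
      · rintro ⟨h1, h2⟩ (_ | i) h
        · simpa using h1
        · exact h2 i (by simpa using h)
      · intro h
        refine ⟨by simpa using h 0 (by simp), fun i hi => ?_⟩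
        exact h (i + 1) (by simpa using hi)

/-- A closed word without backtracking yields a closed walk without backtracking. The condition
`hends` excludes backtracking at the start: the first and the last step either have the same
direction, or the word returns to the same height and its ends are not inverse to each other. -/
theorem nbCycle_of_closed (H : Admissible m s n r) (w : List Step) (hk : 4 ≤ w.length)
    (hw : Closed m s n r w) (hnb : nb w = true)
    (hends : (w.head?.map Prod.fst = w.getLast?.map Prod.fst) ∨
      (net w = 0 ∧ w.head? ≠ w.getLast?.map rev))
    (X : ℤ × (ZMod s → ZMod n)) :
    (CPMbar m s n r).NBCycle w.length (proj m X) (proj m (run r (w.take 1) X))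
      (proj m (run r (w.take 2) X)) (proj m (run r (w.take 3) X)) (proj m (run r (w.take 4) X)) := by
  set k := w.length with hkdef
  set f : ℕ → CPMVertex m s n := fun i => proj m (run r (w.take i) X) with hf
  have hfk : f k = f 0 := by
    simp only [hf, hkdef, List.take_length, List.take_zero]
    exact (proj_run_eq_iff w X).2 hw
  have hadj : ∀ i, i < k → (CPMbar m s n r).Adj (f i) (f (i + 1)) := by
    intro i hi
    simp only [hf]
    rw [run_take_succ w X hi]
    exact adj_move H _ _
  have hnb' : ∀ i, i + 1 < k → f i ≠ f (i + 2) := by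
    intro i hi h
    simp only [hf] at h
    rw [run_take_succ w X hi, run_take_succ w X (by omega)] at h
    exact (nb_iff w).1 hnb i hi ((proj_move_move_eq_iff H).1 h.symm)
  have hwrap : f (k - 1) ≠ f 1 := by
    intro h
    have h0 : 0 < w.length := by omega
    have hl : w.head? = some (w[0]) := by rw [List.head?_eq_getElem?, List.getElem?_eq_getElem h0]
    have hlast : w.getLast? = some (w[k - 1]'(by omega)) := by
      rw [List.getLast?_eq_getElem?, List.getElem?_eq_getElem]
    have e1 : run r (w.take 1) X = move r w[0] X := by
      rw [run_take_succ w X h0]; rfl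
    have e2 : run r w X = move r (w[k - 1]'(by omega)) (run r (w.take (k - 1)) X) := by
      rw [← run_take_succ w X (by omega), show k - 1 + 1 = k by omega, List.take_length]
    have e3 : run r (w.take (k - 1)) X = move r (rev (w[k - 1]'(by omega))) (run r w X) := by
      rw [e2, move_rev]
    simp only [hf] at h
    rw [e1, e3] at h
    rw [hl, hlast] at hends
    rcases hends with hends | ⟨hn, hends⟩
    · have := fst_eq_of_proj_move_eq H ((proj_run_eq_iff w X).2 hw) h
      simp [rev] at this hends
      rw [← hends] at this
      simp at this
    · rw [run_eq_of_closed hw hn] at h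
      exact hends (by rw [← step_eq_of_proj_move_eq H h]; rfl)
  -- The sequence `f` on `0, …, k - 1` is continued periodically.
  have hmod : ∀ i, (i % k + 1 < k ∧ (i + 1) % k = i % k + 1) ∨ (i % k = k - 1 ∧ (i + 1) % k = 0) := by
    intro i
    have h1 : i % k < k := Nat.mod_lt _ (by omega)
    have h2 : (i + 1) % k = (i % k + 1) % k := by rw [Nat.mod_add_mod]
    rcases Nat.lt_or_ge (i % k + 1) k with h3 | h3
    · left; exact ⟨h3, by rw [h2, Nat.mod_eq_of_lt h3]⟩
    · right
      have h4 : i % k + 1 = k := by omega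
      exact ⟨by omega, by rw [h2, h4, Nat.mod_self]⟩
  have hsmall : ∀ i, i ≤ 4 → f (i % k) = f i := by
    intro i hi
    rcases Nat.lt_or_ge i k with h | h
    · rw [Nat.mod_eq_of_lt h]
    · have : i = k := by omega
      rw [this, Nat.mod_self, hfk]
  refine ⟨fun i => f (i % k), fun i => ?_, fun i => ?_, fun i => ?_, hsmall 0 (by omega),
    hsmall 1 (by omega), hsmall 2 (by omega), hsmall 3 (by omega), hsmall 4 (by omega)⟩
  · rcases hmod i with ⟨h1, h2⟩ | ⟨h1, h2⟩ <;> simp only [h1, h2]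
    · exact hadj _ (by omega)
    · have := hadj (k - 1) (by omega)
      rwa [show k - 1 + 1 = k by omega, hfk] at this
  · rcases hmod i with ⟨h1, h2⟩ | ⟨h1, h2⟩ <;> rcases hmod (i + 1) with ⟨h3, h4⟩ | ⟨h3, h4⟩ <;>
      simp only [h4]
    · rw [h2]; exact hnb' _ h1
    · have := hnb' (i % k) h1
      rwa [show i % k + 2 = k by omega, hfk] at this
    · rw [h1, h2]; exact hwrap
    · omega
  · simp

/-- A closed walk without backtracking is described by a closed word without backtracking. -/
theorem exists_word_of_nbCycle (H : Admissible m s n r) {k : ℕ} {x₀ x₁ x₂ x₃ x₄ : CPMVertex m s n}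
    (h : (CPMbar m s n r).NBCycle k x₀ x₁ x₂ x₃ x₄) (hk : 1 ≤ k) {X : ℤ × (ZMod s → ZMod n)}
    (hX : x₀ = proj m X) :
    ∃ t : ℕ → Step, x₁ = proj m (run r [t 0] X) ∧ x₂ = proj m (run r [t 0, t 1] X) ∧
      x₃ = proj m (run r [t 0, t 1, t 2] X) ∧ x₄ = proj m (run r [t 0, t 1, t 2, t 3] X) ∧
      Closed m s n r ((List.range k).map t) ∧ good ((List.range k).map t) = true := by
  obtain ⟨p, h1, h2, h3, rfl, rfl, rfl, rfl, rfl⟩ := h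
  have hstep : ∀ (i : ℕ) (Y : ℤ × (ZMod s → ZMod n)), ∃ t, p i = proj m Y →
      p (i + 1) = proj m (move r t Y) := by
    intro i Y
    by_cases hi : p i = proj m Y
    · obtain ⟨t, ht⟩ := (adj_proj_iff H Y (p (i + 1))).1 (hi ▸ h1 i)
      exact ⟨t, fun _ => ht⟩
    · exact ⟨(true, true), fun h => absurd h hi⟩
  choose g hg using hstep
  let Y : ℕ → ℤ × (ZMod s → ZMod n) := fun i => Nat.rec X (fun i Z => move r (g i Z) Z) i
  let t : ℕ → Step := fun i => g i (Y i)
  have hY : ∀ i, Y (i + 1) = move r (t i) (Y i) := fun i => rfl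
  have hp : ∀ i, p i = proj m (Y i) := by
    intro i
    induction i with
    | zero => exact hX
    | succ i ih => rw [hY]; exact hg i _ ih
  have hrun : ∀ i, run r ((List.range i).map t) X = Y i := by
    intro i
    induction i with
    | zero => rfl
    | succ i ih =>
      rw [List.range_succ, List.map_append, run_append, ih]; rfl
  have hclosed : Closed m s n r ((List.range k).map t) := by
    rw [← proj_run_eq_iff _ X, hrun, ← hp, ← zero_add k, h3, hX]
  have hrev : ∀ i, t (i + 1) ≠ rev (t i) := by
    intro i hi
    apply h2 i
    rw [hp i, hp (i + 2), hY, hY, hi, move_rev]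
  refine ⟨t, hp 1, hp 2, hp 3, hp 4, hclosed, ?_⟩
  rw [good, Bool.and_eq_true]
  constructor
  · rw [nb_iff]
    intro i hi
    simpa using hrev i
  · by_cases h0 : net ((List.range k).map t) = 0
    · have hk' : Y k = X := by rw [← hrun, run_eq_of_closed hclosed h0]
      have htk : t k = t 0 := by
        apply step_eq_of_proj_move_eq H (X := X)
        rw [show move r (t 0) X = Y 1 from rfl, ← hp 1, ← h3 1, hp, add_comm, hY, hk']
      obtain ⟨j, rfl⟩ : ∃ j, k = j + 1 := ⟨k - 1, by omega⟩
      have := hrev j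
      rw [htk] at this
      simp [List.head?_map, List.range_succ]
      cases j <;> simpa [List.range_succ_eq_map] using Or.inr this
    · simp [h0]

end CPMVertex

/-! ### Closed walks and polynomial equations -/

namespace CPMVertex

/-- The value at `q` of the polynomial with the coefficients `l`. -/
def ev {R : Type*} [CommRing R] (q : R) : List ℤ → R
  | [] => 0
  | a :: l => (a : R) + q * ev q l

/-- Deletion of the leading zeros. -/
def dropZeros : List ℤ → List ℤ
  | [] => []
  | a :: l => if a = 0 then dropZeros l else a :: l

/-- Deletion of the leading and trailing zeros of a list of coefficients, followed by a change of
sign if the first remaining coefficient is negative. -/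
def normalize (l : List ℤ) : List ℤ :=
  let t := (dropZeros (dropZeros l).reverse).reverse
  if t.headD 0 < 0 then t.map (- ·) else t

/-- The coordinate of index `k` of the displacement of the word `w`, up to a unit, as a polynomial
in `r ^ s`: the coefficients are those of the levels `k + s j` with `-N ≤ j ≤ N`. -/
def classPoly (s N k : ℕ) (w : List Step) : List ℤ :=
  normalize ((List.range (2 * N + 1)).map fun j : ℕ => coef w ((k : ℤ) + s * ((j : ℤ) - N)))

/-- Every level of the word `w` other than `L` lies at distance less than `d` from `L`. -/
def lone (d : ℤ) (w : List Step) (L : ℤ) : Bool :=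
  (lvls 0 w).all fun p => p.1 == L || (decide (p.1 - L < d) && decide (L - p.1 < d))

variable {m s n : ℕ} {r : (ZMod n)ˣ}

section ev
variable {R : Type*} [CommRing R]

theorem ev_dropZeros (q : Rˣ) (l : List ℤ) : ev (q : R) (dropZeros l) = 0 ↔ ev (q : R) l = 0 := by
  induction l with
  | nil => rfl
  | cons a l ih =>
    rw [dropZeros]
    split_ifs with h
    · rw [ih, h, ev]; simp
    · rfl

theorem ev_append (q : R) (l l' : List ℤ) : ev q (l ++ l') = ev q l + q ^ l.length * ev q l' := by
  induction l with
  | nil => simp [ev]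
  | cons a l ih => rw [List.cons_append, ev, ih, ev, List.length_cons, pow_succ]; ring

theorem ev_reverse_dropZeros (q : R) (l : List ℤ) :
    ev q (dropZeros l).reverse = ev q l.reverse := by
  induction l with
  | nil => rfl
  | cons a l ih =>
    rw [dropZeros]
    split_ifs with h
    · rw [ih, h, List.reverse_cons, ev_append]; simp [ev]
    · rfl

theorem ev_neg (q : R) (l : List ℤ) : ev q (l.map (- ·)) = -ev q l := by
  induction l with
  | nil => simp [ev]
  | cons a l ih => rw [List.map_cons, ev, ev, ih]; push_cast; ring

theorem ev_normalize (q : Rˣ) (l : List ℤ) : ev (q : R) (normalize l) = 0 ↔ ev (q : R) l = 0 := by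
  have h : ev (q : R) (dropZeros (dropZeros l).reverse).reverse = 0 ↔ ev (q : R) l = 0 := by
    rw [ev_reverse_dropZeros, List.reverse_reverse, ev_dropZeros]
  rw [normalize]
  split_ifs
  · rw [ev_neg, neg_eq_zero, h]
  · exact h

theorem ev_map_range (q : R) (f : ℕ → ℤ) (N : ℕ) :
    ev q ((List.range N).map f) = ∑ j ∈ Finset.range N, (f j : R) * q ^ j := by
  induction N with
  | zero => simp [ev]
  | succ N ih =>
    rw [List.range_succ, List.map_append, ev_append, ih, Finset.sum_range_succ]
    simp [ev]; ring

end ev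

/-- If no other level of a closed word is congruent to `L` modulo `s`, then the coefficient of the
level `L` vanishes modulo `n`. -/
theorem Closed.dvd_coef {w : List Step} (hw : Closed m s n r w) (L : ℤ)
    (h : ∀ p ∈ lvls 0 w, p.1 = L ∨ ¬ (s : ℤ) ∣ p.1 - L) : (n : ℤ) ∣ coef w L := by
  have h1 := hw.2 (L : ZMod s)
  have h2 : ∀ l : List (ℤ × ℤ), (∀ p ∈ l, p.1 = L ∨ ¬ (s : ℤ) ∣ p.1 - L) →
      (l.map fun p => if (p.1 : ZMod s) = (L : ZMod s) then
        (p.2 : ZMod n) * ((r ^ p.1 : (ZMod n)ˣ) : ZMod n) else 0).sum =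
      (((l.map fun p => if p.1 = L then p.2 else 0).sum : ℤ) : ZMod n) *
        ((r ^ L : (ZMod n)ˣ) : ZMod n) := by
    intro l hl
    induction l with
    | nil => simp
    | cons p l ih =>
      rw [List.map_cons, List.sum_cons, ih fun p hp => hl p (List.mem_cons_of_mem _ hp),
        List.map_cons, List.sum_cons]
      rcases hl p List.mem_cons_self with h3 | h3
      · simp [h3]; ring
      · have h4 : p.1 ≠ L := by rintro rfl; simp at h3
        have h5 : (p.1 : ZMod s) ≠ (L : ZMod s) := by
          intro h5
          apply h3
          rw [← ZMod.intCast_zmod_eq_zero_iff_dvd]; push_cast; rw [h5, sub_self]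
        simp [h4, h5]
  rw [h2 _ h] at h1
  rw [← ZMod.intCast_zmod_eq_zero_iff_dvd]
  exact (Units.mul_left_eq_zero _).1 h1

theorem Closed.dvd_of_lone {w : List Step} (hw : Closed m s n r w) {L d : ℤ} (hd : d ≤ s)
    (h : lone d w L = true) : (n : ℤ) ∣ coef w L := by
  refine hw.dvd_coef L fun p hp => ?_
  have h1 := List.all_eq_true.1 h p hp
  simp only [Bool.or_eq_true, beq_iff_eq, Bool.and_eq_true, decide_eq_true_eq] at h1
  by_cases h2 : p.1 = L
  · exact Or.inl h2
  · refine Or.inr fun h3 => h2 ?_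
    have := Int.eq_zero_of_abs_lt_dvd h3 (by rw [abs_lt]; omega)
    omega

theorem abs_lvls_le (w : List Step) (h : ℤ) : ∀ p ∈ lvls h w, h - w.length ≤ p.1 ∧
    p.1 ≤ h + w.length := by
  induction w generalizing h with
  | nil => simp [lvls]
  | cons t w ih =>
    intro p hp
    rw [lvls, List.mem_cons] at hp
    rcases hp with rfl | hp
    · rcases t with ⟨_ | _, _⟩ <;> simp [lvl] <;> omega
    · have := ih _ p hp
      rcases t with ⟨_ | _, _⟩ <;> simp [nxt] at this ⊢ <;> omega

/-- The vanishing of a coordinate of the displacement of a word is an equation for `r ^ s`. -/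
theorem ev_classPoly_iff (w : List Step) (N k : ℕ) (hk : k < s) (hN : w.length ≤ s * N) :
    ev ((r : ZMod n) ^ s) (classPoly s N k w) = 0 ↔ ((lvls 0 w).map fun p =>
      if (p.1 : ZMod s) = ((k : ℤ) : ZMod s) then
        (p.2 : ZMod n) * ((r ^ p.1 : (ZMod n)ˣ) : ZMod n) else 0).sum = 0 := by
  rw [← Units.val_pow_eq_pow_val, classPoly, ev_normalize, ev_map_range]
  have h2 : ∀ l : List (ℤ × ℤ), (∀ p ∈ l, 0 - (w.length : ℤ) ≤ p.1 ∧ p.1 ≤ 0 + w.length) →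
      (l.map fun p => if (p.1 : ZMod s) = ((k : ℤ) : ZMod s) then
        (p.2 : ZMod n) * ((r ^ p.1 : (ZMod n)ˣ) : ZMod n) else 0).sum =
      ((r ^ ((k : ℤ) - s * N) : (ZMod n)ˣ) : ZMod n) * ∑ j ∈ Finset.range (2 * N + 1),
        (((l.map fun p => if p.1 = (k : ℤ) + s * ((j : ℤ) - N) then p.2 else 0).sum : ℤ) : ZMod n) *
        (((r ^ s : (ZMod n)ˣ) : ZMod n)) ^ j := by
    intro l hl
    induction l with
    | nil => simp
    | cons p l ih =>
      rw [List.map_cons, List.sum_cons, ih fun p hp => hl p (List.mem_cons_of_mem _ hp)]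
      simp only [List.map_cons, List.sum_cons, Int.cast_add, add_mul, Finset.sum_add_distrib,
        mul_add]
      congr 1
      have h3 := hl p List.mem_cons_self
      by_cases h5 : (p.1 : ZMod s) = ((k : ℤ) : ZMod s)
      · rw [if_pos h5]
        obtain ⟨i, hi⟩ : (s : ℤ) ∣ p.1 - k := by
          rw [← ZMod.intCast_zmod_eq_zero_iff_dvd, Int.cast_sub, h5, sub_self]
        have hs : (0 : ℤ) < s := by omega
        have hN' : (w.length : ℤ) ≤ s * N := by exact_mod_cast hN
        have hi1 : -(N : ℤ) ≤ i := by
          by_contra hc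
          have : (s : ℤ) * i ≤ s * (-(N : ℤ) - 1) := mul_le_mul_of_nonneg_left (by omega) hs.le
          nlinarith
        have hi2 : i ≤ N := by
          by_contra hc
          have : (s : ℤ) * (N + 1) ≤ s * i := mul_le_mul_of_nonneg_left (by omega) hs.le
          nlinarith
        rw [Finset.sum_eq_single (i + N).toNat]
        · have h6 : (((i + N).toNat : ℕ) : ℤ) = i + N := Int.toNat_of_nonneg (by omega)
          rw [h6, if_pos (by rw [add_sub_cancel_right, ← hi]; ring)]
          rw [mul_left_comm, ← Units.val_pow_eq_pow_val, ← Units.val_mul]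
          congr 2
          rw [← zpow_natCast, h6, ← zpow_natCast r s, ← zpow_mul, ← zpow_add]
          congr 1
          linear_combination hi
        · intro j _ hj
          rw [if_neg, Int.cast_zero, zero_mul]
          intro h7
          apply hj
          have : (s : ℤ) * i = s * (j - N) := by rw [← hi, h7]; ring
          have := mul_left_cancel₀ hs.ne' this
          omega
        · intro h; exact absurd (Finset.mem_range.2 (by omega)) h
      · rw [if_neg h5]
        symm
        rw [Finset.sum_eq_zero, mul_zero]
        intro j _
        rw [if_neg, Int.cast_zero, zero_mul]
        intro h6
        apply h5
        rw [h6]; simp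
  rw [h2 _ (abs_lvls_le w 0)]
  exact (Units.mul_right_eq_zero _).symm

/-- A word is closed if and only if its net height is a multiple of `m s` and each of its `s`
displacement polynomials vanishes at `r ^ s`. -/
theorem closed_iff (hs : s ≠ 0) (w : List Step) (N : ℕ) (hN : w.length ≤ s * N) :
    Closed m s n r w ↔ ((m * s : ℕ) : ℤ) ∣ net w ∧
      ∀ k < s, ev ((r : ZMod n) ^ s) (classPoly s N k w) = 0 := by
  refine and_congr Iff.rfl ⟨fun h k hk => (ev_classPoly_iff w N k hk hN).2 (h _), fun h c => ?_⟩
  have : NeZero s := ⟨hs⟩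
  have h1 := (ev_classPoly_iff w N c.val (ZMod.val_lt c) hN).1 (h _ (ZMod.val_lt c))
  simpa using h1


end CPMVertex

/-! ### Transfer of closed walks between 2-arcs -/

namespace CPMVertex

variable {m s n : ℕ} {r : (ZMod n)ˣ}

/-- The walk with steps `t₀, t₁, t₂, t₃` from `X` extends to a closed walk of length `k` without
backtracking. -/
def Ext (m : ℕ) {s n : ℕ} (r : (ZMod n)ˣ) (k : ℕ) (X : ℤ × (ZMod s → ZMod n)) (t₀ t₁ t₂ t₃ : Step) :
    Prop :=
  (CPMbar m s n r).NBCycle k (proj m X) (proj m (run r [t₀] X)) (proj m (run r [t₀, t₁] X))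
    (proj m (run r [t₀, t₁, t₂] X)) (proj m (run r [t₀, t₁, t₂, t₃] X))

theorem run_snoc_inj (H : Admissible m s n r) {w : List Step} {X : ℤ × (ZMod s → ZMod n)}
    {t t' : Step} (h : proj m (run r (w ++ [t]) X) = proj m (run r (w ++ [t']) X)) : t = t' := by
  rw [run_append, run_append] at h
  exact step_eq_of_proj_move_eq H h

theorem Ext.exists_word (H : Admissible m s n r) {k : ℕ} {X : ℤ × (ZMod s → ZMod n)}
    {t₀ t₁ t₂ t₃ : Step} (h : Ext m r k X t₀ t₁ t₂ t₃) (hk : 1 ≤ k) :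
    ∃ t : ℕ → Step, t 0 = t₀ ∧ t 1 = t₁ ∧ t 2 = t₂ ∧ t 3 = t₃ ∧
      Closed m s n r ((List.range k).map t) ∧ good ((List.range k).map t) = true := by
  obtain ⟨t, h0, h1, h2, h3, h4, h5⟩ := exists_word_of_nbCycle H h hk rfl
  obtain rfl : t₀ = t 0 := run_snoc_inj H (w := []) h0
  obtain rfl : t₁ = t 1 := run_snoc_inj H (w := [t 0]) h1
  obtain rfl : t₂ = t 2 := run_snoc_inj H (w := [t 0, t 1]) h2
  obtain rfl : t₃ = t 3 := run_snoc_inj H (w := [t 0, t 1, t 2]) h3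
  exact ⟨t, rfl, rfl, rfl, rfl, h4, h5⟩

theorem Ext.word₈ (H : Admissible m s n r) {X : ℤ × (ZMod s → ZMod n)} {t₀ t₁ t₂ t₃ : Step}
    (h : Ext m r 8 X t₀ t₁ t₂ t₃) : ∃ t₄ t₅ t₆ t₇ : Step,
      Closed m s n r [t₀, t₁, t₂, t₃, t₄, t₅, t₆, t₇] ∧
        good [t₀, t₁, t₂, t₃, t₄, t₅, t₆, t₇] = true := by
  obtain ⟨t, rfl, rfl, rfl, rfl, h1, h2⟩ := h.exists_word H (by norm_num)
  exact ⟨t 4, t 5, t 6, t 7, h1, h2⟩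

theorem Ext.word₆ (H : Admissible m s n r) {X : ℤ × (ZMod s → ZMod n)} {t₀ t₁ t₂ t₃ : Step}
    (h : Ext m r 6 X t₀ t₁ t₂ t₃) : ∃ t₄ t₅ : Step,
      Closed m s n r [t₀, t₁, t₂, t₃, t₄, t₅] ∧ good [t₀, t₁, t₂, t₃, t₄, t₅] = true := by
  obtain ⟨t, rfl, rfl, rfl, rfl, h1, h2⟩ := h.exists_word H (by norm_num)
  exact ⟨t 4, t 5, h1, h2⟩

theorem Ext.word₄ (H : Admissible m s n r) {X : ℤ × (ZMod s → ZMod n)} {t₀ t₁ t₂ t₃ : Step}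
    (h : Ext m r 4 X t₀ t₁ t₂ t₃) :
      Closed m s n r [t₀, t₁, t₂, t₃] ∧ good [t₀, t₁, t₂, t₃] = true := by
  obtain ⟨t, rfl, rfl, rfl, rfl, h1, h2⟩ := h.exists_word H (by norm_num)
  exact ⟨h1, h2⟩

theorem ext_of_closed (H : Admissible m s n r) {t₀ t₁ t₂ t₃ : Step} {w : List Step}
    (hw : Closed m s n r (t₀ :: t₁ :: t₂ :: t₃ :: w))
    (hnb : nb (t₀ :: t₁ :: t₂ :: t₃ :: w) = true)
    (hends : ((t₀ :: t₁ :: t₂ :: t₃ :: w).head?.map Prod.fst =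
        (t₀ :: t₁ :: t₂ :: t₃ :: w).getLast?.map Prod.fst) ∨
      (net (t₀ :: t₁ :: t₂ :: t₃ :: w) = 0 ∧ (t₀ :: t₁ :: t₂ :: t₃ :: w).head? ≠
        (t₀ :: t₁ :: t₂ :: t₃ :: w).getLast?.map rev)) (X : ℤ × (ZMod s → ZMod n)) :
    Ext m r (w.length + 4) X t₀ t₁ t₂ t₃ :=
  nbCycle_of_closed H _ (by simp) hw hnb hends X

theorem mem_cpmSet_of_adj {x y : CPMVertex m s n} (hx : x ∈ CPMSet m s n r)
    (h : (CPMbar m s n r).Adj x y) : y ∈ CPMSet m s n r := by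
  rw [CPMSet, SimpleGraph.ConnectedComponent.mem_supp_iff] at hx ⊢
  rw [← hx]
  exact (SimpleGraph.ConnectedComponent.connectedComponentMk_eq_of_adj h).symm

theorem run_mem (H : Admissible m s n r) (w : List Step) {X : ℤ × (ZMod s → ZMod n)}
    (hX : proj m X ∈ CPMSet m s n r) : proj m (run r w X) ∈ CPMSet m s n r := by
  induction w generalizing X with
  | nil => exact hX
  | cons t w ih => exact ih (mem_cpmSet_of_adj hX (adj_move H X t))

theorem nbCycle_map {k : ℕ} {x₀ x₁ x₂ x₃ x₄ : CPMSet m s n r} (φ : CPMAut m s n r)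
    (h : (CPMbar m s n r).NBCycle k x₀ x₁ x₂ x₃ x₄) :
    (CPMbar m s n r).NBCycle k (φ x₀) (φ x₁) (φ x₂) (φ x₃) (φ x₄) := by
  obtain ⟨p, h1, h2, h3, e0, e1, e2, e3, e4⟩ := h
  have hp : ∀ i, p i ∈ CPMSet m s n r := by
    intro i
    induction i with
    | zero => rw [e0]; exact x₀.2
    | succ i ih => exact mem_cpmSet_of_adj ih (h1 i)
  refine ⟨fun i => φ ⟨p i, hp i⟩, fun i => ?_, fun i h => ?_, fun i => ?_, ?_, ?_, ?_, ?_, ?_⟩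
  · exact φ.map_rel_iff.2 (show (CPM m s n r).Adj ⟨p i, hp i⟩ ⟨p (i + 1), hp (i + 1)⟩ from h1 i)
  · exact h2 i (Subtype.ext_iff.1 (φ.injective (Subtype.ext h)))
  · simp only [h3]
  all_goals simp only [*]

theorem nbCycle_map_iff {k : ℕ} {x₀ x₁ x₂ x₃ x₄ : CPMSet m s n r} (φ : CPMAut m s n r) :
    (CPMbar m s n r).NBCycle k (φ x₀) (φ x₁) (φ x₂) (φ x₃) (φ x₄) ↔
      (CPMbar m s n r).NBCycle k x₀ x₁ x₂ x₃ x₄ := by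
  refine ⟨fun h => ?_, nbCycle_map φ⟩
  simpa using nbCycle_map φ.symm h

/-- The base point of the cover. -/
def base (s n : ℕ) : ℤ × (ZMod s → ZMod n) := (0, 0)

theorem proj_base_mem : proj m (base s n) ∈ CPMSet m s n r := by
  rw [CPMSet, SimpleGraph.ConnectedComponent.mem_supp_iff, proj, base, zero]
  simp

/-- An automorphism that maps one 2-arc to another one maps the extensions of the first to those of
the second and preserves the property of lying on short closed walks. -/
theorem exists_ext_map (H : Admissible m s n r) (h2 : (CPM m s n r).IsTwoArcTransitive)
    {t₀ t₁ t₀' t₁' : Step} (h : t₁ ≠ rev t₀) (h' : t₁' ≠ rev t₀') :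
    ∃ (f : Step → Step) (g : Step → Step → Step), (∀ t, f t = rev t₁' ↔ t = rev t₁) ∧
      Function.Bijective f ∧ (∀ t u, g t u = rev (f t) ↔ u = rev t) ∧
      (∀ t, Function.Bijective (g t)) ∧
      (∀ k t u, Ext m r k (base s n) t₀' t₁' (f t) (g t u) ↔ Ext m r k (base s n) t₀ t₁ t u) ∧
      (∀ k w t u, (∃ v, Ext m r k (run r [t₀', t₁', f w] (base s n)) (rev (f w)) (f t) (g t u) v) ↔
        ∃ v, Ext m r k (run r [t₀, t₁, w] (base s n)) (rev w) t u v) := by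
  let pt : List Step → CPMSet m s n r := fun w =>
    ⟨proj m (run r w (base s n)), run_mem H w proj_base_mem⟩
  have hadj : ∀ w t, (CPM m s n r).Adj (pt w) (pt (w ++ [t])) := by
    intro w t
    change (CPMbar m s n r).Adj _ _
    simp only [pt, run_append]
    exact adj_move H _ _
  have hne : ∀ w t t', pt (w ++ [t] ++ [t']) = pt w ↔ t' = rev t := by
    intro w t t'
    rw [Subtype.ext_iff]
    simp only [pt, run_append]
    exact proj_move_move_eq_iff H
  have hinj : ∀ w t t', pt (w ++ [t]) = pt (w ++ [t']) → t = t' := by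
    intro w t t' h
    exact run_snoc_inj H (Subtype.ext_iff.1 h)
  have hsurj : ∀ w y, (CPM m s n r).Adj (pt w) y → ∃ t, y = pt (w ++ [t]) := by
    intro w y hy
    obtain ⟨t, ht⟩ := (adj_proj_iff H _ _).1
      (show (CPMbar m s n r).Adj (proj m (run r w (base s n))) y from hy)
    exact ⟨t, Subtype.ext (by simp only [pt, run_append]; exact ht)⟩
  obtain ⟨φ, e0, e1, e2⟩ := h2 (pt []) (pt [t₀]) (pt [t₀, t₁]) (pt []) (pt [t₀']) (pt [t₀', t₁'])
    ⟨hadj [] t₀, hadj [t₀] t₁, fun h3 => h ((hne [] t₀ t₁).1 h3.symm)⟩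
    ⟨hadj [] t₀', hadj [t₀'] t₁', fun h3 => h' ((hne [] t₀' t₁').1 h3.symm)⟩
  have hf : ∀ t, ∃ t', φ (pt [t₀, t₁, t]) = pt [t₀', t₁', t'] := by
    intro t
    apply hsurj [t₀', t₁']
    rw [← e2]
    exact φ.map_rel_iff.2 (hadj [t₀, t₁] t)
  choose f hf using hf
  have hg : ∀ t u, ∃ u', φ (pt [t₀, t₁, t, u]) = pt [t₀', t₁', f t, u'] := by
    intro t u
    apply hsurj [t₀', t₁', f t]
    rw [← hf]
    exact φ.map_rel_iff.2 (hadj [t₀, t₁, t] u)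
  choose g hg using hg
  refine ⟨f, g, fun t => ?_, Finite.injective_iff_bijective.1 fun t u h3 => ?_, fun t u => ?_,
    fun t => Finite.injective_iff_bijective.1 fun u u' h3 => ?_, fun k t u => ?_,
    fun k w t u => ?_⟩
  · rw [← hne [t₀'] t₁' (f t), ← hne [t₀] t₁ t,
      ← φ.injective.eq_iff (a := pt ([t₀] ++ [t₁] ++ [t]))]
    change pt [t₀', t₁', f t] = _ ↔ φ (pt [t₀, t₁, t]) = _
    rw [hf, e1]
  · apply hinj [t₀, t₁]
    apply φ.injective
    change φ (pt [t₀, t₁, t]) = φ (pt [t₀, t₁, u])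
    rw [hf, hf, h3]
  · rw [← hne [t₀', t₁'] (f t) (g t u), ← hne [t₀, t₁] t u,
      ← φ.injective.eq_iff (a := pt ([t₀, t₁] ++ [t] ++ [u]))]
    change pt [t₀', t₁', f t, g t u] = _ ↔ φ (pt [t₀, t₁, t, u]) = _
    rw [hg, e2]
  · apply hinj [t₀, t₁, t]
    apply φ.injective
    change φ (pt [t₀, t₁, t, u]) = φ (pt [t₀, t₁, t, u'])
    rw [hg, hg, h3]
  · have h4 := nbCycle_map_iff (k := k) (x₀ := pt []) (x₁ := pt [t₀]) (x₂ := pt [t₀, t₁])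
      (x₃ := pt [t₀, t₁, t]) (x₄ := pt [t₀, t₁, t, u]) φ
    rw [e0, e1, e2, hf, hg] at h4
    exact h4
  · have key : ∀ (a b w t u : Step) (x : CPMSet m s n r), (CPMbar m s n r).NBCycle k (pt [a, b, w])
        (pt [a, b]) (pt [a, b, t]) (pt [a, b, t, u]) x →
        ∃ v, Ext m r k (run r [a, b, w] (base s n)) (rev w) t u v := by
      intro a b w t u x hx
      have hx' := hx
      obtain ⟨p, hp, -, -, -, -, -, e3, e4⟩ := hx'
      obtain ⟨v, hv⟩ := hsurj [a, b, t, u] x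
        (show (CPMbar m s n r).Adj (pt [a, b, t, u]) x by rw [← e3, ← e4]; exact hp 3)
      refine ⟨v, ?_⟩
      rw [hv] at hx
      simpa [Ext, run, pt] using hx
    have key' : ∀ (a b w t u v : Step), Ext m r k (run r [a, b, w] (base s n)) (rev w) t u v →
        (CPMbar m s n r).NBCycle k (pt [a, b, w])
        (pt [a, b]) (pt [a, b, t]) (pt [a, b, t, u]) (pt [a, b, t, u, v]) := by
      intro a b w t u v h3
      simpa [Ext, run, pt] using h3
    constructor
    · rintro ⟨v, hv⟩
      have h4 := nbCycle_map φ.symm (key' _ _ _ _ _ _ hv)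
      rw [← hf, ← hf, ← hg, ← e2] at h4
      simp only [RelIso.symm_apply_apply] at h4
      exact key _ _ _ _ _ _ h4
    · rintro ⟨v, hv⟩
      have h4 := nbCycle_map φ (key' _ _ _ _ _ _ hv)
      rw [hf, hf, hg, e2] at h4
      exact key _ _ _ _ _ _ h4

/-- The extension of the 2-arc `t₀, t₁` by the step `t` lies on a closed walk of length `k` without
backtracking. -/
def Ext₃ (m s : ℕ) {n : ℕ} (r : (ZMod n)ˣ) (k : ℕ) (t₀ t₁ t : Step) : Prop :=
  ∃ u, Ext m r k (base s n) t₀ t₁ t u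

/-- If some extension of one 2-arc lies on a closed walk of length `k`, then so does some
extension of every other 2-arc. -/
theorem exists_ext₃_ne (H : Admissible m s n r) (h2 : (CPM m s n r).IsTwoArcTransitive) {k : ℕ}
    {t₀ t₁ t₀' t₁' : Step} (h : t₁ ≠ rev t₀) (h' : t₁' ≠ rev t₀') {t : Step}
    (ht : Ext₃ m s r k t₀ t₁ t) : ∃ t', Ext₃ m s r k t₀' t₁' t' := by
  obtain ⟨f, g, -, -, -, -, hfg, -⟩ := exists_ext_map H h2 h h'
  obtain ⟨a, ha⟩ := ht
  exact ⟨f t, g t a, (hfg _ _ _).2 ha⟩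

/-- If two extensions of one 2-arc lie on closed walks of length `k`, then so do two extensions of
every other 2-arc. -/
theorem exists_two_ext₃ (H : Admissible m s n r) (h2 : (CPM m s n r).IsTwoArcTransitive) {k : ℕ}
    {t₀ t₁ t₀' t₁' : Step} (h : t₁ ≠ rev t₀) (h' : t₁' ≠ rev t₀') {t u : Step} (htu : t ≠ u)
    (ht : Ext₃ m s r k t₀ t₁ t) (hu : Ext₃ m s r k t₀ t₁ u) :
    ∃ t' u', t' ≠ u' ∧ Ext₃ m s r k t₀' t₁' t' ∧ Ext₃ m s r k t₀' t₁' u' := by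
  obtain ⟨f, g, -, hf, -, -, hfg, -⟩ := exists_ext_map H h2 h h'
  obtain ⟨a, ha⟩ := ht
  obtain ⟨b, hb⟩ := hu
  exact ⟨f t, f u, hf.1.ne htu, ⟨_, (hfg _ _ _).2 ha⟩, ⟨_, (hfg _ _ _).2 hb⟩⟩

/-- If all the extensions of one 2-arc lie on closed walks of length `k`, then so do all the
extensions of every other 2-arc. -/
theorem forall_ext₃ (H : Admissible m s n r) (h2 : (CPM m s n r).IsTwoArcTransitive) {k : ℕ}
    {t₀ t₁ t₀' t₁' : Step} (h : t₁ ≠ rev t₀) (h' : t₁' ≠ rev t₀')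
    (hall : ∀ t, t ≠ rev t₁ → Ext₃ m s r k t₀ t₁ t) (t' : Step) (ht' : t' ≠ rev t₁') :
    Ext₃ m s r k t₀' t₁' t' := by
  obtain ⟨f, g, hf1, hf, -, -, hfg, -⟩ := exists_ext_map H h2 h h'
  obtain ⟨t, rfl⟩ := hf.2 t'
  obtain ⟨a, ha⟩ := hall t fun h3 => ht' ((hf1 t).2 h3)
  exact ⟨_, (hfg _ _ _).2 ha⟩

/-- A step up. -/
abbrev U (b : Bool) : Step := (true, b)

/-- A step down. -/
abbrev D (b : Bool) : Step := (false, b)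

theorem Ext.ne_rev {k : ℕ} {X : ℤ × (ZMod s → ZMod n)}
    {t₀ t₁ t₂ t₃ : Step} (h : Ext m r k X t₀ t₁ t₂ t₃) : t₂ ≠ rev t₁ ∧ t₃ ≠ rev t₂ := by
  obtain ⟨p, -, hp, -, -, e1, e2, e3, e4⟩ := h
  constructor
  · rintro rfl
    refine hp 1 ?_
    rw [e1, show 1 + 2 = 3 from rfl, e3]
    simp [run]
  · rintro rfl
    refine hp 2 ?_
    rw [e2, show 2 + 2 = 4 from rfl, e4]
    simp [run]

/-- The closed walks of length 8 whose levels are twice `i`, twice `i + 1`, and so on. -/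
theorem closed_commutator (a b : Bool) :
    Closed m s n r [D a, U a, U b, D b, D (!a), U (!a), U (!b), D (!b)] ∧
    Closed m s n r [U a, U b, D b, D (!a), U (!a), U (!b), D (!b), D a] := by
  constructor
  all_goals
    refine ⟨by cases a <;> cases b <;> simp [net, sg], fun c => ?_⟩
    cases a <;> cases b <;> simp [lvls, lvl, nxt, sg] <;> split_ifs <;> ring

/-- Both extensions upwards of the 2-arc that goes down and up again lie on closed walks of
length 8. -/
theorem ext_anchor_up (H : Admissible m s n r) (a b : Bool) (X : ℤ × (ZMod s → ZMod n)) :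
    Ext m r 8 X (D a) (U a) (U b) (D b) := by
  refine ext_of_closed (w := [D (!a), U (!a), U (!b), D (!b)]) H (closed_commutator a b).1 ?_ ?_ X
  · revert a b; decide
  · revert a b; decide

theorem ext_up_up_down (H : Admissible m s n r) (a b : Bool) (X : ℤ × (ZMod s → ZMod n)) :
    Ext m r 8 X (U a) (U b) (D b) (D (!a)) := by
  refine ext_of_closed (w := [U (!a), U (!b), D (!b), D a]) H (closed_commutator a b).2 ?_ ?_ X
  · revert a b; decide
  · revert a b; decide

/-- Some directed 3-arc lies on a closed walk of length 8. -/
theorem exists_ext_up (H : Admissible m s n r) (h2 : (CPM m s n r).IsTwoArcTransitive) :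
    ∃ b, Ext₃ m s r 8 (U true) (U true) (U b) := by
  -- Of two extensions of a directed 2-arc one is directed, since only one leads down.
  obtain ⟨t, u, htu, ⟨a, ha⟩, ⟨b, hb⟩⟩ := exists_two_ext₃ H h2 (t₀ := D true) (t₁ := U true)
    (t₀' := U true) (t₁' := U true) (by decide) (by decide) (t := U true) (u := U false) (by decide)
    ⟨_, ext_anchor_up H true true _⟩ ⟨_, ext_anchor_up H true false _⟩
  have h3 := ha.ne_rev.1
  have h4 := hb.ne_rev.1
  rcases t with ⟨_ | _, c⟩
  · rcases u with ⟨_ | _, d⟩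
    · cases c <;> cases d <;> simp [rev] at h3 h4 htu
    · exact ⟨d, b, hb⟩
  · exact ⟨c, a, ha⟩

/-- If every directed 3-arc lies on a closed walk of length 8, then so do the 3-arcs in the cycles
that alternate between two levels. -/
theorem ext_alternating (H : Admissible m s n r) (h2 : (CPM m s n r).IsTwoArcTransitive)
    (h : ∀ b, Ext₃ m s r 8 (U true) (U true) (U b)) : Ext₃ m s r 8 (D true) (U true) (D true) := by
  refine forall_ext₃ H h2 (t₀ := U true) (t₁ := U true) (by decide) (by decide) ?_ _ (by decide)
  rintro ⟨_ | _, b⟩ ht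
  · cases b
    · exact absurd rfl ht
    · exact ⟨_, ext_up_up_down H true true _⟩
  · exact h b

end CPMVertex

/-! ### The case `s ≥ 3` -/

namespace CPMVertex

variable {m s n : ℕ} {r : (ZMod n)ˣ}

/-- Some level of `w` is at distance less than `d` from all the other ones, and its coefficient
belongs to `ks`. -/
def loneCoef (d : ℤ) (w : List Step) (ks : List ℤ) : Bool :=
  ((List.range 17).map fun j : ℕ => (j : ℤ) - 8).any fun L => lone d w L && ks.contains (coef w L)

theorem Closed.exists_dvd {w : List Step} (hw : Closed m s n r w) {d : ℤ} (hd : d ≤ s)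
    {ks : List ℤ} (h : loneCoef d w ks = true) : ∃ k ∈ ks, (n : ℤ) ∣ k := by
  obtain ⟨L, -, hL⟩ := List.any_eq_true.1 h
  rw [Bool.and_eq_true] at hL
  exact ⟨_, by simpa using hL.2, hw.dvd_of_lone hd hL.1⟩

/-- A short word cannot be closed if it has a lone level with a small coefficient. -/
theorem Closed.loneCoef_ne (H : Admissible m s n r) {w : List Step} (hw : Closed m s n r w) {d : ℤ}
    (hd : d ≤ s) : loneCoef d w [1, -1, 2, -2] = false := by
  rw [← Bool.not_eq_true]
  intro h
  obtain ⟨k, hk, h1⟩ := hw.exists_dvd hd h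
  have hn := H.hn
  simp only [List.mem_cons, List.not_mem_nil, or_false] at hk
  rcases hk with rfl | rfl | rfl | rfl <;>
    (have := Int.le_of_dvd (by norm_num) ((dvd_abs _ _).2 h1); norm_num at this; omega)

/-- Some coordinate of the displacement of `w` is given by one of the polynomials `ls`. -/
def anyPoly (s N : ℕ) (w : List Step) (ls : List (List ℤ)) : Bool :=
  (List.range s).any fun k => ls.contains (classPoly s N k w)

theorem Closed.exists_ev {w : List Step} (hw : Closed m s n r w) {N : ℕ} (hN : w.length ≤ s * N)
    {ls : List (List ℤ)} (h : anyPoly s N w ls = true) : ∃ l ∈ ls, ev ((r : ZMod n) ^ s) l = 0 := by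
  obtain ⟨k, hk, hL⟩ := List.any_eq_true.1 h
  have hk' := List.mem_range.1 hk
  exact ⟨_, by simpa using hL, ((closed_iff (by omega) w N hN).1 hw).2 k hk'⟩

theorem Admissible.two_ne_zero (H : Admissible m s n r) : (2 : ZMod n) ≠ 0 := by
  intro h
  have h1 : ((2 : ℕ) : ZMod n) = 0 := by exact_mod_cast h
  rw [ZMod.natCast_eq_zero_iff] at h1
  have := Nat.le_of_dvd (by norm_num) h1
  have := H.hn; omega

theorem Admissible.four_ne_zero (H : Admissible m s n r) (hn : n ≠ 4) : (4 : ZMod n) ≠ 0 := by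
  intro h
  have h1 : ((4 : ℕ) : ZMod n) = 0 := by exact_mod_cast h
  rw [ZMod.natCast_eq_zero_iff] at h1
  have h2 := Nat.le_of_dvd (by norm_num) h1
  have := H.hn
  interval_cases n <;> omega

theorem Admissible.one_ne_zero (H : Admissible m s n r) : (1 : ZMod n) ≠ 0 := by
  intro h
  apply H.two_ne_zero
  linear_combination 2 * h

theorem Closed.dvd_net {w : List Step} (hw : Closed m s n r w) : (m : ℤ) * s ∣ net w := by
  exact_mod_cast hw.1

theorem Closed.dvd_net' {w : List Step} (hw : Closed m s n r w) : (s : ℤ) ∣ net w :=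
  (Dvd.intro_left _ rfl).trans hw.dvd_net

theorem Closed.loneCoef_ne' (H : Admissible m s n r) (hn : n ≠ 4) {w : List Step}
    (hw : Closed m s n r w) {d : ℤ} (hd : d ≤ s) : loneCoef d w [1, -1, 2, -2, 4, -4] = false := by
  rw [← Bool.not_eq_true]
  intro h
  obtain ⟨k, hk, h1⟩ := hw.exists_dvd hd h
  rw [← ZMod.intCast_zmod_eq_zero_iff_dvd] at h1
  have h2 := H.two_ne_zero
  have h3 := H.one_ne_zero
  have h4 := H.four_ne_zero hn
  simp only [List.mem_cons, List.not_mem_nil, or_false] at hk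
  rcases hk with rfl | rfl | rfl | rfl | rfl | rfl <;> simp_all

/-! The lemmas named `words_…` run through all the words of a given length with a given beginning.
Each word without backtracking either has a level or a displacement polynomial that keeps it from
being closed or yields an equation for `r ^ s`, or else its net height restricts `m s`. -/

theorem words_up_up_four : ∀ c d : Step, good [U true, U true, c, d] = true →
    loneCoef 3 [U true, U true, c, d] [1, -1, 2, -2] = true ∨ net [U true, U true, c, d] = 2 ∨
    (net [U true, U true, c, d] = 4 ∧ loneCoef 4 [U true, U true, c, d] [1, -1, 2, -2] = true) := by
  decide +kernel

theorem words_up_eight : ∀ b : Bool, ∀ c d e f g : Step,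
    good [U true, U true, U b, c, d, e, f, g] = true →
    (net [U true, U true, U b, c, d, e, f, g] = 0 ∧
      loneCoef 4 [U true, U true, U b, c, d, e, f, g] [1, -1, 2, -2] = true) ∨
    net [U true, U true, U b, c, d, e, f, g] = -2 ∨
    net [U true, U true, U b, c, d, e, f, g] = 2 ∨
    net [U true, U true, U b, c, d, e, f, g] = 4 ∨
    (net [U true, U true, U b, c, d, e, f, g] = 6 ∧
      loneCoef 6 [U true, U true, U b, c, d, e, f, g] [1, -1, 2, -2] = true) ∨
    (net [U true, U true, U b, c, d, e, f, g] = 8 ∧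
      loneCoef 8 [U true, U true, U b, c, d, e, f, g] [1, -1, 2, -2] = true ∧
      anyPoly 4 2 [U true, U true, U b, c, d, e, f, g] [[1, 1], [1, -1]]) := by
  decide +kernel

theorem words_up_eight_three : ∀ b : Bool, ∀ c d e f g : Step,
    good [U true, U true, U b, c, d, e, f, g] = true →
    (net [U true, U true, U b, c, d, e, f, g] = 0 ∧
      (loneCoef 3 [U true, U true, U b, c, d, e, f, g] [1, -1, 2, -2] = true ∨
       anyPoly 3 3 [U true, U true, U b, c, d, e, f, g] [[2, 2], [2, -2]] = true)) ∨
    (net [U true, U true, U b, c, d, e, f, g] = 6 ∧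
       anyPoly 3 3 [U true, U true, U b, c, d, e, f, g] [[1, 1], [1, -1]] = true) ∨
    ¬ (3 : ℤ) ∣ net [U true, U true, U b, c, d, e, f, g] := by
  decide +kernel

theorem words_anchor_eight_four : ∀ b : Bool, ∀ d e f g : Step, ∀ c : Bool,
    (good [D true, U true, D true, D b, d, e, f, g] = true →
      loneCoef 3 [D true, U true, D true, D b, d, e, f, g] [1, -1, 2, -2, 4, -4] = true ∨
      (net [D true, U true, D true, D b, d, e, f, g] = -4 ∧
        anyPoly 4 2 [D true, U true, D true, D b, d, e, f, g] [[1]] = true) ∨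
      ¬ (4 : ℤ) ∣ net [D true, U true, D true, D b, d, e, f, g]) ∧
    (good [D true, U true, U c, U b, d, e, f, g] = true →
      (net [D true, U true, U c, U b, d, e, f, g] = 0 ∧
        loneCoef 4 [D true, U true, U c, U b, d, e, f, g] [1, -1, 2, -2] = true) ∨
      (net [D true, U true, U c, U b, d, e, f, g] = 4 ∧
        anyPoly 4 2 [D true, U true, U c, U b, d, e, f, g] [[1]] = true) ∨
      ¬ (4 : ℤ) ∣ net [D true, U true, U c, U b, d, e, f, g]) := by
  decide +kernel

theorem words_anchor_six : ∀ b : Bool, ∀ c d e : Step,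
    good [D true, U true, U b, c, d, e] = true →
      (net [D true, U true, U b, c, d, e] = 0 ∧
      loneCoef 3 [D true, U true, U b, c, d, e] [1, -1, 2, -2] = true) ∨
      ¬ (3 : ℤ) ∣ net [D true, U true, U b, c, d, e] := by
  decide +kernel

theorem words_up_up_three : ∀ b g : Bool, ∀ c d e f : Step,
    (good [U true, U true, U b, U g, c, d, e, f] = true →
      (net [U true, U true, U b, U g, c, d, e, f] = 0 ∧
       (loneCoef 3 [U true, U true, U b, U g, c, d, e, f] [1, -1, 2, -2] = true ∨
        anyPoly 3 3 [U true, U true, U b, U g, c, d, e, f] [[2, 2 * sg g]])) ∨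
      (net [U true, U true, U b, U g, c, d, e, f] = 6 ∧
       anyPoly 3 3 [U true, U true, U b, U g, c, d, e, f] [[1, 1], [1, -1]] = true) ∨
      ¬ (3 : ℤ) ∣ net [U true, U true, U b, U g, c, d, e, f]) ∧
    (good [U true, U true, D true, D true, c, d, e, f] = true →
      loneCoef 3 [U true, U true, D true, D true, c, d, e, f] [1, -1, 2, -2, 4, -4] = true ∨
      ¬ (3 : ℤ) ∣ net [U true, U true, D true, D true, c, d, e, f]) := by
  decide +kernel

/-- For `n = 4` the walks that alternate between two levels are 4-cycles, but for `s ≥ 3` no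
directed 2-arc lies on a 4-cycle. -/
theorem ne_four_of_three_le (H : Admissible m s n r) (h2 : (CPM m s n r).IsTwoArcTransitive)
    (hs : 3 ≤ s) : n ≠ 4 := by
  intro hn
  have h1 : Ext m r 4 (base s n) (D true) (U true) (D true) (U true) := by
    refine ext_of_closed (w := []) H ⟨by simp [net, sg], fun c => ?_⟩ (by decide) (by decide) _
    have h4 : (4 : ZMod n) = 0 := by subst hn; rfl
    simp [lvls, lvl, nxt, sg]
    split_ifs
    · linear_combination ((r⁻¹ : (ZMod n)ˣ) : ZMod n) * h4
    · simp
  obtain ⟨t, u, h3⟩ := exists_ext₃_ne H h2 (t₀' := U true) (t₁' := U true) (by decide) (by decide)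
    ⟨_, h1⟩
  obtain ⟨h4, h5⟩ := h3.word₄ H
  have hm := H.hm
  rcases words_up_up_four t u h5 with h6 | h6 | ⟨h6, h7⟩
  · rw [h4.loneCoef_ne H (by omega)] at h6; simp at h6
  · have h8 := h4.dvd_net'
    rw [h6] at h8
    have := Int.le_of_dvd (by norm_num) h8
    omega
  · rcases Nat.lt_or_ge s 4 with h9 | h9
    · have h8 := h4.dvd_net'
      rw [h6, show s = 3 by omega] at h8
      norm_num at h8
    · rw [h4.loneCoef_ne H (by omega)] at h7; simp at h7

/-- For `s ≥ 4` the closed walks of length 8 through directed 3-arcs have net height 4 or 8. In the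
first case `m s = 4`, in the second one `m s` divides `8` and `r ^ s = ±1`. -/
theorem eq_four_of_four_le (H : Admissible m s n r) (h2 : (CPM m s n r).IsTwoArcTransitive)
    (hs : 4 ≤ s) : s = 4 ∧ m ≤ 2 ∧ ((r : ZMod n) ^ s = 1 ∨ (r : ZMod n) ^ s = -1) := by
  obtain ⟨b, t, h3⟩ := exists_ext_up H h2
  obtain ⟨d, e, f, g, h4, h5⟩ := h3.word₈ H
  have hd := h4.dvd_net
  have hd' := h4.dvd_net'
  have hm := H.hm
  rcases words_up_eight b t d e f g h5 with ⟨h6, h7⟩ | h6 | h6 | h6 | ⟨h6, h7⟩ | ⟨h6, h7, h8⟩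
  · rw [h4.loneCoef_ne H (by omega)] at h7; simp at h7
  · rw [h6] at hd'
    have := Int.le_of_dvd (by norm_num) ((Int.dvd_neg).2 hd'); omega
  · rw [h6] at hd'
    have := Int.le_of_dvd (by norm_num) hd'; omega
  · rw [h6] at hd hd'
    have h8 := Int.le_of_dvd (by norm_num) hd'
    obtain rfl : s = 4 := by omega
    have h9 := Int.le_of_dvd (by norm_num) hd
    obtain rfl : m = 1 := by push_cast at h9; omega
    refine ⟨rfl, by norm_num, ?_⟩
    rcases H.hr with h | h <;> rw [one_mul] at h
    · left; rw [← Units.val_pow_eq_pow_val, h]; rfl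
    · right; rw [← Units.val_pow_eq_pow_val, h]; rfl
  · rw [h6] at hd'
    have h8 := Int.le_of_dvd (by norm_num) hd'
    have h9 : s = 4 ∨ s = 5 ∨ s = 6 := by omega
    rcases h9 with rfl | rfl | rfl
    · norm_num at hd'
    · norm_num at hd'
    · rw [h4.loneCoef_ne H (by norm_num)] at h7; simp at h7
  · rw [h6] at hd hd'
    have h10 := Int.le_of_dvd (by norm_num) hd'
    have h9 : s = 4 ∨ s = 5 ∨ s = 6 ∨ s = 7 ∨ s = 8 := by omega
    rcases h9 with rfl | rfl | rfl | rfl | rfl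
    · have h9 := Int.le_of_dvd (by norm_num) hd
      refine ⟨rfl, by push_cast at h9; omega, ?_⟩
      obtain ⟨l, hl, h11⟩ := h4.exists_ev (N := 2) (by simp) h8
      simp only [List.mem_cons, List.not_mem_nil, or_false] at hl
      rcases hl with rfl | rfl <;> simp [ev] at h11
      · right; linear_combination h11
      · left; linear_combination -h11
    · norm_num at hd'
    · norm_num at hd'
    · norm_num at hd'
    · rw [h4.loneCoef_ne H (by norm_num)] at h7; simp at h7

/-- For `s = 4` both directed extensions of a directed 3-arc lie on closed walks of length 8. The
3-arcs that begin by going down and up again have no two extensions that could correspond to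
these. -/
theorem not_four_le (H : Admissible m s n r) (h2 : (CPM m s n r).IsTwoArcTransitive) : ¬ 4 ≤ s := by
  intro hs
  obtain ⟨rfl, hm, hr⟩ := eq_four_of_four_le H h2 hs
  have hn4 := ne_four_of_three_le H h2 (by norm_num)
  have hm1 := H.hm
  -- A directed 2-arc is continued twice upwards by going up eight times.
  have key : ∀ b : Bool, Ext m r 8 (base 4 n) (U true) (U true) (U true) (U b) := by
    intro b
    have hcl : ∃ c : Bool, ((c : Bool) = true ↔ (r : ZMod n) ^ 4 = -1) := by
      classical exact ⟨decide ((r : ZMod n) ^ 4 = -1), by simp⟩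
    obtain ⟨c, hc⟩ := hcl
    have hc' : 1 + (r : ZMod n) ^ 4 * (sg c : ZMod n) = 0 := by
      rcases hr with h | h
      · have : c = false := by
          rw [← Bool.not_eq_true, hc, h]
          intro h3; exact H.two_ne_zero (by linear_combination h3)
        rw [this, h]; simp [sg]
      · rw [hc.2 h, h]; simp [sg]
    refine ext_of_closed (w := [U c, U c, U c, U (c == b)]) H ?_ ?_ ?_ _
    · rw [closed_iff (by norm_num) _ 2 (by simp)]
      constructor
      · have h3 : net [U true, U true, U true, U b, U c, U c, U c, U (c == b)] = 8 := rfl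
        rw [h3]
        interval_cases m <;> norm_num
      · have h4 : ∀ b c : Bool, ∀ k < 4, classPoly 4 2 k
          [U true, U true, U true, U b, U c, U c, U c, U (c == b)] = [1, sg c] := by decide
        intro k hk
        rw [h4 b c k hk]
        simpa [ev] using hc'
    · clear hc hc'; revert b c; decide
    · left; clear hc hc'; revert b c; decide
  obtain ⟨f, g, hf1, hf, hg1, hg, hfg, -⟩ := exists_ext_map H h2 (t₀ := U true) (t₁ := U true)
    (t₀' := D true) (t₁' := U true) (by decide) (by decide)
  have e1 := (hfg _ _ _).2 (key true)
  have e2 := (hfg _ _ _).2 (key false)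
  have hne : g (U true) (U true) ≠ g (U true) (U false) := (hg _).1.ne (by decide)
  set t := f (U true)
  set a := g (U true) (U true)
  set b := g (U true) (U false)
  have ht := e1.ne_rev.1
  -- An alternating step has to be continued by an alternating one, a step up by a step down.
  have h3 : ∀ u, Ext m r 8 (base 4 n) (D true) (U true) t u → u.1 = !t.1 := by
    intro u hu
    obtain ⟨d, e, x, y, h4, h5⟩ := hu.word₈ H
    have hd := h4.dvd_net'
    rcases t with ⟨_ | _, c⟩
    · have hc : c = true := by cases c; exact absurd rfl ht; rfl
      subst hc
      rcases u with ⟨_ | _, u⟩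
      · exfalso
        rcases (words_anchor_eight_four u d e x y true).1 h5 with h6 | ⟨-, h6⟩ | h6
        · rw [h4.loneCoef_ne' H hn4 (by norm_num)] at h6; simp at h6
        · obtain ⟨l, hl, h11⟩ := h4.exists_ev (N := 2) (by simp) h6
          simp only [List.mem_cons, List.not_mem_nil, or_false] at hl
          subst hl
          simp [ev] at h11
          exact H.one_ne_zero h11
        · exact h6 hd
      · rfl
    · rcases u with ⟨_ | _, u⟩
      · rfl
      · exfalso
        rcases (words_anchor_eight_four u d e x y c).2 h5 with ⟨-, h6⟩ | ⟨-, h6⟩ | h6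
        · rw [h4.loneCoef_ne H (by norm_num)] at h6; simp at h6
        · obtain ⟨l, hl, h11⟩ := h4.exists_ev (N := 2) (by simp) h6
          simp only [List.mem_cons, List.not_mem_nil, or_false] at hl
          subst hl
          simp [ev] at h11
          exact H.one_ne_zero h11
        · exact h6 hd
  have ha := h3 _ e1
  have hb := h3 _ e2
  have h4 := e1.ne_rev.2
  have h5 := e2.ne_rev.2
  revert hne ha hb h4 h5
  generalize t = t, a = a, b = b
  revert t a b
  decide

/-- For `s = 3` the closed walks of length 8 through directed 3-arcs yield `r ^ 3 = ±1` with `m ≤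
2`, or `2 r ^ 3 = ±2`. In either case there are further short closed walks, and their transfer to
other 3-arcs is contradictory. -/
theorem not_three (H : Admissible m 3 n r) (h2 : (CPM m 3 n r).IsTwoArcTransitive) : False := by
  have hn4 := ne_four_of_three_le H h2 le_rfl
  have hm1 := H.hm
  have h20 := H.two_ne_zero
  by_cases hq : m ≤ 2 ∧ ((r : ZMod n) ^ 3 = 1 ∨ (r : ZMod n) ^ 3 = -1)
  · -- Directed 2-arcs have two extensions on closed walks of length 6 that only go up.
    have key : ∀ b : Bool, ∃ c, Ext m r 6 (base 3 n) (U true) (U true) (U b) (U c) := by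
      intro b
      have hcl : ∃ c : Bool, 1 + (r : ZMod n) ^ 3 * (sg c : ZMod n) = 0 := by
        rcases hq.2 with h | h
        · exact ⟨false, by rw [h]; simp [sg]⟩
        · exact ⟨true, by rw [h]; simp [sg]⟩
      obtain ⟨c, hc⟩ := hcl
      refine ⟨c, ext_of_closed (w := [U c, U (c == b)]) H ?_ ?_ ?_ _⟩
      · rw [closed_iff (by norm_num) _ 3 (by simp)]
        constructor
        · have h3 : net [U true, U true, U b, U c, U c, U (c == b)] = 6 := rfl
          rw [h3]
          have := hq.1
          interval_cases m <;> norm_num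
        · have h4 : ∀ b c : Bool, ∀ k < 3, classPoly 3 3 k
            [U true, U true, U b, U c, U c, U (c == b)] = [1, sg c] := by decide
          intro k hk
          rw [h4 b c k hk]
          simpa [ev] using hc
      · clear hc; revert b c; decide
      · left; clear hc; revert b c; decide
    obtain ⟨c, hc⟩ := key true
    obtain ⟨d, hd⟩ := key false
    obtain ⟨t, u, htu, ⟨x, hx⟩, ⟨y, hy⟩⟩ := exists_two_ext₃ H h2 (t₀' := D true) (t₁' := U true)
      (by decide) (by decide) (by decide : U true ≠ U false) ⟨_, hc⟩ ⟨_, hd⟩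
    have hup : ∀ (b : Bool) (z : Step), ¬ Ext m r 6 (base 3 n) (D true) (U true) (U b) z := by
      intro b z hz
      obtain ⟨d, e, h4, h5⟩ := hz.word₆ H
      rcases words_anchor_six b z d e h5 with ⟨-, h6⟩ | h6
      · rw [h4.loneCoef_ne H (by norm_num)] at h6; simp at h6
      · exact h6 h4.dvd_net'
    have h3 := hx.ne_rev.1
    have h4 := hy.ne_rev.1
    rcases t with ⟨_ | _, c⟩
    · rcases u with ⟨_ | _, d⟩
      · cases c <;> cases d <;> simp [rev] at h3 h4 htu
      · exact hup _ _ hy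
    · exact hup _ _ hx
  · have h6q : ∀ w : List Step, Closed m 3 n r w → w.length ≤ 9 → net w = 6 →
        anyPoly 3 3 w [[1, 1], [1, -1]] ≠ true := by
      intro w hw hl hnet h
      apply hq
      have h3 := Int.le_of_dvd (by rw [hnet]; norm_num) hw.dvd_net
      rw [hnet] at h3
      refine ⟨by push_cast at h3; omega, ?_⟩
      obtain ⟨l, hl, h11⟩ := hw.exists_ev (N := 3) hl h
      simp only [List.mem_cons, List.not_mem_nil, or_false] at hl
      rcases hl with rfl | rfl <;> simp [ev] at h11
      · right; linear_combination h11
      · left; linear_combination -h11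
    -- A directed 3-arc on a closed walk of length 8 yields an equation for `r ^ 3`.
    have hrel : ∃ c : Bool, 2 + (r : ZMod n) ^ 3 * (2 * sg c : ZMod n) = 0 := by
      obtain ⟨b, t, h3⟩ := exists_ext_up H h2
      obtain ⟨d, e, f, g, h4, h5⟩ := h3.word₈ H
      rcases words_up_eight_three b t d e f g h5 with ⟨-, h6 | h6⟩ | ⟨h6, h7⟩ | h6
      · rw [h4.loneCoef_ne H (by norm_num)] at h6; simp at h6
      · obtain ⟨l, hl, h11⟩ := h4.exists_ev (N := 3) (by simp) h6
        simp only [List.mem_cons, List.not_mem_nil, or_false] at hl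
        rcases hl with rfl | rfl <;> simp [ev] at h11
        · exact ⟨true, by simpa [sg] using h11⟩
        · exact ⟨false, by simpa [sg] using h11⟩
      · exact absurd h7 (h6q _ h4 (by simp) h6)
      · exact absurd h4.dvd_net' h6
    obtain ⟨c, hc⟩ := hrel
    -- The extension upwards of the 2-arc through a lower neighbour has three continuations.
    have key : ∀ b : Bool, Ext m r 8 (base 3 n) (D true) (U true) (U true) (U b) := by
      intro b
      refine ext_of_closed (w := [U c, D c, D (!b), D false]) H ?_ ?_ ?_ _
      · rw [closed_iff (by norm_num) _ 3 (by simp)]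
        constructor
        · have h3 : net [D true, U true, U true, U b, U c, D c, D (!b), D false] = 0 := rfl
          rw [h3]; exact dvd_zero _
        · have h4 : ∀ b c : Bool, ∀ k < 3, classPoly 3 3 k
            [D true, U true, U true, U b, U c, D c, D (!b), D false] ∈
              [[], [2, 2 * sg c]] := by decide
          intro k hk
          have h5 := h4 b c k hk
          simp only [List.mem_cons, List.not_mem_nil, or_false] at h5
          rcases h5 with h5 | h5 <;> rw [h5]
          · rfl
          · simpa [ev] using hc
      · clear hc; revert b c; decide
      · left; clear hc; revert b c; decide
    obtain ⟨f, g, hf1, hf, hg1, hg, hfg, -⟩ := exists_ext_map H h2 (t₀ := D true) (t₁ := U true)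
      (t₀' := U true) (t₁' := U true) (by decide) (by decide)
    have hall : ∀ u, u ≠ rev (f (U true)) →
        Ext m r 8 (base 3 n) (U true) (U true) (f (U true)) u := by
      intro u hu
      obtain ⟨u, rfl⟩ := (hg (U true)).2 u
      rw [Ne, hg1] at hu
      refine (hfg _ _ _).2 ?_
      rcases u with ⟨_ | _, _ | _⟩
      · exact absurd rfl hu
      · exact ext_anchor_up H true true _
      · exact key _
      · exact key _
    have ht : f (U true) ≠ rev (U true) := by rw [Ne, hf1]; decide
    generalize f (U true) = t at hall ht
    rcases t with ⟨_ | _, b⟩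
    · obtain rfl : b = true := by cases b; exact absurd rfl ht; rfl
      obtain ⟨d, e, x, y, h4, h5⟩ := (hall (D true) (by decide)).word₈ H
      rcases (words_up_up_three true true d e x y).2 h5 with h6 | h6
      · rw [h4.loneCoef_ne' H hn4 (by norm_num)] at h6; simp at h6
      · exact h6 h4.dvd_net'
    · have hboth : ∀ g : Bool, 2 + (r : ZMod n) ^ 3 * (2 * sg g : ZMod n) = 0 := by
        intro g
        obtain ⟨d, e, x, y, h4, h5⟩ := (hall (U g) (by cases b <;> cases g <;> decide)).word₈ H
        rcases (words_up_up_three b g d e x y).1 h5 with ⟨-, h6 | h6⟩ | ⟨h6, h7⟩ | h6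
        · rw [h4.loneCoef_ne H (by norm_num)] at h6; simp at h6
        · obtain ⟨l, hl, h11⟩ := h4.exists_ev (N := 3) (by simp) h6
          simp only [List.mem_cons, List.not_mem_nil, or_false] at hl
          subst hl
          simpa [ev] using h11
        · exact absurd h7 (h6q _ h4 (by simp) h6)
        · exact absurd h4.dvd_net' h6
      have e1 := hboth true
      have e2 := hboth false
      simp [sg] at e1 e2
      exact H.four_ne_zero hn4 (by linear_combination e1 + e2)

theorem eq_two (H : Admissible m s n r) (h2 : (CPM m s n r).IsTwoArcTransitive) : s = 2 := by
  have h3 := not_four_le H h2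
  have h4 := H.hs
  have h5 : s ≠ 3 := by rintro rfl; exact not_three H h2
  omega

end CPMVertex

/-! ### Short closed walks for `s = 2`, and the case `n = 4` -/

namespace CPMVertex

variable {m n : ℕ} {r : (ZMod n)ˣ}

/-- The arithmetic behind `two_mul_sq_of_dvd`: the pairs are the coefficients of the equations
`x + y r ^ 2 = 0` that short closed walks impose. -/
theorem squares_mod_divisors : ∀ n ∈ List.range 121, n ∣ 120 → 3 ≤ n → n ≠ 4 →
    ∀ a ∈ List.range n, Nat.gcd a n = 1 →
    ∀ p ∈ ([(4, 2), (4, -2), (2, 4), (2, -4), (1, 3), (1, -3), (3, 1), (3, -1), (8, 0),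
      (6, 0)] :
      List (ℤ × ℤ)), (p.1 + p.2 * ((a : ℤ) * a)) % n = 0 →
        (2 * ((a : ℤ) * a) - 2) % n = 0 ∨ (2 * ((a : ℤ) * a) + 2) % n = 0 := by
  decide +kernel

/-- If `n` divides `120`, then the squares of units modulo `n` satisfy few linear equations. -/
theorem two_mul_sq_of_dvd (hn : 3 ≤ n) (hn4 : n ≠ 4) (h120 : (120 : ZMod n) = 0) {x y : ℤ}
    (hxy : (x, y) ∈ ([(4, 2), (4, -2), (2, 4), (2, -4), (1, 3), (1, -3), (3, 1), (3, -1), (8, 0),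
      (6, 0)] :
      List (ℤ × ℤ))) (h : (x : ZMod n) + y * (r : ZMod n) ^ 2 = 0) :
    ∃ d : Bool, 2 * (r : ZMod n) ^ 2 = 2 * (sg d : ZMod n) := by
  have : NeZero n := ⟨by omega⟩
  have h1 : n ∣ 120 := by rw [← ZMod.natCast_eq_zero_iff]; exact_mod_cast h120
  have h2 : n < 121 := Nat.lt_succ_of_le (Nat.le_of_dvd (by norm_num) h1)
  have hval : (((r : ZMod n).val : ℤ) : ZMod n) = r := by simp
  have key := squares_mod_divisors n (List.mem_range.2 h2) h1 hn hn4 (r : ZMod n).val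
    (List.mem_range.2 (ZMod.val_lt _))
    (ZMod.val_coe_unit_coprime r) (x, y) hxy
  simp only [← Int.dvd_iff_emod_eq_zero, ← ZMod.intCast_zmod_eq_zero_iff_dvd] at key
  push_cast at key
  simp only [ZMod.natCast_val, ZMod.cast_id', id] at key
  rcases key (by rw [← h]; ring) with h3 | h3
  · exact ⟨true, by simp [sg]; linear_combination h3⟩
  · exact ⟨false, by simp [sg]; linear_combination h3⟩

theorem words_two_anchor_four : ∀ c d : Step, good [D true, U true, c, d] = true →
    anyPoly 2 2 [D true, U true, c, d] [[1], [2], [4]] = true := by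
  decide +kernel

theorem words_two_up_four : ∀ c d : Step, good [U true, U true, c, d] = true →
    anyPoly 2 2 [U true, U true, c, d] [[1], [2]] = true ∨ net [U true, U true, c, d] = 4 := by
  decide +kernel

theorem words_two_up_eight : ∀ b : Bool, ∀ c d e f g : Step,
    good [U true, U true, U b, c, d, e, f, g] = true →
    (net [U true, U true, U b, c, d, e, f, g] = 0 ∧
      classPoly 2 4 0 [U true, U true, U b, c, d, e, f, g] ∈
        [[2], [2, 2 * sg b], [4, 2 * sg b], [2, 4 * sg b]]) ∨
    (net [U true, U true, U b, c, d, e, f, g] = 6 ∧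
      anyPoly 2 4 [U true, U true, U b, c, d, e, f, g]
        [[1, 1, 1], [1, 1, -1], [1, -1, 1], [1, -1, -1]] = true) ∨
    (net [U true, U true, U b, c, d, e, f, g] = 8 ∧
      classPoly 2 4 0 [U true, U true, U b, c, d, e, f, g] ∈
        [[1, sg b, 1, 1], [1, sg b, 1, -1], [1, sg b, -1, 1], [1, sg b, -1, -1]]) ∨
    net [U true, U true, U b, c, d, e, f, g] ∈ [2, -2, 4] := by
  decide +kernel

theorem words_two_alternating : ∀ b c d e f : Step,
    good [D true, U true, D true, b, c, d, e, f] = true →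
    (net [D true, U true, D true, b, c, d, e, f] = 0 ∧
      anyPoly 2 4 [D true, U true, D true, b, c, d, e, f]
        [[2], [4], [8], [2, 4], [2, -4], [4, 2], [4, -2]] = true) ∨
    (net [D true, U true, D true, b, c, d, e, f] = -6 ∧
      anyPoly 2 4 [D true, U true, D true, b, c, d, e, f]
        [[1, 1, 1], [1, 1, -1], [1, -1, 1], [1, -1, -1]] = true) ∨
    (net [D true, U true, D true, b, c, d, e, f] ∈ [4, -4] ∧
      anyPoly 2 4 [D true, U true, D true, b, c, d, e, f]
        [[1, 1], [1, -1], [1, 3], [1, -3], [3, 1], [3, -1]] = true) ∨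
    net [D true, U true, D true, b, c, d, e, f] ∈ [2, -2] := by
  decide +kernel

theorem words_two_anchor_six : ∀ b c d e : Step,
    good [D true, U true, b, c, d, e] = true →
    (net [D true, U true, b, c, d, e] = 0 ∧
      anyPoly 2 3 [D true, U true, b, c, d, e] [[2], [6], [2, 2], [2, -2]] = true) ∨
    net [D true, U true, b, c, d, e] ∈ [2, -2, 4, -4] := by
  decide +kernel

/-- The first equation satisfied by `q = r ^ 2` if a directed 3-arc lies on a closed walk of
length 8 of net height `0`. -/
def RelX (q : ZMod n) (b : Bool) : Prop := 4 + 2 * sg b * q = 0 ∨ 2 + 4 * sg b * q = 0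

/-- The equation satisfied by `q = r ^ 2` if a directed 3-arc lies on a closed directed walk of
length 8. -/
def RelP (q : ZMod n) (b : Bool) : Prop :=
  ∃ c d : Bool, 1 + sg b * q + sg c * q ^ 2 + sg d * q ^ 3 = 0

theorem mem_sign_lists {q : ZMod n} {b : Bool} {l : List ℤ}
    (hl : l ∈ [[1, sg b, 1, 1], [1, sg b, 1, -1], [1, sg b, -1, 1], [1, sg b, -1, -1]])
    (h : ev q l = 0) : RelP q b := by
  simp only [List.mem_cons, List.not_mem_nil, or_false] at hl
  rcases hl with rfl | rfl | rfl | rfl <;> simp only [ev] at h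
  · exact ⟨true, true, by cases b <;> simp [sg] at h ⊢ <;> linear_combination h⟩
  · exact ⟨true, false, by cases b <;> simp [sg] at h ⊢ <;> linear_combination h⟩
  · exact ⟨false, true, by cases b <;> simp [sg] at h ⊢ <;> linear_combination h⟩
  · exact ⟨false, false, by cases b <;> simp [sg] at h ⊢ <;> linear_combination h⟩

theorem sg_sq (b : Bool) : ((sg b : ℤ) : ZMod n) ^ 2 = 1 := by
  cases b <;> simp [sg]

/-- If `m ≤ 2` and `r ^ 2 = ±1`, then directed 2-arcs lie on 4-cycles. But a 2-arc that goes down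
and up again lies on a 4-cycle only if `n = 4`. -/
theorem eq_four_of_le_two (H : Admissible m 2 n r) (h2 : (CPM m 2 n r).IsTwoArcTransitive)
    (hm : m ≤ 2) (hq : (r : ZMod n) ^ 2 = 1 ∨ (r : ZMod n) ^ 2 = -1) : n = 4 := by
  have hm1 := H.hm
  have hcl : ∃ c : Bool, 1 + (r : ZMod n) ^ 2 * (sg c : ZMod n) = 0 := by
    rcases hq with h | h
    · exact ⟨false, by rw [h]; simp [sg]⟩
    · exact ⟨true, by rw [h]; simp [sg]⟩
  obtain ⟨c, hc⟩ := hcl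
  have h1 : Ext m r 4 (base 2 n) (U true) (U true) (U c) (U c) := by
    refine ext_of_closed (w := []) H ?_ ?_ ?_ _
    · rw [closed_iff (by norm_num) _ 2 (by simp)]
      constructor
      · have h3 : net [U true, U true, U c, U c] = 4 := rfl
        rw [h3]
        interval_cases m <;> norm_num
      · have h4 : ∀ c : Bool, ∀ k < 2, classPoly 2 2 k [U true, U true, U c, U c] = [1, sg c] := by
          decide
        intro k hk
        rw [h4 c k hk]
        simpa [ev] using hc
    · clear hc; revert c; decide
    · left; clear hc; revert c; decide
  obtain ⟨t, u, h3⟩ := exists_ext₃_ne H h2 (t₀' := D true) (t₁' := U true) (by decide) (by decide)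
    ⟨_, h1⟩
  obtain ⟨h4, h5⟩ := h3.word₄ H
  by_contra hn
  obtain ⟨l, hl, h6⟩ := h4.exists_ev (N := 2) (by simp) (words_two_anchor_four t u h5)
  simp only [List.mem_cons, List.not_mem_nil, or_false] at hl
  rcases hl with rfl | rfl | rfl <;> simp [ev] at h6
  · exact H.one_ne_zero h6
  · exact H.two_ne_zero h6
  · exact H.four_ne_zero hn h6

/-- If `n = 4`, then the walks that alternate between two levels are 4-cycles. But a directed
2-arc lies on a 4-cycle only if this goes up four times, whence `2 m` divides `4`. -/
theorem le_two_of_eq_four (H : Admissible m 2 n r) (h2 : (CPM m 2 n r).IsTwoArcTransitive)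
    (hn : n = 4) : m ≤ 2 := by
  have h1 : Ext m r 4 (base 2 n) (D true) (U true) (D true) (U true) := by
    refine ext_of_closed (w := []) H ?_ (by decide) (by decide) _
    rw [closed_iff (by norm_num) _ 2 (by simp)]
    refine ⟨dvd_zero _, ?_⟩
    have h4 : ∀ k < 2, classPoly 2 2 k [D true, U true, D true, U true] ∈ [[], [4]] := by decide
    intro k hk
    have h5 := h4 k hk
    simp only [List.mem_cons, List.not_mem_nil, or_false] at h5
    rcases h5 with h5 | h5 <;> rw [h5]
    · rfl
    · subst hn; simp [ev]; rfl
  obtain ⟨t, u, h3⟩ := exists_ext₃_ne H h2 (t₀' := U true) (t₁' := U true) (by decide) (by decide)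
    ⟨_, h1⟩
  obtain ⟨h4, h5⟩ := h3.word₄ H
  rcases words_two_up_four t u h5 with h6 | h6
  · obtain ⟨l, hl, h6⟩ := h4.exists_ev (N := 2) (by simp) h6
    simp only [List.mem_cons, List.not_mem_nil, or_false] at hl
    rcases hl with rfl | rfl <;> simp [ev] at h6
    · exact absurd h6 H.one_ne_zero
    · exact absurd h6 H.two_ne_zero
  · have h7 := h4.dvd_net
    rw [h6] at h7
    have := Int.le_of_dvd (by norm_num) h7
    push_cast at this; omega

end CPMVertex

/-! ### The equation `2 r ^ 2 = ±2` for `m ≤ 3` -/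

namespace CPMVertex

variable {m n : ℕ} {r : (ZMod n)ˣ}

/-- The equation `2 r ^ 2 = ±2`. -/
def TwoSq (r : (ZMod n)ˣ) : Prop := ∃ d : Bool, 2 * (r : ZMod n) ^ 2 = 2 * (sg d : ZMod n)

theorem twoSq_of_ev (H : Admissible m 2 n r) {l : List ℤ}
    (hl : l ∈ ([[2], [2, 2], [2, -2]] : List (List ℤ))) (h : ev ((r : ZMod n) ^ 2) l = 0) :
    TwoSq r := by
  simp only [List.mem_cons, List.not_mem_nil, or_false] at hl
  rcases hl with rfl | rfl | rfl <;> simp [ev] at h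
  · exact absurd h H.two_ne_zero
  · exact ⟨false, by simp [sg]; linear_combination h⟩
  · exact ⟨true, by simp [sg]; linear_combination -h⟩

/-- For `m = 3` an equation `1 ± q ± q ^ 2 = 0` yields closed directed walks of length 6. -/
theorem twoSq_of_three (H : Admissible m 2 n r) (h2 : (CPM m 2 n r).IsTwoArcTransitive)
    (hn : n ≠ 4) (hm : m = 3) {l : List ℤ}
    (hl : l ∈ ([[1, 1, 1], [1, 1, -1], [1, -1, 1], [1, -1, -1]] : List (List ℤ)))
    (h : ev ((r : ZMod n) ^ 2) l = 0) : TwoSq r := by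
  subst hm
  have hl' : ∃ a b : Bool, l = [1, sg a, sg b] := by
    simp only [List.mem_cons, List.not_mem_nil, or_false] at hl
    rcases hl with rfl | rfl | rfl | rfl
    exacts [⟨true, true, rfl⟩, ⟨true, false, rfl⟩, ⟨false, true, rfl⟩, ⟨false, false, rfl⟩]
  obtain ⟨a, b, rfl⟩ := hl'
  have h1 : Ext 3 r 6 (base 2 n) (U true) (U true) (U a) (U a) := by
    refine ext_of_closed (w := [U b, U b]) H ?_ ?_ ?_ _
    · rw [closed_iff (by norm_num) _ 3 (by simp)]
      constructor
      · have h3 : net [U true, U true, U a, U a, U b, U b] = 6 := rfl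
        rw [h3]; norm_num
      · have h4 : ∀ a b : Bool, ∀ k < 2, classPoly 2 3 k [U true, U true, U a, U a, U b, U b] =
            [1, sg a, sg b] := by decide
        intro k hk
        rw [h4 a b k hk]
        exact h
    · clear h hl; revert a b; decide
    · left; clear h hl; revert a b; decide
  obtain ⟨t, u, h3⟩ := exists_ext₃_ne H h2 (t₀' := D true) (t₁' := U true) (by decide) (by decide)
    ⟨_, h1⟩
  obtain ⟨c, d, h4, h5⟩ := h3.word₆ H
  rcases words_two_anchor_six t u c d h5 with ⟨-, h6⟩ | h6
  · obtain ⟨l, hl, h6⟩ := h4.exists_ev (N := 3) (by simp) h6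
    by_cases h7 : l = [6]
    · subst h7
      simp [ev] at h6
      exact two_mul_sq_of_dvd H.hn hn (by linear_combination 20 * h6) (x := 6) (y := 0) (by simp)
        (by push_cast; linear_combination h6)
    · refine twoSq_of_ev H ?_ h6
      simp only [List.mem_cons, List.not_mem_nil, or_false] at hl ⊢
      tauto
  · have h7 := h4.dvd_net
    simp only [List.mem_cons, List.not_mem_nil, or_false] at h6
    rcases h6 with h6 | h6 | h6 | h6 <;> rw [h6] at h7 <;> norm_num at h7

/-- The equations satisfied by `r ^ 2` if an alternating 3-arc lies on a closed walk of
length 8. -/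
theorem exists_rel_of_alternating (H : Admissible m 2 n r)
    (h2 : (CPM m 2 n r).IsTwoArcTransitive) (hn : n ≠ 4) (hm : 2 ≤ m)
    (h : Ext₃ m 2 r 8 (D true) (U true) (D true)) :
    TwoSq r ∨ ∃ p ∈ ([(4, 2), (4, -2), (2, 4), (2, -4), (8, 0), (1, 3), (1, -3), (3, 1), (3, -1)] :
      List (ℤ × ℤ)), (p.1 : ZMod n) + p.2 * (r : ZMod n) ^ 2 = 0 ∧ (p.1 = 1 ∨ p.1 = 3 → m = 2) := by
  obtain ⟨b, h3⟩ := h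
  obtain ⟨c, d, e, f, h4, h5⟩ := h3.word₈ H
  have hd := h4.dvd_net
  rcases words_two_alternating b c d e f h5 with ⟨-, h6⟩ | ⟨h6, h7⟩ | ⟨h6, h7⟩ | h6
  · obtain ⟨l, hl, h7⟩ := h4.exists_ev (N := 4) (by simp) h6
    simp only [List.mem_cons, List.not_mem_nil, or_false] at hl
    rcases hl with rfl | rfl | rfl | rfl | rfl | rfl | rfl
    · exact Or.inl (twoSq_of_ev H (by simp) h7)
    · simp [ev] at h7; exact absurd h7 (H.four_ne_zero hn)
    · exact Or.inr ⟨(8, 0), by simp, by simpa [ev] using h7, by norm_num⟩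
    · exact Or.inr ⟨(2, 4), by simp, by simpa [ev, mul_comm] using h7, by norm_num⟩
    · exact Or.inr ⟨(2, -4), by simp, by simpa [ev, mul_comm] using h7, by norm_num⟩
    · exact Or.inr ⟨(4, 2), by simp, by simpa [ev, mul_comm] using h7, by norm_num⟩
    · exact Or.inr ⟨(4, -2), by simp, by simpa [ev, mul_comm] using h7, by norm_num⟩
  · rw [h6] at hd
    have h8 := Int.le_of_dvd (by norm_num) ((Int.dvd_neg).2 hd)
    obtain ⟨l, hl, h7⟩ := h4.exists_ev (N := 4) (by simp) h7
    refine Or.inl (twoSq_of_three H h2 hn ?_ hl h7)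
    push_cast at h8
    have : m = 2 ∨ m = 3 := by omega
    rcases this with rfl | rfl
    · norm_num at hd
    · rfl
  · obtain ⟨l, hl, h7⟩ := h4.exists_ev (N := 4) (by simp) h7
    have hm2 : m = 2 := by
      simp only [List.mem_cons, List.not_mem_nil, or_false] at h6
      rcases h6 with h6 | h6 <;> rw [h6] at hd
      · have h8 := Int.le_of_dvd (by norm_num) hd
        push_cast at h8; omega
      · have h8 := Int.le_of_dvd (by norm_num) ((Int.dvd_neg).2 hd)
        push_cast at h8; omega
    simp only [List.mem_cons, List.not_mem_nil, or_false] at hl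
    rcases hl with rfl | rfl | rfl | rfl | rfl | rfl
    · refine absurd (eq_four_of_le_two H h2 hm2.le (Or.inr ?_)) hn
      simp [ev] at h7; linear_combination h7
    · refine absurd (eq_four_of_le_two H h2 hm2.le (Or.inl ?_)) hn
      simp [ev] at h7; linear_combination -h7
    · exact Or.inr ⟨(1, 3), by simp, by simpa [ev, mul_comm] using h7, fun _ => hm2⟩
    · exact Or.inr ⟨(1, -3), by simp, by simpa [ev, mul_comm] using h7, fun _ => hm2⟩
    · exact Or.inr ⟨(3, 1), by simp, by simpa [ev, mul_comm] using h7, fun _ => hm2⟩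
    · exact Or.inr ⟨(3, -1), by simp, by simpa [ev, mul_comm] using h7, fun _ => hm2⟩
  · simp only [List.mem_cons, List.not_mem_nil, or_false] at h6
    rcases h6 with h6 | h6 <;> rw [h6] at hd
    · have h8 := Int.le_of_dvd (by norm_num) hd
      push_cast at h8; omega
    · have h8 := Int.le_of_dvd (by norm_num) ((Int.dvd_neg).2 hd)
      push_cast at h8; omega

/-- The case `m = 2`: every directed 3-arc lies on a closed directed walk of length 8. -/
theorem twoSq_of_two (H : Admissible m 2 n r) (h2 : (CPM m 2 n r).IsTwoArcTransitive)
    (hn : n ≠ 4) (hm : m = 2) : TwoSq r := by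
  subst hm
  have hq : ((r : ZMod n) ^ 2) ^ 2 = 1 ∨ ((r : ZMod n) ^ 2) ^ 2 = -1 := by
    rw [← pow_mul]
    rcases H.hr with h | h
    · left; rw [← Units.val_pow_eq_pow_val, h]; rfl
    · right; rw [← Units.val_pow_eq_pow_val, h]; rfl
  have key : ∀ b : Bool, Ext₃ 2 2 r 8 (U true) (U true) (U b) := by
    intro b
    have hcl : ∃ c : Bool, ((r : ZMod n) ^ 2) ^ 2 = -sg c := by
      rcases hq with h | h
      · exact ⟨false, by rw [h]; simp [sg]⟩
      · exact ⟨true, by rw [h]; simp [sg]⟩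
    obtain ⟨c, hc⟩ := hcl
    refine ⟨U b, ext_of_closed (w := [U c, U c, U (c == b), U (c == b)]) H ?_ ?_ ?_ _⟩
    · rw [closed_iff (by norm_num) _ 4 (by simp)]
      constructor
      · have h3 : net [U true, U true, U b, U b, U c, U c, U (c == b), U (c == b)] = 8 := rfl
        rw [h3]; norm_num
      · have h4 : ∀ b c : Bool, ∀ k < 2, classPoly 2 4 k
            [U true, U true, U b, U b, U c, U c, U (c == b), U (c == b)] =
            [1, sg b, sg c, sg c * sg b] := by decide
        intro k hk
        rw [h4 b c k hk]
        simp only [ev]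
        push_cast
        linear_combination (1 + sg b * (r : ZMod n) ^ 2) * (sg c * hc - sg_sq (n := n) c)
    · clear hc; revert b c; decide
    · left; clear hc; revert b c; decide
  rcases exists_rel_of_alternating H h2 hn le_rfl (ext_alternating H h2 key) with h | ⟨p, hp, h, -⟩
  · exact h
  -- Elimination of `q` from `x + y q = 0` and `q ^ 2 = ±1` shows that `n` divides `x ^ 2 ∓ y ^ 2`, if
  -- `y ≠ 0`. So `n` divides one of `8`, `10`, `12`, `20`.
  have h120 : (120 : ZMod n) = 0 := by
    simp only [List.mem_cons, List.not_mem_nil, or_false] at hp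
    rcases hp with rfl | rfl | rfl | rfl | rfl | rfl | rfl | rfl | rfl <;> simp at h <;>
      generalize (r : ZMod n) ^ 2 = q at h hq <;> rcases hq with hq | hq
    · linear_combination (10 * (4 - 2 * q)) * h + 40 * hq
    · linear_combination (6 * (4 - 2 * q)) * h + 24 * hq
    · linear_combination (10 * (4 + 2 * q)) * h + 40 * hq
    · linear_combination (6 * (4 + 2 * q)) * h + 24 * hq
    · linear_combination (-10 * (2 - 4 * q)) * h - 160 * hq
    · linear_combination (6 * (2 - 4 * q)) * h + 96 * hq
    · linear_combination (-10 * (2 + 4 * q)) * h - 160 * hq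
    · linear_combination (6 * (2 + 4 * q)) * h + 96 * hq
    · linear_combination 15 * h
    · linear_combination 15 * h
    · linear_combination (-15 * (1 - 3 * q)) * h - 135 * hq
    · linear_combination (12 * (1 - 3 * q)) * h + 108 * hq
    · linear_combination (-15 * (1 + 3 * q)) * h - 135 * hq
    · linear_combination (12 * (1 + 3 * q)) * h + 108 * hq
    · linear_combination (15 * (3 - q)) * h + 15 * hq
    · linear_combination (12 * (3 - q)) * h + 12 * hq
    · linear_combination (15 * (3 + q)) * h + 15 * hq
    · linear_combination (12 * (3 + q)) * h + 12 * hq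
  refine two_mul_sq_of_dvd H.hn hn h120 (x := p.1) (y := p.2) ?_ h
  simp only [List.mem_cons, List.not_mem_nil, or_false] at hp ⊢
  tauto

end CPMVertex

/-! ### The equation `2 r ^ 2 = ±2` and closed walks of net height 0 -/

namespace CPMVertex

variable {m n : ℕ} {r : (ZMod n)ˣ}

/-- The closed walks of length 8 through a directed 3-arc, for `m ≥ 3`. -/
theorem rel_of_ext_up (H : Admissible m 2 n r) (h2 : (CPM m 2 n r).IsTwoArcTransitive)
    (hn : n ≠ 4) (hm : 3 ≤ m) (hT : ¬ TwoSq r) {b : Bool} (h : Ext₃ m 2 r 8 (U true) (U true) (U b)) :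
    RelX ((r : ZMod n) ^ 2) b ∨ (m = 4 ∧ RelP ((r : ZMod n) ^ 2) b) := by
  obtain ⟨t, h3⟩ := h
  obtain ⟨c, d, e, f, h4, h5⟩ := h3.word₈ H
  have hd := h4.dvd_net
  rcases words_two_up_eight b t c d e f h5 with ⟨-, h6⟩ | ⟨h6, h7⟩ | ⟨h6, h7⟩ | h6
  · have h7 := ((closed_iff (by norm_num) _ 4 (by simp)).1 h4).2 0 (by norm_num)
    simp only [List.mem_cons, List.not_mem_nil, or_false] at h6
    rcases h6 with h6 | h6 | h6 | h6 <;> rw [h6] at h7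
    · exact absurd (twoSq_of_ev H (by simp) h7) hT
    · refine absurd (twoSq_of_ev H ?_ h7) hT
      cases b <;> simp [sg]
    · left; left
      simp only [ev] at h7; push_cast at h7; linear_combination h7
    · left; right
      simp only [ev] at h7; push_cast at h7; linear_combination h7
  · rw [h6] at hd
    have h8 := Int.le_of_dvd (by norm_num) hd
    obtain ⟨l, hl, h7⟩ := h4.exists_ev (N := 4) (by simp) h7
    exact absurd (twoSq_of_three H h2 hn (by push_cast at h8; omega) hl h7) hT
  · rw [h6] at hd
    have h8 := Int.le_of_dvd (by norm_num) hd
    have h9 : m = 3 ∨ m = 4 := by push_cast at h8; omega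
    have h10 : m = 4 := by
      rcases h9 with rfl | rfl
      · norm_num at hd
      · rfl
    exact Or.inr ⟨h10, mem_sign_lists h7
      (((closed_iff (by norm_num) _ 4 (by simp)).1 h4).2 0 (by norm_num))⟩
  · simp only [List.mem_cons, List.not_mem_nil, or_false] at h6
    rcases h6 with h6 | h6 | h6 <;> rw [h6] at hd
    · have h8 := Int.le_of_dvd (by norm_num) hd
      push_cast at h8; omega
    · have h8 := Int.le_of_dvd (by norm_num) ((Int.dvd_neg).2 hd)
      push_cast at h8; omega
    · have h8 := Int.le_of_dvd (by norm_num) hd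
      push_cast at h8; omega

/-- Each of the two equations in `RelX` closes a walk of length 8 that begins with an alternating
3-arc. -/
theorem ext_alternating_of_relX (H : Admissible m 2 n r) {b : Bool}
    (h : RelX ((r : ZMod n) ^ 2) b) : Ext₃ m 2 r 8 (D true) (U true) (D true) := by
  rcases h with h | h
  · refine ⟨U true, ext_of_closed (w := [U true, U b, D b, D false]) H ?_ ?_ ?_ _⟩
    · rw [closed_iff (by norm_num) _ 4 (by simp)]
      constructor
      · have h3 : net [D true, U true, D true, U true, U true, U b, D b, D false] = 0 := rfl
        rw [h3]; exact dvd_zero _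
      · have h4 : ∀ b : Bool, ∀ k < 2, classPoly 2 4 k
            [D true, U true, D true, U true, U true, U b, D b, D false] ∈ [[], [4, 2 * sg b]] := by
          decide
        intro k hk
        have h5 := h4 b k hk
        simp only [List.mem_cons, List.not_mem_nil, or_false] at h5
        rcases h5 with h5 | h5 <;> rw [h5]
        · rfl
        · simp only [ev]; push_cast; linear_combination h
    · clear h; revert b; decide
    · left; clear h; revert b; decide
  · refine ⟨D true, ext_of_closed (w := [D b, U b, U false, U true]) H ?_ ?_ ?_ _⟩
    · rw [closed_iff (by norm_num) _ 4 (by simp)]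
      constructor
      · have h3 : net [D true, U true, D true, D true, D b, U b, U false, U true] = 0 := rfl
        rw [h3]; exact dvd_zero _
      · have h4 : ∀ b : Bool, ∀ k < 2, classPoly 2 4 k
            [D true, U true, D true, D true, D b, U b, U false, U true] ∈ [[], [2, 4 * sg b]] := by
          decide
        intro k hk
        have h5 := h4 b k hk
        simp only [List.mem_cons, List.not_mem_nil, or_false] at h5
        rcases h5 with h5 | h5 <;> rw [h5]
        · rfl
        · simp only [ev]; push_cast; linear_combination h
    · clear h; revert b; decide
    · right; clear h; revert b; decide

/-- The converse of `rel_of_ext_up` for the equations `RelP`. -/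
theorem ext_up_of_relP (H : Admissible m 2 n r) (hm : m = 4) {b : Bool}
    (h : RelP ((r : ZMod n) ^ 2) b) : Ext₃ m 2 r 8 (U true) (U true) (U b) := by
  subst hm
  obtain ⟨c, d, h⟩ := h
  refine ⟨U b, ext_of_closed (w := [U c, U c, U d, U d]) H ?_ ?_ ?_ _⟩
  · rw [closed_iff (by norm_num) _ 4 (by simp)]
    constructor
    · have h3 : net [U true, U true, U b, U b, U c, U c, U d, U d] = 8 := rfl
      rw [h3]; norm_num
    · have h4 : ∀ b c d : Bool, ∀ k < 2, classPoly 2 4 k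
          [U true, U true, U b, U b, U c, U c, U d, U d] = [1, sg b, sg c, sg d] := by decide
      intro k hk
      rw [h4 b c d k hk]
      simp only [ev]; push_cast; linear_combination h
  · clear h; revert b c d; decide
  · left; clear h; revert b c d; decide

theorem forall_ext_up_of_alternating (H : Admissible m 2 n r)
    (h2 : (CPM m 2 n r).IsTwoArcTransitive) (h : Ext₃ m 2 r 8 (D true) (U true) (D true)) (b : Bool) :
    Ext₃ m 2 r 8 (U true) (U true) (U b) := by
  refine forall_ext₃ H h2 (t₀ := D true) (t₁ := U true) (by decide) (by decide) ?_ _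
    (by cases b <;> decide)
  rintro ⟨_ | _, c⟩ ht
  · cases c
    · exact absurd rfl ht
    · exact h
  · exact ⟨_, ext_anchor_up H true c _⟩

theorem relX_mem {q : ZMod n} {b : Bool} (h : RelX q b) :
    ∃ p ∈ ([(4, 2), (4, -2), (2, 4), (2, -4), (1, 3), (1, -3), (3, 1), (3, -1), (8, 0), (6, 0)] :
      List (ℤ × ℤ)), (p.1 : ZMod n) + p.2 * q = 0 := by
  rcases h with h | h <;> cases b <;> simp [sg] at h
  · exact ⟨(4, -2), by simp, by push_cast; linear_combination h⟩
  · exact ⟨(4, 2), by simp, by push_cast; linear_combination h⟩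
  · exact ⟨(2, -4), by simp, by push_cast; linear_combination h⟩
  · exact ⟨(2, 4), by simp, by push_cast; linear_combination h⟩

theorem relX_of_mem {q : ZMod n} {p : ℤ × ℤ} (hp : p ∈ ([(4, 2), (4, -2), (2, 4), (2, -4)] :
      List (ℤ × ℤ))) (h : (p.1 : ZMod n) + p.2 * q = 0) : ∃ b, RelX q b := by
  simp only [List.mem_cons, List.not_mem_nil, or_false] at hp
  rcases hp with rfl | rfl | rfl | rfl <;> simp at h
  · exact ⟨true, Or.inl (by simp [sg]; linear_combination h)⟩
  · exact ⟨false, Or.inl (by simp [sg]; linear_combination h)⟩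
  · exact ⟨true, Or.inr (by simp [sg]; linear_combination h)⟩
  · exact ⟨false, Or.inr (by simp [sg]; linear_combination h)⟩

theorem relX_not {q : ZMod n} {b : Bool} (h : RelX q b) (h' : RelX q !b) : (120 : ZMod n) = 0 := by
  rcases h with h | h <;> rcases h' with h' | h' <;> cases b <;> simp [sg] at h h'
  · linear_combination 15 * h + 15 * h'
  · linear_combination 15 * h + 15 * h'
  · linear_combination 24 * h + 12 * h'
  · linear_combination 24 * h + 12 * h'
  · linear_combination 12 * h + 24 * h'
  · linear_combination 12 * h + 24 * h'
  · linear_combination 30 * h + 30 * h'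
  · linear_combination 30 * h + 30 * h'

/-- Elimination of `q` from the equations of `RelX` and `RelP` with opposite signs, together with
`q ^ 4 = ±1`, shows that `n` divides `120`. -/
theorem relX_relP {q : ZMod n} (hq : q ^ 4 = 1 ∨ q ^ 4 = -1) {b : Bool} (h : RelX q b)
    (h' : RelP q !b) : (120 : ZMod n) = 0 := by
  obtain ⟨c, d, h'⟩ := h'
  -- Up to the sign of `q` the sign `b` is positive.
  obtain ⟨w, f, hw, hw', hwq⟩ : ∃ (w : ZMod n) (f : Bool), (4 + 2 * w = 0 ∨ 2 + 4 * w = 0) ∧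
      1 - w + sg c * w ^ 2 + sg f * w ^ 3 = 0 ∧ (w ^ 4 = 1 ∨ w ^ 4 = -1) := by
    cases b
    · refine ⟨-q, !d, ?_, ?_, ?_⟩
      · simpa [RelX, sg] using h
      · have : ((sg (!d) : ℤ) : ZMod n) = -sg d := by cases d <;> simp [sg]
        rw [this]; simp only [Bool.not_false, sg] at h' ⊢; push_cast at h' ⊢; linear_combination h'
      · rwa [show (-q) ^ 4 = q ^ 4 by ring]
    · refine ⟨q, d, ?_, ?_, hq⟩
      · simpa [RelX, sg] using h
      · simp [sg] at h' ⊢; linear_combination h'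
  clear h h' hq
  rcases hw with h | h
  -- The resultant of the two equations and that of `hw` and `w ^ 4 = ±1`.
  · have e1 : (24 + 32 * sg c - 64 * sg f : ZMod n) = 0 := by
      linear_combination 8 * hw' + (4 - 2 * (2 * w - 4) * sg c -
        sg f * (4 * w ^ 2 - 8 * w + 16)) * h
    have e2 : (240 : ZMod n) = 0 ∨ (272 : ZMod n) = 0 := by
      have e3 : 16 * w ^ 4 = 256 := by
        linear_combination (2 * w - 4) * (4 * w ^ 2 + 16) * h
      rcases hwq with h1 | h1 <;> rw [h1] at e3
      · left; linear_combination -e3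
      · right; linear_combination -e3
    rcases e2 with e2 | e2 <;> cases c <;> cases f <;> simp [sg] at e1 <;> ring_nf at e1
    · linear_combination 15 * (13 * e1 - 3 * e2)
    · linear_combination 5 * (3 * e1 + e2)
    · linear_combination e1
    · linear_combination -15 * e1
    · linear_combination 15 * (5 * e1 - e2)
    · linear_combination 15 * (15 * e1 + 4 * e2)
    · linear_combination e1
    · linear_combination -15 * e1
  · have e1 : (96 + 16 * sg c - 8 * sg f : ZMod n) = 0 := by
      linear_combination 64 * hw' + (16 - (16 * w - 8) * sg c -
        sg f * (16 * w ^ 2 - 8 * w + 4)) * h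
    have e2 : (240 : ZMod n) = 0 ∨ (272 : ZMod n) = 0 := by
      have e3 : 256 * w ^ 4 = 16 := by
        linear_combination (4 * w - 2) * (16 * w ^ 2 + 4) * h
      rcases hwq with h1 | h1 <;> rw [h1] at e3
      · left; linear_combination e3
      · right; linear_combination -e3
    rcases e2 with e2 | e2 <;> cases c <;> cases f <;> simp [sg] at e1 <;> ring_nf at e1
    · linear_combination 15 * (11 * e1 - 4 * e2)
    · linear_combination 5 * (e2 - 3 * e1)
    · linear_combination e1
    · linear_combination 15 * (7 * e1 - 3 * e2)
    · linear_combination 15 * (e2 - 3 * e1)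
    · linear_combination 15 * (-15 * e1 + 4 * e2)
    · linear_combination e1
    · linear_combination 15 * (-13 * e1 + 5 * e2)

/-- The equation of `RelX` leads to `2 r ^ 2 = ±2`. -/
theorem twoSq_of_relX (H : Admissible m 2 n r) (h2 : (CPM m 2 n r).IsTwoArcTransitive)
    (hn : n ≠ 4) (hm : 3 ≤ m) {b : Bool} (h : RelX ((r : ZMod n) ^ 2) b) : TwoSq r := by
  by_contra hT
  have h3 := forall_ext_up_of_alternating H h2 (ext_alternating_of_relX H h) (!b)
  have h120 : (120 : ZMod n) = 0 := by
    rcases rel_of_ext_up H h2 hn hm hT h3 with h4 | ⟨rfl, h4⟩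
    · exact relX_not h h4
    · refine relX_relP ?_ h h4
      rw [← pow_mul]
      rcases H.hr with h | h
      · left; rw [← Units.val_pow_eq_pow_val, h]; rfl
      · right; rw [← Units.val_pow_eq_pow_val, h]; rfl
  obtain ⟨p, hp, hq⟩ := relX_mem h
  exact hT (two_mul_sq_of_dvd H.hn hn h120 hp hq)

end CPMVertex

/-! ### The equation `2 r ^ 2 = ±2` for `m = 4` -/

namespace CPMVertex

variable {m n : ℕ} {r : (ZMod n)ˣ}

theorem words_two_down : ∀ b : Bool, ∀ c d e f g : Step,
    good [D b, D true, D false, c, d, e, f, g] = true →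
    (net [D b, D true, D false, c, d, e, f, g] = 0 ∧
      anyPoly 2 4 [D b, D true, D false, c, d, e, f, g]
        [[2], [2, 2], [2, -2], [4, 2], [4, -2], [2, 4], [2, -4]] = true) ∨
    (net [D b, D true, D false, c, d, e, f, g] = -8 ∧
      anyPoly 2 4 [D b, D true, D false, c, d, e, f, g]
        [[1, 1, 1, -sg b], [1, -1, 1, -sg b], [1, 1, -1, sg b], [1, -1, -1, sg b]] = true) ∨
    ¬ (8 : ℤ) ∣ net [D b, D true, D false, c, d, e, f, g] := by
  decide +kernel

theorem words_two_anchor_up : ∀ b c : Bool, ∀ d e f g : Step,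
    good [D true, U true, U b, U c, d, e, f, g] = true →
    anyPoly 2 4 [D true, U true, U b, U c, d, e, f, g]
        [[2], [2, 2], [2, -2], [4, 2], [4, -2], [2, 4], [2, -4]] = true ∨
    ¬ (8 : ℤ) ∣ net [D true, U true, U b, U c, d, e, f, g] := by
  decide +kernel

theorem rel_of_mem (H : Admissible m 2 n r) {l : List ℤ}
    (hl : l ∈ ([[2], [2, 2], [2, -2], [4, 2], [4, -2], [2, 4], [2, -4]] : List (List ℤ)))
    (h : ev ((r : ZMod n) ^ 2) l = 0) : TwoSq r ∨ ∃ b, RelX ((r : ZMod n) ^ 2) b := by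
  simp only [List.mem_cons, List.not_mem_nil, or_false] at hl
  rcases hl with rfl | rfl | rfl | rfl | rfl | rfl | rfl
  · exact Or.inl (twoSq_of_ev H (by simp) h)
  · exact Or.inl (twoSq_of_ev H (by simp) h)
  · exact Or.inl (twoSq_of_ev H (by simp) h)
  · exact Or.inr (relX_of_mem (p := (4, 2)) (by simp) (by simpa [ev, mul_comm] using h))
  · exact Or.inr (relX_of_mem (p := (4, -2)) (by simp) (by simpa [ev, mul_comm] using h))
  · exact Or.inr (relX_of_mem (p := (2, 4)) (by simp) (by simpa [ev, mul_comm] using h))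
  · exact Or.inr (relX_of_mem (p := (2, -4)) (by simp) (by simpa [ev, mul_comm] using h))

/-- Multiplication of the equation of a directed closed walk by a power of `q` rotates it. -/
theorem relP_of_rotated {q : ZMod n} (hq : q ^ 4 = 1 ∨ q ^ 4 = -1) {b : Bool} {l : List ℤ}
    (hl : l ∈ ([[1, 1, 1, -sg b], [1, -1, 1, -sg b], [1, 1, -1, sg b], [1, -1, -1, sg b]] :
      List (List ℤ))) (h : ev q l = 0) : RelP q !b := by
  obtain ⟨x, y, rfl⟩ : ∃ x y : Bool, l = [1, sg x, sg y, -(sg y * sg b)] := by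
    simp only [List.mem_cons, List.not_mem_nil, or_false] at hl
    rcases hl with rfl | rfl | rfl | rfl
    · exact ⟨true, true, by cases b <;> simp [sg]⟩
    · exact ⟨false, true, by cases b <;> simp [sg]⟩
    · exact ⟨true, false, by cases b <;> simp [sg]⟩
    · exact ⟨false, false, by cases b <;> simp [sg]⟩
  simp only [ev] at h
  push_cast at h
  have h1 : ((sg (!b) : ℤ) : ZMod n) = -sg b := by cases b <;> simp [sg]
  have h2 : ∀ x y : Bool, ((sg (x == y) : ℤ) : ZMod n) = sg x * sg y := by
    intro x y; cases x <;> cases y <;> simp [sg]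
  have hy := sg_sq (n := n) y
  rcases hq with hq | hq
  · refine ⟨y, x == y, ?_⟩
    rw [h1, h2]
    linear_combination sg y * q ^ 2 * h - (1 - q * sg b) * hy * q ^ 4 + (-1 + q * sg b) * hq
  · refine ⟨!y, x == !y, ?_⟩
    have h3 : ((sg (!y) : ℤ) : ZMod n) = -sg y := by cases y <;> simp [sg]
    rw [h1, h2, h3]
    linear_combination -sg y * q ^ 2 * h + (1 - q * sg b) * hy * q ^ 4 + (1 - q * sg b) * hq

/-- In the remaining case `m = 4` consider the 3-arcs that lie on no closed walk of length 8. They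
match the extensions of an arc at its two ends. The 2-arcs with an extension `y, z` on a
closed walk of length 8 such that `z` is the match of the match of the first vertex are
directed. -/
theorem twoSq_of_four (H : Admissible m 2 n r) (h2 : (CPM m 2 n r).IsTwoArcTransitive)
    (hn : n ≠ 4) (hm : m = 4) : TwoSq r := by
  by_contra hT
  have hX : ∀ b, ¬ RelX ((r : ZMod n) ^ 2) b := fun b h =>
    hT (twoSq_of_relX H h2 hn (by omega) h)
  have hq : ((r : ZMod n) ^ 2) ^ 4 = 1 ∨ ((r : ZMod n) ^ 2) ^ 4 = -1 := by
    subst hm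
    rw [← pow_mul]
    rcases H.hr with h | h
    · left; rw [← Units.val_pow_eq_pow_val, h]; rfl
    · right; rw [← Units.val_pow_eq_pow_val, h]; rfl
  have hd8 : ∀ {w}, Closed m 2 n r w → (8 : ℤ) ∣ net w := by
    intro w hw
    have := hw.dvd_net
    rw [hm] at this; simpa using this
  have hlist : ∀ {w}, Closed m 2 n r w → w.length ≤ 8 → ¬ anyPoly 2 4 w
        [[2], [2, 2], [2, -2], [4, 2], [4, -2], [2, 4], [2, -4]] = true := by
    intro w hw hl h
    obtain ⟨l, hl, h7⟩ := hw.exists_ev (N := 4) hl h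
    rcases rel_of_mem H hl h7 with h | ⟨b, h⟩
    · exact hT h
    · exact hX b h
  have hup : ∀ b, Ext₃ m 2 r 8 (U true) (U true) (U b) → RelP ((r : ZMod n) ^ 2) b := by
    intro b h
    rcases rel_of_ext_up H h2 hn (by omega) hT h with h | h
    · exact absurd h (hX b)
    · exact h.2
  -- Exactly one of the two extensions upwards of a directed 2-arc lies on closed walks of length 8.
  obtain ⟨b, hb⟩ := exists_ext_up H h2
  have hb' : ¬ RelP ((r : ZMod n) ^ 2) !b := by
    intro h
    have hall : ∀ c, Ext₃ m 2 r 8 (U true) (U true) (U c) := by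
      intro c
      by_cases hc : c = b
      · rw [hc]; exact hb
      · have : c = !b := by cases c <;> cases b <;> simp at hc ⊢
        rw [this]
        exact ext_up_of_relP H hm h
    rcases exists_rel_of_alternating H h2 hn (by omega) (ext_alternating H h2 hall) with
      h | ⟨p, hp, h, hp'⟩
    · exact hT h
    · simp only [List.mem_cons, List.not_mem_nil, or_false] at hp
      rcases hp with rfl | rfl | rfl | rfl | rfl | rfl | rfl | rfl | rfl
      · exact absurd (relX_of_mem (p := (4, 2)) (by simp) h) (by simpa using hX)
      · exact absurd (relX_of_mem (p := (4, -2)) (by simp) h) (by simpa using hX)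
      · exact absurd (relX_of_mem (p := (2, 4)) (by simp) h) (by simpa using hX)
      · exact absurd (relX_of_mem (p := (2, -4)) (by simp) h) (by simpa using hX)
      · have h8 : (8 : ZMod n) = 0 := by simpa using h
        exact hT (two_mul_sq_of_dvd H.hn hn (by linear_combination 15 * h8) (x := 8) (y := 0)
          (by simp) (by simpa using h8))
      · have := hp' (Or.inl rfl); omega
      · have := hp' (Or.inl rfl); omega
      · have := hp' (Or.inr rfl); omega
      · have := hp' (Or.inr rfl); omega
  obtain ⟨f, g, hf1, hf, hg1, hg, hfg, hfg'⟩ := exists_ext_map H h2 (t₀ := U true) (t₁ := U true)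
    (t₀' := D true) (t₁' := U true) (by decide) (by decide)
  have e1 : Ext m r 8 (base 2 n) (D true) (U true) (f (D true)) (g (D true) (D false)) :=
    (hfg _ _ _).2 (ext_up_up_down H true true _)
  -- The image of the extension upwards on no closed walk of length 8 is the alternating extension.
  have e2 : ¬ ∃ v, Ext m r 8 (base 2 n) (D true) (U true) (f (U !b)) v := by
    rintro ⟨v, hv⟩
    obtain ⟨u, rfl⟩ := (hg (U !b)).2 v
    exact hb' (hup _ ⟨_, (hfg _ _ _).1 hv⟩)
  have e3 : ¬ ∃ v, Ext m r 8 (run r [D true, U true, f (U !b)] (base 2 n)) (rev (f (U !b)))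
      (f (D true)) (g (D true) (D false)) v := by
    rw [hfg']
    rintro ⟨v, hv⟩
    have hv' : Ext m r 8 (run r [U true, U true, U !b] (base 2 n)) (D b) (D true) (D false) v := by
      have : rev (U !b) = D b := by simp [rev]
      rwa [this] at hv
    obtain ⟨c, d, x, y, h4, h5⟩ := hv'.word₈ H
    rcases words_two_down b v c d x y h5 with ⟨-, h6⟩ | ⟨-, h6⟩ | h6
    · exact hlist h4 (by simp) h6
    · obtain ⟨l, hl, h7⟩ := h4.exists_ev (N := 4) (by simp) h6
      exact hb' (relP_of_rotated hq hl h7)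
    · exact h6 (hd8 h4)
  have h3 := e1.ne_rev
  have h4 : f (U !b) ≠ rev (U true) := by rw [Ne, hf1]; simp [rev]
  have h5 : f (U !b) ≠ f (D true) := by rw [Ne, hf.1.eq_iff]; simp
  generalize f (U !b) = w at *
  generalize f (D true) = t at *
  generalize g (D true) (D false) = u at *
  have hw : w = D true := by
    rcases w with ⟨_ | _, c⟩
    · cases c
      · exact absurd rfl h4
      · rfl
    · exact absurd ⟨_, ext_anchor_up H true c _⟩ e2
  subst hw
  obtain ⟨c, rfl⟩ : ∃ c, t = U c := by
    rcases t with ⟨_ | _, c⟩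
    · cases c
      · exact absurd rfl h3.1
      · exact absurd rfl h5
    · exact ⟨c, rfl⟩
  rcases u with ⟨_ | _, d⟩
  · have hd : d = c := by
      have := h3.2
      cases c <;> cases d <;> simp [rev] at this ⊢
    subst hd
    exact e3 ⟨_, ext_up_up_down H false d _⟩
  · obtain ⟨x, y, z, a, h6, h7⟩ := e1.word₈ H
    rcases words_two_anchor_up c d x y z a h7 with h8 | h8
    · exact hlist h6 (by simp) h8
    · exact h8 (hd8 h6)

/-- A 2-arc-transitive graph with `s = 2` and `n ≠ 4` satisfies `2 r ^ 2 = ±2`. -/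
theorem twoSq (H : Admissible m 2 n r) (h2 : (CPM m 2 n r).IsTwoArcTransitive)
    (hn : n ≠ 4) : TwoSq r := by
  by_contra hT
  have hm1 := H.hm
  have h1 : m ≠ 1 := by
    rintro rfl
    refine hn (eq_four_of_le_two H h2 (by norm_num) ?_)
    rcases H.hr with h | h <;> rw [one_mul] at h
    · left; rw [← Units.val_pow_eq_pow_val, h]; rfl
    · right; rw [← Units.val_pow_eq_pow_val, h]; rfl
  have h3 : m ≠ 2 := fun h => hT (twoSq_of_two H h2 hn h)
  have h4 : m ≠ 4 := fun h => hT (twoSq_of_four H h2 hn h)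
  obtain ⟨b, hb⟩ := exists_ext_up H h2
  rcases rel_of_ext_up H h2 hn (by omega) hT hb with h | h
  · exact hT (twoSq_of_relX H h2 hn (by omega) h)
  · exact h4 h.1

end CPMVertex

/-! ### Rigid edge colourings -/

/-- A regular edge colouring of a graph that all its automorphisms respect up to a permutation of
the colours. The neighbour of `v` along the edge of colour `c` is `st c v`. By `rigid`, the images
of the first and of the last edge of a path with the colours `x, a, x` again have the same colour.
-/
structure SimpleGraph.RigidColouring {V : Type*} (Γ : SimpleGraph V) (C : Type*) where
  /-- The neighbour along the edge of a given colour. -/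
  st : C → V → V
  adj_iff : ∀ v w, Γ.Adj v w ↔ ∃ c, w = st c v
  st_st : ∀ c v, st c (st c v) = v
  inj : ∀ c c' v, st c v = st c' v → c = c'
  rigid : ∀ (φ : Γ ≃g Γ) (v : V) (x a x' y' : C), x ≠ a → φ (st x v) = st x' (φ v) →
    φ (st x (st a v)) = st y' (φ (st a v)) → x' = y'

namespace SimpleGraph.RigidColouring

variable {V C : Type*} {Γ : SimpleGraph V} (K : Γ.RigidColouring C)

/-- The automorphism `φ` permutes the colours of the edges by `π`. -/
def Acts (φ : Γ ≃g Γ) (π : Equiv.Perm C) : Prop := ∀ c v, φ (K.st c v) = K.st (π c) (φ v)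

theorem Acts.mul {K : Γ.RigidColouring C} {φ ψ : Γ ≃g Γ} {π ρ : Equiv.Perm C} (h : K.Acts φ π)
    (h' : K.Acts ψ ρ) : K.Acts (φ * ψ) (π * ρ) := fun c v => by
  change φ (ψ _) = K.st (π (ρ c)) (φ (ψ v))
  rw [h', h]

theorem Acts.inv {K : Γ.RigidColouring C} {φ : Γ ≃g Γ} {π : Equiv.Perm C} (h : K.Acts φ π) :
    K.Acts φ⁻¹ π⁻¹ := fun c v => by
  apply φ.injective
  have h1 : ∀ x, φ (φ⁻¹ x) = x := fun x => φ.apply_symm_apply x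
  rw [h1, h, h1]
  simp

theorem acts_one : K.Acts 1 1 := fun _ _ => rfl

theorem Acts.of_apply {K : Γ.RigidColouring C} {φ : Γ ≃g Γ} {π ρ : Equiv.Perm C} (h : K.Acts φ π)
    (v : V) (hv : ∀ c, φ (K.st c v) = K.st (ρ c) (φ v)) : K.Acts φ ρ := by
  have : π = ρ := Equiv.ext fun c => K.inj _ _ (φ v) (by rw [← h, hv])
  exact this ▸ h

theorem adj_st (c : C) (v : V) : Γ.Adj v (K.st c v) := (K.adj_iff _ _).2 ⟨c, rfl⟩

/-- A property that passes along the edges holds at all the vertices of a connected graph. -/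
theorem induct (hc : Γ.Preconnected) {p : V → Prop} {v₀ : V} (h₀ : p v₀)
    (hp : ∀ c v, p v → p (K.st c v)) (v : V) : p v := by
  obtain ⟨w⟩ := hc v₀ v
  induction w with
  | nil => exact h₀
  | cons h w ih =>
    obtain ⟨c, rfl⟩ := (K.adj_iff _ _).1 h
    exact ih (hp c _ h₀)

/-- An automorphism is determined by its permutation of the colours and the image of one vertex. -/
theorem eq_of_acts (hc : Γ.Preconnected) {φ ψ : Γ ≃g Γ} {π : Equiv.Perm C} {v₀ : V}
    (hφ : K.Acts φ π) (hψ : K.Acts ψ π) (h : φ v₀ = ψ v₀) : φ = ψ := by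
  refine RelIso.ext fun v => K.induct hc (p := fun v => φ v = ψ v) h (fun c v hv => ?_) v
  rw [hφ, hψ, hv]

/-- By `rigid` the permutation of the colours at a vertex is the same as at its neighbours. In a
connected graph it is the same everywhere. -/
theorem exists_acts (hc : Γ.Preconnected) [Finite C] (v₀ : V) (φ : Γ ≃g Γ) : ∃ π, K.Acts φ π := by
  have h1 : ∀ c v, ∃ c', φ (K.st c v) = K.st c' (φ v) := fun c v =>
    (K.adj_iff _ _).1 (φ.map_rel_iff.2 (K.adj_st c v))
  choose f hf using h1
  have hinj : ∀ v, Function.Injective fun c => f c v := by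
    intro v c c' h
    apply K.inj _ _ v
    apply φ.injective
    rw [hf, hf]
    exact congrArg (fun c => K.st c (φ v)) h
  have hstep : ∀ a v x, f x (K.st a v) = f x v := by
    intro a v x
    by_cases hxa : x = a
    · subst hxa
      apply K.inj _ _ (φ (K.st x v))
      rw [← hf, K.st_st, hf x v, K.st_st]
    · exact (K.rigid φ v x a _ _ hxa (hf x v) (hf x (K.st a v))).symm
  have hconst : ∀ v x, f x v = f x v₀ := fun v x =>
    K.induct hc (p := fun v => f x v = f x v₀) rfl (fun c v hv => by rw [hstep, hv]) v
  refine ⟨Equiv.ofBijective _ (Finite.injective_iff_bijective.1 (hinj v₀)), fun c v => ?_⟩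
  rw [hf, hconst]
  rfl

/-- If the group is 2-arc-transitive and contains an element that fixes a vertex and interchanges
two colours, then the stabilizer of a vertex induces all the permutations of the colours. -/
theorem exists_acts_of_swap (hc : Γ.Preconnected) [Finite C] [DecidableEq C]
    (h2 : Γ.IsTwoArcTransitive) {v₀ : V} {φ₀ : Γ ≃g Γ} {a b : C} (hab : a ≠ b) (hv₀ : φ₀ v₀ = v₀)
    (hφ₀ : K.Acts φ₀ (Equiv.swap a b)) (v : V) (π : Equiv.Perm C) :
    ∃ φ : Γ ≃g Γ, φ v = v ∧ K.Acts φ π := by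
  have hsw : ∀ x y : C, x ≠ y → ∃ φ : Γ ≃g Γ, φ v = v ∧ K.Acts φ (Equiv.swap x y) := by
    intro x y hxy
    have harc : ∀ w x y, x ≠ y → Γ.IsTwoArc (K.st x w) w (K.st y w) := fun w x y h =>
      ⟨(K.adj_st x w).symm, K.adj_st y w, fun h' => h (K.inj _ _ _ h')⟩
    obtain ⟨ψ, h3, h4, h5⟩ := h2 _ _ _ _ _ _ (harc v₀ a b hab) (harc v x y hxy)
    obtain ⟨ρ, hρ⟩ := K.exists_acts hc v₀ ψ
    have h6 : ρ a = x := K.inj _ _ v (by rw [← h3, hρ, h4])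
    have h7 : ρ b = y := K.inj _ _ v (by rw [← h5, hρ, h4])
    have h8 : ψ⁻¹ v = v₀ := by rw [← h4]; exact ψ.symm_apply_apply v₀
    refine ⟨ψ * φ₀ * ψ⁻¹, ?_, ?_⟩
    · change ψ (φ₀ (ψ⁻¹ v)) = v
      rw [h8, hv₀, h4]
    · have := (hρ.mul hφ₀).mul hρ.inv
      rwa [← Equiv.swap_apply_apply, h6, h7] at this
  have := Fintype.ofFinite C
  induction π using Equiv.Perm.swap_induction_on with
  | one => exact ⟨1, rfl, K.acts_one⟩
  | swap_mul f x y hxy ih =>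
    obtain ⟨φ, h3, h4⟩ := ih
    obtain ⟨ψ, h5, h6⟩ := hsw x y hxy
    exact ⟨ψ * φ, by change ψ (φ v) = v; rw [h3, h5], h6.mul h4⟩

/-- The stabilizer of a vertex acts faithfully on the colours. So if it induces all the
permutations, it is isomorphic to the symmetric group. -/
theorem card_stabilizer (hc : Γ.Preconnected) [Finite C] (v : V)
    (h : ∀ π, ∃ φ : Γ ≃g Γ, φ v = v ∧ K.Acts φ π) :
    Nat.card (MulAction.stabilizer (Γ ≃g Γ) v) = (Nat.card C).factorial := by
  rw [← Nat.card_perm]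
  choose f hf using fun φ : MulAction.stabilizer (Γ ≃g Γ) v => K.exists_acts hc v φ.1
  refine Nat.card_congr (Equiv.ofBijective f ⟨fun φ ψ h' => Subtype.ext ?_, fun π => ?_⟩)
  · refine K.eq_of_acts (v₀ := v) hc (hf φ) (h' ▸ hf ψ) ?_
    exact (MulAction.mem_stabilizer_iff.1 φ.2).trans (MulAction.mem_stabilizer_iff.1 ψ.2).symm
  · obtain ⟨φ, h3, h4⟩ := h π
    refine ⟨⟨φ, h3⟩, Equiv.ext fun c => K.inj _ _ (φ v) ?_⟩
    rw [← h4, ← hf ⟨φ, h3⟩ c v]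

/-- A vertex-transitive subgroup whose stabilizer of `v₀` induces all the transpositions of a
connected set of pairs of colours is the whole automorphism group. -/
theorem eq_top_of_swaps (hc : Γ.Preconnected) [Finite C] [DecidableEq C] {v₀ : V}
    (S : Subgroup (Γ ≃g Γ)) (htrans : ∀ v, ∃ φ ∈ S, φ v₀ = v)
    (h : ∀ a b : C, Relation.EqvGen (fun a b => ∃ φ ∈ S, φ v₀ = v₀ ∧ K.Acts φ (Equiv.swap a b)) a b) :
    S = ⊤ := by
  have hsw : ∀ a b : C, ∃ φ ∈ S, φ v₀ = v₀ ∧ K.Acts φ (Equiv.swap a b) := by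
    intro a b
    induction h a b with
    | rel _ _ h => exact h
    | refl x => exact ⟨1, one_mem _, rfl, by rw [Equiv.swap_self]; exact K.acts_one⟩
    | symm x y _ ih => rwa [Equiv.swap_comm]
    | trans x y z _ _ ih ih' =>
      obtain ⟨φ, h1, h3, h4⟩ := ih
      obtain ⟨ψ, h1', h3', h4'⟩ := ih'
      by_cases hxz : x = z
      · subst hxz; exact ⟨1, one_mem _, rfl, by rw [Equiv.swap_self]; exact K.acts_one⟩
      by_cases hxy : x = y
      · subst hxy; exact ⟨ψ, h1', h3', h4'⟩
      refine ⟨ψ * φ * ψ, mul_mem (mul_mem h1' h1) h1', ?_, ?_⟩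
      · change ψ (φ (ψ v₀)) = v₀; rw [h3', h3, h3']
      · have := (h4'.mul h4).mul h4'
        rwa [Equiv.swap_mul_swap_mul_swap hxy hxz, Equiv.swap_comm] at this
  rw [eq_top_iff]
  intro φ _
  obtain ⟨π, hπ⟩ := K.exists_acts hc v₀ φ
  have hall : ∀ π : Equiv.Perm C, ∃ φ ∈ S, φ v₀ = v₀ ∧ K.Acts φ π := by
    intro π
    have := Fintype.ofFinite C
    induction π using Equiv.Perm.swap_induction_on with
    | one => exact ⟨1, one_mem _, rfl, K.acts_one⟩
    | swap_mul f x y hxy ih =>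
      obtain ⟨φ, h1, h3, h4⟩ := ih
      obtain ⟨ψ, h1', h3', h4'⟩ := hsw x y
      exact ⟨ψ * φ, mul_mem h1' h1, by change ψ (φ v₀) = v₀; rw [h3, h3'], h4'.mul h4⟩
  obtain ⟨ψ, h1, h3⟩ := htrans (φ v₀)
  obtain ⟨ρ, hρ⟩ := K.exists_acts hc v₀ ψ
  obtain ⟨χ, h4, h5, h6⟩ := hall (ρ⁻¹ * π)
  have : φ = ψ * χ := by
    refine K.eq_of_acts (v₀ := v₀) hc hπ (by simpa using hρ.mul h6) ?_
    change φ v₀ = ψ (χ v₀)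
    rw [h5, h3]
  exact this ▸ mul_mem h1 h4

/-- A family of involutions that describe the neighbours in a graph is a rigid colouring if the
coincidence of the colours of the ends of a path of length 3 is preserved by the automorphisms. -/
def ofInvariant (st : C → V → V)
    (adj_iff : ∀ v w, Γ.Adj v w ↔ ∃ c, w = st c v) (st_st : ∀ c v, st c (st c v) = v)
    (inj : ∀ c c' v, st c v = st c' v → c = c') (P : V → V → V → V → Prop)
    (hP : ∀ (φ : Γ ≃g Γ) v₀ v₁ v₂ v₃, P v₀ v₁ v₂ v₃ → P (φ v₀) (φ v₁) (φ v₂) (φ v₃))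
    (hst : ∀ v x a y, x ≠ a → y ≠ a → (P (st x v) v (st a v) (st y (st a v)) ↔ x = y)) :
    Γ.RigidColouring C where
  st := st
  adj_iff := adj_iff
  st_st := st_st
  inj := inj
  rigid := by
    intro φ v x a x' y' hxa h1 h2
    obtain ⟨a', ha'⟩ := (adj_iff _ _).1 (φ.map_rel_iff.2 ((adj_iff _ _).2 ⟨a, rfl⟩) :
      Γ.Adj (φ v) (φ (st a v)))
    have h3 := hP φ _ _ _ _ ((hst v x a x hxa hxa).2 rfl)
    rw [h2, h1, ha'] at h3
    refine (hst (φ v) x' a' y' ?_ ?_).1 h3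
    · rintro rfl
      exact hxa (inj _ _ _ (φ.injective (h1.trans ha'.symm)))
    · rintro rfl
      rw [ha', st_st] at h2
      have h4 := congrArg (st x) (φ.injective h2)
      rw [st_st] at h4
      exact hxa (inj _ _ _ h4.symm)

end SimpleGraph.RigidColouring

/-! ### The colours of the edges -/

namespace CPMVertex

/-- The colours of the edges for `s = 2`: the first component tells which of the two coordinates
`v₀`, `v₁` changes along the edge, the second one is a sign. The colours of the edges that change
`v₀` are written `y⁺`, `y⁻` in comments, the other two `z⁺`, `z⁻`. -/
abbrev Colour := Bool × Bool

/-- An edge of colour `c` goes up from the height `h`: edges of level `h` change the coordinate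
`h mod 2`. -/
def isUp (c : Colour) (h : ℤ) : Bool := decide (h % 2 = 1) == c.1

/-- The step from the height `h` along the edge of colour `c`. The edge of level `L` between
`⟨L; v⟩` and `⟨L + 1; v + e r ^ L e_ℓ⟩` has the sign `e δ ^ ⌊L / 2⌋`, where `δ = ±1`. -/
def stp (δ : Bool) (c : Colour) (h : ℤ) : Step :=
  (isUp c h, (isUp c h == c.2) == (δ || decide (lvl (isUp c h, true) h / 2 % 2 = 0)))

/-- The steps of the walk from the height `h` along the edges of given colours. -/
def cwd (δ : Bool) : ℤ → List Colour → List Step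
  | _, [] => []
  | h, c :: w => stp δ c h :: cwd δ (nxt (stp δ c h) h) w

theorem stp_add (δ : Bool) (c : Colour) (h q : ℤ) : stp δ c (h + 4 * q) = stp δ c h := by
  have h1 : isUp c (h + 4 * q) = isUp c h := by
    rw [isUp, isUp, show (h + 4 * q) % 2 = h % 2 by omega]
  have h2 : ∀ t : Step, lvl t (h + 4 * q) / 2 % 2 = lvl t h / 2 % 2 := by
    rintro ⟨_ | _, _⟩ <;> simp only [lvl, if_true] <;> first | omega | (simp; omega)
  simp only [stp, h1, h2]

theorem nxt_add (t : Step) (h q : ℤ) : nxt t (h + q) = nxt t h + q := by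
  rcases t with ⟨_ | _, _⟩ <;> simp [nxt] <;> ring

theorem cwd_add (δ : Bool) (w : List Colour) (h q : ℤ) : cwd δ (h + 4 * q) w = cwd δ h w := by
  induction w generalizing h with
  | nil => rfl
  | cons c w ih => rw [cwd, cwd, stp_add, nxt_add, ih]

theorem cwd_emod (δ : Bool) (w : List Colour) (h : ℤ) : cwd δ h w = cwd δ (h % 4) w := by
  conv_lhs => rw [← Int.emod_add_mul_ediv h 4, cwd_add]

theorem stp_emod (δ : Bool) (c : Colour) (h : ℤ) : stp δ c h = stp δ c (h % 4) := by
  conv_lhs => rw [← Int.emod_add_mul_ediv h 4, stp_add]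

theorem emod_four_mem (h : ℤ) : h % 4 ∈ ([0, 1, 2, 3] : List ℤ) := by
  simp only [List.mem_cons, List.not_mem_nil, or_false]
  omega

theorem stp_inj {δ : Bool} {c c' : Colour} {h : ℤ} (he : stp δ c h = stp δ c' h) : c = c' := by
  have key : ∀ k ∈ ([0, 1, 2, 3] : List ℤ), ∀ (δ : Bool) (c c' : Colour),
      stp δ c k = stp δ c' k → c = c' := by decide
  rw [stp_emod, stp_emod δ c'] at he
  exact key _ (emod_four_mem h) _ _ _ he

theorem stp_surj (δ : Bool) (h : ℤ) (t : Step) : ∃ c, stp δ c h = t := by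
  have key : ∀ k ∈ ([0, 1, 2, 3] : List ℤ), ∀ (δ : Bool) (t : Step), ∃ c, stp δ c k = t := by decide
  obtain ⟨c, hc⟩ := key _ (emod_four_mem h) δ t
  exact ⟨c, by rw [stp_emod, hc]⟩

/-- The two ends of an edge agree on its colour. -/
theorem stp_nxt (δ : Bool) (c : Colour) (h : ℤ) :
    stp δ c (nxt (stp δ c h) h) = rev (stp δ c h) := by
  have key : ∀ k ∈ ([0, 1, 2, 3] : List ℤ), ∀ (δ : Bool) (c : Colour),
      stp δ c (nxt (stp δ c k) k) = rev (stp δ c k) := by decide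
  have h1 := key _ (emod_four_mem h) δ c
  have h2 : nxt (stp δ c h) h = nxt (stp δ c h) (h % 4) + 4 * (h / 4) := by
    rw [← nxt_add, Int.emod_add_mul_ediv]
  rw [h2, stp_add, stp_emod δ c h, h1]

variable {m n : ℕ} {r : (ZMod n)ˣ} {δ : Bool}

/-- The unit `±1`. -/
def sgu (b : Bool) : (ZMod n)ˣ := if b then 1 else -1

/-- The unit `κ = δ r ^ 2`. -/
def kap (δ : Bool) (r : (ZMod n)ˣ) : (ZMod n)ˣ := sgu δ * r ^ 2

/-- The weight `δ ^ ⌊L / 2⌋ r ^ L` of the level `L`. -/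
def wt (δ : Bool) (r : (ZMod n)ˣ) (L : ℤ) : (ZMod n)ˣ := kap δ r ^ (L / 2) * r ^ (L % 2)

/-- The step along the edge of colour `c` on the cover. -/
def cst (δ : Bool) (r : (ZMod n)ˣ) (c : Colour) (X : ℤ × (ZMod 2 → ZMod n)) :
    ℤ × (ZMod 2 → ZMod n) := move r (stp δ c X.1) X

/-- The index of the coordinate that changes along the edges of colour `c`. -/
def ix (c : Colour) : ZMod 2 := if c.1 then 1 else 0

theorem sg_beq (a b : Bool) : sg (a == b) = sg a * sg b := by
  cases a <;> cases b <;> rfl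

@[simp] theorem val_sgu (b : Bool) : ((sgu b : (ZMod n)ˣ) : ZMod n) = (sg b : ℤ) := by
  cases b <;> simp [sgu, sg]

theorem wt_eq (δ : Bool) (r : (ZMod n)ˣ) (L : ℤ) :
    wt δ r L = sgu (δ || decide (L / 2 % 2 = 0)) * r ^ L := by
  have h1 : r ^ L = r ^ (2 * (L / 2)) * r ^ (L % 2) := by
    rw [← zpow_add, Int.mul_ediv_add_emod]
  have h2 : (sgu δ : (ZMod n)ˣ) ^ (L / 2) = sgu (δ || decide (L / 2 % 2 = 0)) := by
    cases δ
    · rcases Int.even_or_odd (L / 2) with h | h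
      · simp [sgu, h.neg_one_zpow, Int.even_iff.1 h]
      · simp [sgu, h.neg_one_zpow, Int.odd_iff.1 h]
    · simp [sgu]
  rw [wt, kap, mul_zpow, h2, h1, zpow_mul, mul_assoc]
  norm_cast

theorem lvl_cast (c : Colour) (h : ℤ) (b : Bool) : ((lvl (isUp c h, b) h : ℤ) : ZMod 2) = ix c := by
  have h1 : lvl (isUp c h, b) h % 2 = if c.1 then 1 else 0 := by
    rcases c with ⟨_ | _, _⟩ <;> rcases Int.emod_two_eq h with h2 | h2 <;> simp [lvl, isUp, h2] <;>
      omega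
  rw [ix, ← Int.emod_add_mul_ediv (lvl (isUp c h, b) h) 2, h1]
  rcases c with ⟨_ | _, _⟩ <;> simp <;> left <;> rfl

theorem cst_fst (c : Colour) (X : ℤ × (ZMod 2 → ZMod n)) :
    (cst δ r c X).1 = if isUp c X.1 then X.1 + 1 else X.1 - 1 := rfl

theorem cst_snd (c : Colour) (X : ℤ × (ZMod 2 → ZMod n)) :
    (cst δ r c X).2 = X.2 + Pi.single (ix c) ((sg (isUp c X.1) : ZMod n) * sg c.2 *
      wt δ r (if isUp c X.1 then X.1 else X.1 - 1)) := by
  rw [cst, move, stp, lvl_cast]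
  simp only [lvl, sg_beq, Int.cast_mul]
  congr 2
  rw [wt_eq, Units.val_mul, val_sgu, mul_assoc]
  congr!

theorem cst_cst (c : Colour) (X : ℤ × (ZMod 2 → ZMod n)) : cst δ r c (cst δ r c X) = X := by
  rw [cst, show (cst δ r c X).1 = nxt (stp δ c X.1) X.1 from rfl, stp_nxt, cst, move_rev]

theorem run_cwd (c : Colour) (w : List Colour) (X : ℤ × (ZMod 2 → ZMod n)) :
    run r (cwd δ X.1 (c :: w)) X = run r (cwd δ (cst δ r c X).1 w) (cst δ r c X) := rfl

/-- The assumptions on the parameters under which the colours of the edges are defined and the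
products of three different colours are involutions. -/
structure ColourData (m : ℕ) {n : ℕ} (r : (ZMod n)ˣ) (δ : Bool) : Prop where
  two : 2 * (kap δ r : ZMod n) = 2
  pow : kap δ r ^ m = 1

/-- The weights, and so the colours, depend only on the level modulo `2 m`. -/
theorem ColourData.wt_add (K : ColourData m r δ) (L q : ℤ) :
    wt δ r (L + ((m * 2 : ℕ) : ℤ) * q) = wt δ r L := by
  have h1 : (L + ((m * 2 : ℕ) : ℤ) * q) / 2 = L / 2 + m * q := by
    rw [show L + ((m * 2 : ℕ) : ℤ) * q = L + (m * q) * 2 by push_cast; ring]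
    exact Int.add_mul_ediv_right _ _ (by norm_num)
  have h2 : (L + ((m * 2 : ℕ) : ℤ) * q) % 2 = L % 2 := by
    rw [show L + ((m * 2 : ℕ) : ℤ) * q = L + (m * q) * 2 by push_cast; ring]
    exact Int.add_mul_emod_self_right _ _ _
  rw [wt, wt, h1, h2, zpow_add, zpow_mul, zpow_natCast, K.pow, one_zpow, mul_one]

theorem ColourData.cst_congr (K : ColourData m r δ) (c : Colour) {X Y : ℤ × (ZMod 2 → ZMod n)}
    (h : proj m X = proj m Y) : proj m (cst δ r c X) = proj m (cst δ r c Y) := by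
  obtain ⟨h1, h2⟩ := Prod.ext_iff.1 h
  obtain ⟨q, hq⟩ := (ZMod.intCast_eq_intCast_iff_dvd_sub _ _ _).1 h1
  have h3 : Y.1 = X.1 + ((m * 2 : ℕ) : ℤ) * q := by linarith
  have h4 : isUp c Y.1 = isUp c X.1 := by
    rw [isUp, isUp, h3, show X.1 + ((m * 2 : ℕ) : ℤ) * q = X.1 + (m * q) * 2 by push_cast; ring,
      Int.add_mul_emod_self_right]
  refine Prod.ext ?_ ?_
  · change (((cst δ r c X).1 : ℤ) : ZMod (m * 2)) = ((cst δ r c Y).1 : ℤ)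
    change ((X.1 : ℤ) : ZMod (m * 2)) = (Y.1 : ℤ) at h1
    rw [cst_fst, cst_fst, h4]
    split_ifs <;> push_cast <;> rw [h1]
  · change (cst δ r c X).2 = (cst δ r c Y).2
    have h5 : X.2 = Y.2 := h2
    rw [cst_snd, cst_snd, h4, h5, h3]
    congr 3
    split_ifs
    · rw [K.wt_add]
    · rw [add_sub_right_comm, K.wt_add]

/-- A lift of a vertex to the cover. -/
def lift (x : CPMVertex m 2 n) : ℤ × (ZMod 2 → ZMod n) := ((x.1.cast : ℤ), x.2)

@[simp] theorem proj_lift (x : CPMVertex m 2 n) : proj m (lift x) = x :=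
  Prod.ext (by simp [proj, lift]) rfl

/-- The neighbour of a vertex of `CPM(m, 2, n; r)` along the edge of colour `c`. -/
def vst (H : Admissible m 2 n r) (δ : Bool) (c : Colour) (x : CPMSet m 2 n r) : CPMSet m 2 n r :=
  ⟨proj m (cst δ r c (lift x.1)), mem_cpmSet_of_adj (x := proj m (lift x.1))
    (by rw [proj_lift]; exact x.2) (adj_move H _ _)⟩

theorem vst_eq (H : Admissible m 2 n r) (K : ColourData m r δ) (c : Colour)
    {x : CPMSet m 2 n r} {X : ℤ × (ZMod 2 → ZMod n)} (hx : x.1 = proj m X) :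
    (vst H δ c x).1 = proj m (cst δ r c X) :=
  K.cst_congr c (by rw [proj_lift, hx])

theorem vst_vst (H : Admissible m 2 n r) (K : ColourData m r δ) (c : Colour)
    (x : CPMSet m 2 n r) : vst H δ c (vst H δ c x) = x := by
  apply Subtype.ext
  rw [vst_eq H K c (X := cst δ r c (lift x.1)) rfl, cst_cst, proj_lift]

theorem vst_inj (H : Admissible m 2 n r) {c c' : Colour} {x : CPMSet m 2 n r}
    (h : vst H δ c x = vst H δ c' x) : c = c' :=
  stp_inj (step_eq_of_proj_move_eq H (Subtype.ext_iff.1 h))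

theorem adj_iff_vst (H : Admissible m 2 n r) (x y : CPMSet m 2 n r) :
    (CPM m 2 n r).Adj x y ↔ ∃ c, y = vst H δ c x := by
  change (CPMbar m 2 n r).Adj x.1 y.1 ↔ _
  rw [← proj_lift x.1, adj_proj_iff H]
  constructor
  · rintro ⟨t, ht⟩
    obtain ⟨c, rfl⟩ := stp_surj δ (lift x.1).1 t
    exact ⟨c, Subtype.ext ht⟩
  · rintro ⟨c, rfl⟩
    exact ⟨_, rfl⟩

end CPMVertex

/-! ### Hexagons -/

namespace CPMVertex

variable {m n : ℕ} {r : (ZMod n)ˣ} {δ : Bool}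

/-- The equation `2 r ^ 2 = ±2` says `2 κ = 2` for `κ = ±r ^ 2`. Then `κ ^ m = ±1`, and the sign is
positive since `n ≠ 4`. -/
theorem exists_colourData (H : Admissible m 2 n r) (hn : n ≠ 4) (hT : TwoSq r) :
    ∃ δ, ColourData m r δ := by
  obtain ⟨d, hd⟩ := hT
  have h2 : 2 * (kap d r : ZMod n) = 2 := by
    rw [kap, Units.val_mul, val_sgu, Units.val_pow_eq_pow_val]
    linear_combination (sg d : ZMod n) * hd + 2 * sg_sq d
  refine ⟨d, h2, ?_⟩
  have h3 : ∀ k : ℕ, 2 * (kap d r : ZMod n) ^ k = 2 := by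
    intro k
    induction k with
    | zero => simp
    | succ k ih => rw [pow_succ, ← mul_assoc, ih, h2]
  have h4 : kap d r ^ m = 1 ∨ kap d r ^ m = -1 := by
    rw [kap, mul_pow, ← pow_mul, mul_comm 2 m]
    have h5 : (sgu d : (ZMod n)ˣ) ^ m = 1 ∨ (sgu d : (ZMod n)ˣ) ^ m = -1 := by
      cases d
      · simpa [sgu] using neg_one_pow_eq_or (ZMod n)ˣ m
      · simp [sgu]
    rcases h5 with h5 | h5 <;> rcases H.hr with h6 | h6 <;> rw [h5, h6] <;> simp
  refine h4.resolve_right fun h5 => H.four_ne_zero hn ?_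
  have h6 := h3 m
  rw [← Units.val_pow_eq_pow_val, h5] at h6
  push_cast at h6
  linear_combination -h6

theorem colourData_of_eq_four {r : (ZMod 4)ˣ} : ColourData 2 r false := by
  have h1 : r ^ 2 = 1 := by revert r; decide
  constructor
  · rw [kap, h1]; decide
  · rw [kap, h1]; decide

/-- The hexagons with the colours `x, a, y, x, a, y`. -/
theorem hexagon_word : ∀ k ∈ ([0, 1, 2, 3] : List ℤ), ∀ (δ : Bool) (x a y : Colour),
    x ≠ a → y ≠ a → x ≠ y →
      nb (cwd δ k [x, a, y, x, a, y]) = true ∧ net (cwd δ k [x, a, y, x, a, y]) = 0 ∧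
      (cwd δ k [x, a, y, x, a, y]).head? ≠ (cwd δ k [x, a, y, x, a, y]).getLast?.map rev ∧
      ∀ i < 2, classPoly 2 3 i (cwd δ k [x, a, y, x, a, y]) ∈
        ([[], [2, -(2 * sg δ)]] : List (List ℤ)) := by
  decide +kernel

set_option synthInstance.maxSize 1000 in
/-- The closed walks of length 6 that begin with edges of colours `x, a, x`. -/
theorem words_same : ∀ k ∈ ([0, 1, 2, 3] : List ℤ), ∀ (δ : Bool) (x a : Colour) (u v t : Step),
    x ≠ a → good (cwd δ k [x, a, x] ++ [u, v, t]) = true →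
      (x.1 = a.1 ∧ anyPoly 2 3 (cwd δ k [x, a, x] ++ [u, v, t]) [[2], [6]] = true) ∨
      anyPoly 2 3 (cwd δ k [x, a, x] ++ [u, v, t]) [[2], [2, 2 * sg δ]] = true ∨
      (net (cwd δ k [x, a, x] ++ [u, v, t]) ∈ ([4, -4] : List ℤ) ∧
        anyPoly 2 3 (cwd δ k [x, a, x] ++ [u, v, t]) [[1, 1], [1, -1]] = true) ∨
      (net (cwd δ k [x, a, x] ++ [u, v, t]) ∈ ([6, -6] : List ℤ) ∧
        anyPoly 2 3 (cwd δ k [x, a, x] ++ [u, v, t])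
          [[1, 1, 1], [1, 1, -1], [1, -1, 1], [1, -1, -1]] = true) ∨
      net (cwd δ k [x, a, x] ++ [u, v, t]) ∈ ([2, -2] : List ℤ) := by
  decide +kernel

/-- The product of the steps along three edges of different colours is an involution, so that the
path with the colours `x, a, y` lies on the hexagon with the colours `x, a, y, x, a, y`. -/
theorem ext_hexagon (H : Admissible m 2 n r) (K : ColourData m r δ) (Y : ℤ × (ZMod 2 → ZMod n))
    {x a y : Colour} (hxa : x ≠ a) (hya : y ≠ a) (hxy : x ≠ y) :
    (CPMbar m 2 n r).NBCycle 6 (proj m Y) (proj m (cst δ r x Y)) (proj m (cst δ r a (cst δ r x Y)))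
      (proj m (cst δ r y (cst δ r a (cst δ r x Y))))
      (proj m (cst δ r x (cst δ r y (cst δ r a (cst δ r x Y))))) := by
  obtain ⟨h1, h2, h3, h4⟩ := hexagon_word _ (emod_four_mem Y.1) δ x a y hxa hya hxy
  rw [← cwd_emod] at h1 h2 h3 h4
  refine ext_of_closed (w := cwd δ (cst δ r x (cst δ r y (cst δ r a (cst δ r x Y)))).1 [a, y])
    H ?_ h1 (Or.inr ⟨h2, h3⟩) Y
  change Closed m 2 n r (cwd δ Y.1 [x, a, y, x, a, y])
  rw [closed_iff (by norm_num) _ 3 (by simp [cwd])]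
  refine ⟨by rw [h2]; exact dvd_zero _, fun i hi => ?_⟩
  have h5 := h4 i hi
  simp only [List.mem_cons, List.not_mem_nil, or_false] at h5
  rcases h5 with h5 | h5 <;> rw [h5]
  · rfl
  · have h6 := K.two
    have h7 := sg_sq (n := n) δ
    rw [kap, Units.val_mul, val_sgu, Units.val_pow_eq_pow_val] at h6
    simp only [ev]
    push_cast
    linear_combination -h6

/-- Paths with the colours `x, a, x` lie on no hexagon unless `n` divides `6`. -/
theorem six_eq_zero_of_nbCycle (H : Admissible m 2 n r) (K : ColourData m r δ) (hn : n ≠ 4)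
    (hm : m ≠ 1) (hm2 : m = 2 → ¬ ((r : ZMod n) ^ 2 = 1 ∨ (r : ZMod n) ^ 2 = -1))
    (Y : ℤ × (ZMod 2 → ZMod n)) {x a : Colour} (hxa : x ≠ a) {z : CPMVertex m 2 n}
    (h : (CPMbar m 2 n r).NBCycle 6 (proj m Y) (proj m (cst δ r x Y))
      (proj m (cst δ r a (cst δ r x Y))) (proj m (cst δ r x (cst δ r a (cst δ r x Y)))) z) :
    (6 : ZMod n) = 0 ∧ (x.1 ≠ a.1 → m = 3 ∧ n = 3) := by
  have hm1 := H.hm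
  have hn3 := H.hn
  have h2 := K.two
  have hd := sg_sq (n := n) δ
  rw [kap, Units.val_mul, val_sgu, Units.val_pow_eq_pow_val] at h2
  have hq2 : 2 * (r : ZMod n) ^ 2 = 2 * sg δ := by
    linear_combination (sg δ : ZMod n) * h2 - 2 * (r : ZMod n) ^ 2 * hd
  obtain ⟨t, rfl⟩ : ∃ t, z = proj m (move r t (cst δ r x (cst δ r a (cst δ r x Y)))) := by
    obtain ⟨p, h1, -, -, -, -, -, h3, h4⟩ := h
    rw [← h4, ← adj_proj_iff H, ← h3]
    exact h1 3
  obtain ⟨u, v, h3, h4⟩ := Ext.word₆ (m := m) (r := r) (X := Y) (t₀ := stp δ x Y.1)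
    (t₁ := stp δ a (cst δ r x Y).1) (t₂ := stp δ x (cst δ r a (cst δ r x Y)).1) (t₃ := t) H h
  change Closed m 2 n r (cwd δ Y.1 [x, a, x] ++ [t, u, v]) at h3
  change good (cwd δ Y.1 [x, a, x] ++ [t, u, v]) = true at h4
  have h5 := words_same _ (emod_four_mem Y.1) δ x a t u v hxa
  rw [← cwd_emod] at h5
  have hlen : (cwd δ Y.1 [x, a, x] ++ [t, u, v]).length ≤ 2 * 3 := by simp [cwd]
  have hdvd := h3.dvd_net
  rcases h5 h4 with ⟨hx, h6⟩ | h6 | ⟨h7, h6⟩ | ⟨h7, h6⟩ | h7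
  · obtain ⟨l, hl, h6⟩ := h3.exists_ev hlen h6
    simp only [List.mem_cons, List.not_mem_nil, or_false] at hl
    rcases hl with rfl | rfl <;> simp [ev] at h6
    · exact absurd h6 H.two_ne_zero
    · exact ⟨h6, fun h8 => absurd hx h8⟩
  · obtain ⟨l, hl, h6⟩ := h3.exists_ev hlen h6
    simp only [List.mem_cons, List.not_mem_nil, or_false] at hl
    rcases hl with rfl | rfl <;> simp [ev] at h6
    · exact absurd h6 H.two_ne_zero
    · exact absurd (by linear_combination h6 - h2) (H.four_ne_zero hn)
  · have hm' : m = 2 := by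
      have : (m : ℤ) ∣ 2 := by
        simp only [List.mem_cons, List.not_mem_nil, or_false] at h7
        rcases h7 with h7 | h7 <;> rw [h7] at hdvd <;> push_cast at hdvd
        · exact (mul_dvd_mul_iff_right (by norm_num : (2 : ℤ) ≠ 0)).1 (by simpa using hdvd)
        · exact (mul_dvd_mul_iff_right (by norm_num : (2 : ℤ) ≠ 0)).1 (by simpa using hdvd)
      have := Int.le_of_dvd (by norm_num) this
      omega
    obtain ⟨l, hl, h6⟩ := h3.exists_ev hlen h6
    refine absurd ?_ (hm2 hm')
    simp only [List.mem_cons, List.not_mem_nil, or_false] at hl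
    rcases hl with rfl | rfl <;> simp [ev] at h6
    · right; linear_combination h6
    · left; linear_combination -h6
  · have hm' : m = 3 := by
      have : (m : ℤ) ∣ 3 := by
        simp only [List.mem_cons, List.not_mem_nil, or_false] at h7
        rcases h7 with h7 | h7 <;> rw [h7] at hdvd <;> push_cast at hdvd
        · exact (mul_dvd_mul_iff_right (by norm_num : (2 : ℤ) ≠ 0)).1 (by simpa using hdvd)
        · exact (mul_dvd_mul_iff_right (by norm_num : (2 : ℤ) ≠ 0)).1 (by simpa using hdvd)
      have h8 := Int.le_of_dvd (by norm_num) this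
      have : m ≠ 2 := by rintro rfl; revert this; decide
      omega
    obtain ⟨l, hl, h6⟩ := h3.exists_ev hlen h6
    obtain ⟨b, c, rfl⟩ : ∃ b c : Bool, l = [1, sg b, sg c] := by
      simp only [List.mem_cons, List.not_mem_nil, or_false] at hl
      rcases hl with rfl | rfl | rfl | rfl
      exacts [⟨true, true, rfl⟩, ⟨true, false, rfl⟩, ⟨false, true, rfl⟩, ⟨false, false, rfl⟩]
    simp only [ev] at h6
    push_cast at h6
    have h9 : ((2 + 2 * (sg δ * sg b) + 2 * sg c : ℤ) : ZMod n) = 0 := by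
      push_cast
      linear_combination 2 * h6 - (sg b : ZMod n) * hq2 - sg c * ((r : ZMod n) ^ 2 + sg δ) * hq2
        - 2 * sg c * hd
    have h10 : (6 : ZMod n) = 0 := by
      have key : ∀ δ b c : Bool, (2 + 2 * (sg δ * sg b) + 2 * sg c) = 6 ∨
          (2 + 2 * (sg δ * sg b) + 2 * sg c) = 2 ∨ (2 + 2 * (sg δ * sg b) + 2 * sg c) = -2 := by
        decide
      rcases key δ b c with h11 | h11 | h11 <;> rw [h11] at h9 <;> push_cast at h9
      · exact h9
      · exact absurd h9 H.two_ne_zero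
      · exact absurd (by linear_combination -h9) H.two_ne_zero
    refine ⟨h10, fun _ => ⟨hm', ?_⟩⟩
    have h11 : n ∣ 6 := by rw [← ZMod.natCast_eq_zero_iff]; exact_mod_cast h10
    have h12 := Nat.le_of_dvd (by norm_num) h11
    have h13 : n = 3 ∨ n = 6 := by interval_cases n <;> simp_all
    refine h13.resolve_right ?_
    rintro rfl
    have h14 : r ^ 2 = 1 := by clear * -; revert r; decide
    rw [← Units.val_pow_eq_pow_val, h14] at h6
    clear * - h6
    revert b c; decide
  · have : (m : ℤ) ∣ 1 := by
      simp only [List.mem_cons, List.not_mem_nil, or_false] at h7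
      rcases h7 with h7 | h7 <;> rw [h7] at hdvd <;> push_cast at hdvd
      · exact (mul_dvd_mul_iff_right (by norm_num : (2 : ℤ) ≠ 0)).1 (by simpa using hdvd)
      · exact (mul_dvd_mul_iff_right (by norm_num : (2 : ℤ) ≠ 0)).1 (by simpa using hdvd)
    exact absurd (by exact_mod_cast Int.eq_one_of_dvd_one (by positivity) this) hm

/-- If `n` divides `6`, then the walks that alternate between two levels have length 6, as have the
hexagons. So all the 3-arcs lie on 6-cycles. -/
theorem eq_three_of_six_eq_zero (H : Admissible m 2 n r) (h2 : (CPM m 2 n r).IsTwoArcTransitive)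
    (K : ColourData m r δ) (hn : n ≠ 4)
    (hm : m ≠ 1) (hm2 : m = 2 → ¬ ((r : ZMod n) ^ 2 = 1 ∨ (r : ZMod n) ^ 2 = -1))
    (h6 : (6 : ZMod n) = 0) : m = 3 ∧ n = 3 := by
  have hup : ∀ c : Bool, Ext m r 6 (base 2 n) (D true) (U true) (U c) (U (!δ)) := by
    intro c
    refine ext_of_closed (w := [D (!δ), D (!c)]) H ?_ ?_ ?_ _
    · rw [closed_iff (by norm_num) _ 3 (by simp)]
      refine ⟨by cases δ <;> cases c <;> exact dvd_zero _, fun i hi => ?_⟩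
      have h4 : ∀ δ c : Bool, ∀ i < 2, classPoly 2 3 i [D true, U true, U c, U (!δ), D (!δ), D (!c)] ∈
          ([[], [2, -(2 * sg δ)]] : List (List ℤ)) := by decide +kernel
      have h5 := h4 δ c i hi
      simp only [List.mem_cons, List.not_mem_nil, or_false] at h5
      rcases h5 with h5 | h5 <;> rw [h5]
      · rfl
      · have h6 := K.two
        rw [kap, Units.val_mul, val_sgu, Units.val_pow_eq_pow_val] at h6
        simp only [ev]
        push_cast
        linear_combination -h6
    · clear K; revert δ c; decide
    · clear K; revert δ c; decide
  have halt : Ext m r 6 (base 2 n) (D true) (U true) (D true) (U true) := by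
    refine ext_of_closed (w := [D true, U true]) H ?_ (by decide) (by decide) _
    rw [closed_iff (by norm_num) _ 3 (by simp)]
    refine ⟨dvd_zero _, fun i hi => ?_⟩
    have h4 : ∀ i < 2, classPoly 2 3 i [D true, U true, D true, U true, D true, U true] ∈
        ([[], [6]] : List (List ℤ)) := by decide +kernel
    have h5 := h4 i hi
    simp only [List.mem_cons, List.not_mem_nil, or_false] at h5
    rcases h5 with h5 | h5 <;> rw [h5]
    · rfl
    · simpa [ev] using h6
  obtain ⟨t, ht⟩ := forall_ext₃ H h2 (t₀ := D true) (t₁ := U true) (t₀' := U true) (t₁' := U true)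
    (k := 6) (by decide) (by decide) (by
      rintro ⟨_ | _, b⟩ hb
      · cases b
        · exact absurd rfl hb
        · exact ⟨_, halt⟩
      · exact ⟨_, hup b⟩) (U δ) (by simp [rev])
  have key : ∀ δ, stp δ (false, true) 0 = U true ∧ stp δ (true, true) 1 = U true ∧
      stp δ (false, true) 2 = U δ := by decide
  obtain ⟨k1, k2, k3⟩ := key δ
  refine (six_eq_zero_of_nbCycle H K hn hm hm2 (base 2 n) (x := (false, true)) (a := (true, true))
    (z := proj m (run r [U true, U true, U δ, t] (base 2 n))) (by decide) ?_).2 (by decide)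
  have e1 : cst δ r (false, true) (base 2 n) = move r (U true) (base 2 n) := by
    rw [cst, show (base 2 n).1 = 0 from rfl, k1]
  have e2 : cst δ r (true, true) (cst δ r (false, true) (base 2 n)) =
      move r (U true) (move r (U true) (base 2 n)) := by
    rw [e1, cst, show (move r (U true) (base 2 n)).1 = 1 from rfl, k2]
  have e3 : cst δ r (false, true) (cst δ r (true, true) (cst δ r (false, true) (base 2 n))) =
      move r (U δ) (move r (U true) (move r (U true) (base 2 n))) := by
    rw [e2, cst, show (move r (U true) (move r (U true) (base 2 n))).1 = 2 from rfl, k3]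
  rw [e3, e2, e1]
  exact ht

end CPMVertex

/-! ### Rigidity of the colouring -/

/-- The vertex `y` has a neighbour that has two neighbours which no walk of length 3 joins to `x`.
-/
def SimpleGraph.FarPair {V : Type*} (Γ : SimpleGraph V) (x y : V) : Prop :=
  ∃ z w w', Γ.Adj y z ∧ Γ.Adj z w ∧ Γ.Adj z w' ∧ w ≠ w' ∧
    (∀ u v, Γ.Adj x u → Γ.Adj u v → ¬ Γ.Adj v w) ∧ ∀ u v, Γ.Adj x u → Γ.Adj u v → ¬ Γ.Adj v w'

theorem SimpleGraph.FarPair.of_map {V : Type*} {Γ : SimpleGraph V} (φ : Γ ≃g Γ) {x y : V}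
    (h : Γ.FarPair (φ x) (φ y)) : Γ.FarPair x y := by
  obtain ⟨z, w, w', h1, h2, h3, h4, h5, h6⟩ := h
  refine ⟨φ.symm z, φ.symm w, φ.symm w', ?_, φ.symm.map_rel_iff.2 h2, φ.symm.map_rel_iff.2 h3,
    φ.symm.injective.ne h4, fun u v hu hv hw => ?_, fun u v hu hv hw => ?_⟩
  · have := φ.symm.map_rel_iff.2 h1
    rwa [φ.symm_apply_apply] at this
  · refine h5 (φ u) (φ v) (φ.map_rel_iff.2 hu) (φ.map_rel_iff.2 hv) ?_
    have := φ.map_rel_iff.2 hw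
    rwa [φ.apply_symm_apply] at this
  · refine h6 (φ u) (φ v) (φ.map_rel_iff.2 hu) (φ.map_rel_iff.2 hv) ?_
    have := φ.map_rel_iff.2 hw
    rwa [φ.apply_symm_apply] at this

namespace CPMVertex

variable {m n : ℕ} {r : (ZMod n)ˣ} {δ : Bool}

/-- The height modulo 6 of the end of a coloured walk that starts at height `0` or `1`, minus the
initial height, with a Boolean that tells whether the initial height is odd. -/
def hgt : Bool → List Colour → ℕ
  | _, [] => 0
  | p, c :: w => (if p == c.1 then 1 else 5) + hgt (!p) w

/-- The displacement modulo 3, up to a unit, of one of the coordinates along a coloured walk. -/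
def dsp (b : Bool) : Bool → List Colour → ℕ
  | _, [] => 0
  | p, c :: w => (if c.1 == b then if (p == c.1) == c.2 then 1 else 2 else 0) + dsp b (!p) w

/-- A coloured walk is closed for `m = n = 3`. -/
def isClosed₃ (p : Bool) (w : List Colour) : Bool :=
  (dsp true p w % 3).beq 0 && (dsp false p w % 3).beq 0 && (hgt p w % 6).beq 0

/-- The conjunction over all the colours. -/
def allColours (f : Colour → Bool) : Bool :=
  f (true, true) && f (true, false) && f (false, true) && f (false, false)

/-- The end of the walk with the colours `x, a, y, d, e` is joined to its start by no walk of
length 3. -/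
def isFar (p : Bool) (x a y d e : Colour) : Bool :=
  allColours fun c => allColours fun c' => allColours fun c'' =>
    !isClosed₃ p [x, a, y, d, e, c, c', c'']

theorem allColours_iff (f : Colour → Bool) : allColours f = true ↔ ∀ c, f c = true := by
  simp [allColours, Prod.forall, Bool.forall_bool, and_assoc]
  tauto

/-- The finite computation behind `farPair_iff`. -/
theorem isFar_iff : ∀ p, ∀ x a y : Colour, x ≠ a → y ≠ a →
    ((∃ d e e', e ≠ e' ∧ isFar p x a y d e ∧ isFar p x a y d e') ↔ x ≠ y) := by
  decide +kernel

theorem vst_foldl (H : Admissible m 2 n r) (K : ColourData m r δ) (w : List Colour)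
    {x : CPMSet m 2 n r} {X : ℤ × (ZMod 2 → ZMod n)} (hx : x.1 = proj m X) :
    (w.foldl (fun x c => vst H δ c x) x).1 = proj m (w.foldl (fun X c => cst δ r c X) X) := by
  induction w generalizing x X with
  | nil => exact hx
  | cons c w ih => exact ih (vst_eq H K c hx)

/-- For `n = 3` the end of a coloured walk is computed by `hgt` and `dsp`. -/
theorem foldl_cst {r : (ZMod 3)ˣ} (w : List Colour)
    (X : ℤ × (ZMod 2 → ZMod 3)) :
    (((w.foldl (fun X c => cst true r c X) X).1 : ℤ) : ZMod 6) =
        (X.1 : ZMod 6) + hgt (decide (X.1 % 2 = 1)) w ∧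
      (w.foldl (fun X c => cst true r c X) X).2 0 = X.2 0 + dsp false (decide (X.1 % 2 = 1)) w ∧
      (w.foldl (fun X c => cst true r c X) X).2 1 = X.2 1 + r * dsp true (decide (X.1 % 2 = 1)) w := by
  have hk : kap true r = 1 := by revert r; decide
  induction w generalizing X with
  | nil => simp [hgt, dsp]
  | cons c w ih =>
    obtain ⟨h1, h2, h3⟩ := ih (cst true r c X)
    have h4 : decide ((cst true r c X).1 % 2 = 1) = !decide (X.1 % 2 = 1) := by
      rw [cst_fst]
      rcases Int.emod_two_eq X.1 with h | h
      · split_ifs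
        · rw [show (X.1 + 1) % 2 = 1 by omega, h]; rfl
        · rw [show (X.1 - 1) % 2 = 1 by omega, h]; rfl
      · split_ifs
        · rw [show (X.1 + 1) % 2 = 0 by omega, h]; rfl
        · rw [show (X.1 - 1) % 2 = 0 by omega, h]; rfl
    have h5 : ((wt true r (if isUp c X.1 = true then X.1 else X.1 - 1) : (ZMod 3)ˣ) : ZMod 3) =
        if c.1 then (r : ZMod 3) else 1 := by
      rw [wt, hk, one_zpow, one_mul]
      have h6 : (if isUp c X.1 = true then X.1 else X.1 - 1) % 2 = if c.1 then 1 else 0 := by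
        rcases c with ⟨_ | _, _⟩ <;> rcases Int.emod_two_eq X.1 with h2 | h2 <;>
          simp [isUp, h2] <;> omega
      rw [h6]
      cases c.1 <;> simp
    rw [List.foldl_cons, h1, h2, h3, h4, hgt, dsp, dsp, cst_snd, h5, cst_fst]
    simp only [isUp]
    have e1 : (5 : ZMod 6) = -1 := by decide
    have e2 : (2 : ZMod 3) = -1 := by decide
    rcases Bool.eq_false_or_eq_true (decide (X.1 % 2 = 1)) with hp | hp <;> simp only [hp]
    all_goals
      refine ⟨?_, ?_, ?_⟩
      · rcases c with ⟨_ | _, _⟩ <;> simp [e1] <;> ring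
      · rcases c with ⟨_ | _, _ | _⟩ <;> simp [e2, ix, sg] <;> ring
      · rcases c with ⟨_ | _, _ | _⟩ <;> simp [e2, ix, sg] <;> ring

theorem isClosed₃_iff {r : (ZMod 3)ˣ} (H : Admissible 3 2 3 r) (K : ColourData 3 r true)
    (w : List Colour) (x : CPMSet 3 2 3 r) :
    isClosed₃ (decide ((lift x.1).1 % 2 = 1)) w = true ↔
      w.foldl (fun x c => vst H true c x) x = x := by
  obtain ⟨h1, h2, h3⟩ := foldl_cst w (lift x.1)
  have key : ∀ k : ℕ, ((k : ZMod 3) = 0 ↔ k % 3 = 0) := fun k => by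
    rw [ZMod.natCast_eq_zero_iff, Nat.dvd_iff_mod_eq_zero]
  have key' : ∀ k : ℕ, ((k : ZMod 6) = 0 ↔ k % 6 = 0) := fun k => by
    rw [ZMod.natCast_eq_zero_iff, Nat.dvd_iff_mod_eq_zero]
  suffices h : isClosed₃ (decide ((lift x.1).1 % 2 = 1)) w = true ↔
      proj 3 (w.foldl (fun X c => cst true r c X) (lift x.1)) = proj 3 (lift x.1) by
    rw [proj_lift] at h
    rwa [Subtype.ext_iff, vst_foldl H K w (X := lift x.1) (by simp)]
  rw [proj, proj, Prod.ext_iff]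
  simp only [isClosed₃, Bool.and_eq_true, Nat.beq_eq, ← key, ← key']
  constructor
  · rintro ⟨⟨h4, h5⟩, h6⟩
    refine ⟨by simpa [h6] using h1, funext fun i => ?_⟩
    rw [h5, add_zero] at h2
    rw [h4, mul_zero, add_zero] at h3
    have : i = 0 ∨ i = 1 := by clear * -; revert i; decide
    rcases this with rfl | rfl
    exacts [h2, h3]
  · rintro ⟨h4, h5⟩
    rw [h5, left_eq_add] at h2 h3
    refine ⟨⟨(Units.mul_right_eq_zero _).1 h3, h2⟩, ?_⟩
    have h6 := h1.symm.trans h4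
    simpa using h6

/-- For `m = n = 3` the paths with the colours `x, a, x` lie on hexagons, too, but `FarPair` tells
them from the other paths of length 3. -/
theorem farPair_iff {r : (ZMod 3)ˣ} (H : Admissible 3 2 3 r) (K : ColourData 3 r true)
    (v : CPMSet 3 2 3 r) {x a y : Colour} (hxa : x ≠ a) (hya : y ≠ a) :
    (CPM 3 2 3 r).FarPair (vst H true x v) (vst H true y (vst H true a v)) ↔ x ≠ y := by
  rw [← isFar_iff (decide ((lift (vst H true x v).1).1 % 2 = 1)) x a y hxa hya]
  have hfar : ∀ d e, isFar (decide ((lift (vst H true x v).1).1 % 2 = 1)) x a y d e = true ↔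
      ∀ u w, (CPM 3 2 3 r).Adj (vst H true x v) u → (CPM 3 2 3 r).Adj u w →
        ¬ (CPM 3 2 3 r).Adj w (vst H true e (vst H true d (vst H true y (vst H true a v)))) := by
    intro d e
    simp only [isFar, allColours_iff, Bool.not_eq_true', Bool.eq_false_iff, Ne, isClosed₃_iff H K,
      List.foldl_cons, List.foldl_nil, vst_vst H K]
    constructor
    · intro h u w hu hw hwe
      obtain ⟨c, rfl⟩ := (adj_iff_vst H (δ := true) _ _).1 hu
      obtain ⟨c', rfl⟩ := (adj_iff_vst H (δ := true) _ _).1 hw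
      obtain ⟨c'', h6⟩ := (adj_iff_vst H (δ := true) _ _).1 hwe
      apply h c'' c' c
      rw [h6]
      simp only [vst_vst H K]
    · intro h c'' c' c h6
      refine h (vst H true c (vst H true x v)) (vst H true c' (vst H true c (vst H true x v)))
        ((adj_iff_vst H (δ := true) _ _).2 ⟨_, rfl⟩) ((adj_iff_vst H (δ := true) _ _).2 ⟨_, rfl⟩)
        ((adj_iff_vst H (δ := true) _ _).2 ⟨c'', ?_⟩)
      rw [← h6]
      simp only [vst_vst H K]
  constructor
  · rintro ⟨z, w, w', h1, h2, h3, h4, h5, h6⟩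
    obtain ⟨d, rfl⟩ := (adj_iff_vst H (δ := true) _ _).1 h1
    obtain ⟨e, rfl⟩ := (adj_iff_vst H (δ := true) _ _).1 h2
    obtain ⟨e', rfl⟩ := (adj_iff_vst H (δ := true) _ _).1 h3
    exact ⟨d, e, e', fun h => h4 (h ▸ rfl), (hfar d e).2 h5, (hfar d e').2 h6⟩
  · rintro ⟨d, e, e', h4, h5, h6⟩
    exact ⟨_, _, _, (adj_iff_vst H (δ := true) _ _).2 ⟨d, rfl⟩,
      (adj_iff_vst H (δ := true) _ _).2 ⟨e, rfl⟩, (adj_iff_vst H (δ := true) _ _).2 ⟨e', rfl⟩,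
      fun h => h4 (vst_inj H h), (hfar d e).1 h5, (hfar d e').1 h6⟩

set_option synthInstance.maxSize 1000 in
/-- In the 4-cube `CPM(2, 2, 4; r)` the ends of a path of length 3 are adjacent if and only if its
first and its last edge have the same colour. -/
theorem adj_vst_iff {r : (ZMod 4)ˣ} (H : Admissible 2 2 4 r) (v : CPMSet 2 2 4 r) {x a y : Colour}
    (hxa : x ≠ a) (hya : y ≠ a) :
    (CPM 2 2 4 r).Adj (vst H false x v) (vst H false y (vst H false a v)) ↔ x = y := by
  have K : ColourData 2 r false := colourData_of_eq_four
  have h1 : ∀ k ∈ ([0, 1, 2, 3] : List ℤ), ∀ x a y c : Colour, x ≠ a → y ≠ a →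
      ((net (cwd false k [x, a, y, c]) % 4 = 0 ∧ ∀ i < 2,
        (classPoly 2 2 i (cwd false k [x, a, y, c])).sum % 4 = 0) ↔ x = y ∧ c = a) := by
    decide +kernel
  have hr : r ^ 2 = 1 := by clear * -; revert r; decide
  have hev : ∀ l : List ℤ, ev ((r : ZMod 4) ^ 2) l = ((l.sum : ℤ) : ZMod 4) := by
    intro l
    rw [← Units.val_pow_eq_pow_val, hr]
    induction l with
    | nil => simp [ev]
    | cons b l ih => rw [ev, ih]; simp
  have key : ∀ c, vst H false y (vst H false a v) = vst H false c (vst H false x v) ↔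
      x = y ∧ c = a := by
    intro c
    rw [← h1 _ (emod_four_mem (cst false r x (lift v.1)).1) x a y c hxa hya, ← cwd_emod]
    have h2 : Closed 2 2 4 r (cwd false (cst false r x (lift v.1)).1 [x, a, y, c]) ↔
        vst H false c (vst H false y (vst H false a v)) = vst H false x v := by
      rw [← proj_run_eq_iff _ (cst false r x (lift v.1)), Subtype.ext_iff,
        vst_eq H K x (X := lift v.1) (by simp),
        vst_eq H K c (vst_eq H K y (vst_eq H K a (X := lift v.1) (by simp)))]
      simp only [run_cwd, cst_cst]
      rfl
    rw [closed_iff (by norm_num) _ 2 (by simp [cwd])] at h2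
    simp only [hev, ZMod.intCast_zmod_eq_zero_iff_dvd, Int.dvd_iff_emod_eq_zero] at h2
    simp only [Nat.reduceMul, Nat.cast_ofNat] at h2
    constructor
    · intro h3
      exact h2.2 (by rw [h3, vst_vst H K])
    · intro h3
      rw [← h2.1 h3, vst_vst H K]
  rw [adj_iff_vst H (δ := false)]
  constructor
  · rintro ⟨c, hc⟩
    exact ((key c).1 hc).1
  · intro h
    exact ⟨a, (key a).2 ⟨h, rfl⟩⟩

/-- The colours of the edges form a rigid colouring. Whether the ends `x`, `y` of a path with the
colours `x, a, y` have the same colour can be told from the graph: for `n = 4` from the adjacency of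
the ends of the path, for `n = 3` by `FarPair`, and otherwise from the hexagons through the path. -/
theorem exists_rigidColouring (H : Admissible m 2 n r) (h2 : (CPM m 2 n r).IsTwoArcTransitive)
    (h : n ≠ 4 ∨ m = 2) : ∃ δ, ColourData m r δ ∧
      ∃ R : (CPM m 2 n r).RigidColouring Colour, R.st = vst H δ := by
  by_cases hn : n = 4
  · subst hn
    obtain rfl := h.resolve_left (by simp)
    have K : ColourData 2 r false := colourData_of_eq_four
    refine ⟨false, K, SimpleGraph.RigidColouring.ofInvariant (vst H false)
      (adj_iff_vst H) (vst_vst H K) (fun c c' v => vst_inj H)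
      (fun p₀ _ _ p₃ => (CPM 2 2 4 r).Adj p₀ p₃) (fun φ _ _ _ _ h => φ.map_rel_iff.2 h)
      fun v x a y => adj_vst_iff H v, rfl⟩
  obtain ⟨δ, K⟩ := exists_colourData H hn (twoSq H h2 hn)
  refine ⟨δ, K, ?_⟩
  have hm1 := H.hm
  have hm2 : m = 2 → ¬ ((r : ZMod n) ^ 2 = 1 ∨ (r : ZMod n) ^ 2 = -1) := fun hm hq =>
    hn (eq_four_of_le_two H h2 hm.le hq)
  have hm : m ≠ 1 := by
    rintro rfl
    refine hn (eq_four_of_le_two H h2 (by norm_num) ?_)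
    rcases H.hr with h | h <;> rw [one_mul] at h
    · left; rw [← Units.val_pow_eq_pow_val, h]; rfl
    · right; rw [← Units.val_pow_eq_pow_val, h]; rfl
  by_cases h6 : (6 : ZMod n) = 0
  · obtain ⟨rfl, rfl⟩ := eq_three_of_six_eq_zero H h2 K hn hm hm2 h6
    obtain rfl : δ = true := by
      have := K.two
      clear * - this
      revert r δ
      decide
    exact ⟨SimpleGraph.RigidColouring.ofInvariant (vst H true)
      (adj_iff_vst H) (vst_vst H K) (fun c c' v => vst_inj H)
      (fun p₀ _ _ p₃ => ¬ (CPM 3 2 3 r).FarPair p₀ p₃) (fun φ _ _ _ _ h h' => h (h'.of_map φ))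
      fun v x a y hxa hya => by rw [farPair_iff H K v hxa hya, not_not], rfl⟩
  · refine ⟨SimpleGraph.RigidColouring.ofInvariant (vst H δ)
      (adj_iff_vst H) (vst_vst H K) (fun c c' v => vst_inj H)
      (fun p₀ p₁ p₂ p₃ => ¬ ∃ p₄ : CPMSet m 2 n r, (CPMbar m 2 n r).NBCycle 6 p₀ p₁ p₂ p₃ p₄)
      (fun φ _ _ _ _ h => ?_) fun v x a y hxa hya => ?_, rfl⟩
    · rintro ⟨p₄, h4⟩
      rw [← φ.apply_symm_apply p₄, nbCycle_map_iff] at h4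
      exact h ⟨_, h4⟩
    · have e0 : v.1 = proj m (cst δ r x (cst δ r x (lift v.1))) := by rw [cst_cst, proj_lift]
      have e1 := vst_eq H K a e0
      have e2 := vst_eq H K y e1
      have e3 : (vst H δ x v).1 = proj m (cst δ r x (lift v.1)) := rfl
      generalize cst δ r x (lift v.1) = X at e0 e1 e2 e3
      rw [e3, e2, e1, e0]
      constructor
      · intro h7
        by_contra hxy
        refine h7 ⟨vst H δ x (vst H δ y (vst H δ a v)), ?_⟩
        rw [vst_eq H K x e2]
        exact ext_hexagon H K _ hxa hya hxy
      · rintro rfl ⟨p₄, h7⟩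
        exact h6 (six_eq_zero_of_nbCycle H K hn hm hm2 _ hxa h7).1

end CPMVertex

/-! ### The group `G` -/

namespace CPMVertex

variable {m s n : ℕ} {r : (ZMod n)ˣ}

/-- A permutation of the vertices that is compatible with the steps on the cover is an automorphism
of the graph on all the vertices. -/
theorem adj_apply_iff_of_steps (H : Admissible m s n r) (g : Equiv.Perm (CPMVertex m s n))
    (h : ∀ X : ℤ × (ZMod s → ZMod n), ∃ (X' : ℤ × (ZMod s → ZMod n)) (f : Step → Step),
      Function.Surjective f ∧ g (proj m X) = proj m X' ∧
        ∀ t, g (proj m (move r t X)) = proj m (move r (f t) X')) (x y : CPMVertex m s n) :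
    (CPMbar m s n r).Adj (g x) (g y) ↔ (CPMbar m s n r).Adj x y := by
  obtain ⟨X, rfl⟩ := proj_surjective x
  obtain ⟨X', f, hf, h1, h2⟩ := h X
  rw [h1, adj_proj_iff H, adj_proj_iff H]
  constructor
  · rintro ⟨t, ht⟩
    obtain ⟨t, rfl⟩ := hf t
    exact ⟨t, g.injective (by rw [ht, h2])⟩
  · rintro ⟨t, rfl⟩
    exact ⟨f t, h2 t⟩

/-- The permutations in the group generated by `σ`, `ρ₀` and `τ₀` are automorphisms. -/
theorem adj_apply_iff (H : Admissible m s n r) {g : Equiv.Perm (CPMVertex m s n)}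
    (hg : g ∈ CPMGbar m s n r) :
    ∀ x y, (CPMbar m s n r).Adj (g x) (g y) ↔ (CPMbar m s n r).Adj x y := by
  induction hg using Subgroup.closure_induction with
  | one => exact fun x y => Iff.rfl
  | mul g h _ _ ihg ihh => exact fun x y => (ihg _ _).trans (ihh _ _)
  | inv g _ ih =>
    intro x y
    rw [← ih]
    simp
  | mem g hg =>
    rcases hg with rfl | rfl | rfl
    · refine adj_apply_iff_of_steps H _ fun X => ⟨(X.1 + 1, fun j => r * X.2 (j - 1)), id,
        Function.surjective_id, by simp [sigmaBar, proj], fun t => Prod.ext ?_ (funext fun j => ?_)⟩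
      · rcases t with ⟨_ | _, _⟩ <;> simp [sigmaBar, proj, move, nxt]
      · have h1 : lvl t (X.1 + 1) = lvl t X.1 + 1 := by
          rcases t with ⟨_ | _, _⟩ <;> simp [lvl]
        simp only [sigmaBar, proj, move, Equiv.coe_fn_mk, id, Pi.add_apply, mul_add, h1, Int.cast_add,
          Int.cast_one, Pi.single_apply, sub_eq_iff_eq_add, zpow_add, zpow_one, Units.val_mul]
        split_ifs <;> ring
    · refine adj_apply_iff_of_steps H _ fun X => ⟨(X.1, X.2 + Pi.single 0 1), id,
        Function.surjective_id, by simp [rhoBar, proj], fun t => Prod.ext ?_ ?_⟩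
      · simp [rhoBar, proj, move]
      · simp [rhoBar, proj, move, add_right_comm]
    · refine adj_apply_iff_of_steps H _ fun X => ⟨(X.1, Function.update X.2 0 (-X.2 0)),
        fun t => (t.1, if (lvl t X.1 : ZMod s) = 0 then !t.2 else t.2), fun t => ?_,
        by simp [tauBar, proj], fun t => Prod.ext ?_ ?_⟩
      · refine ⟨(t.1, if (lvl t X.1 : ZMod s) = 0 then !t.2 else t.2), Prod.ext rfl ?_⟩
        have h1 : ∀ b, lvl (t.1, b) X.1 = lvl t X.1 := fun b => rfl
        simp only [h1]
        split_ifs <;> simp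
      · simp [tauBar, proj, move, nxt]
      · have h1 : ∀ b, lvl (t.1, b) X.1 = lvl t X.1 := fun b => rfl
        funext j
        simp only [tauBar, proj, move, Equiv.coe_fn_mk, h1, Pi.add_apply, Function.update_apply,
          Pi.single_apply]
        by_cases hj : j = 0
        · subst hj
          by_cases hl : (lvl t X.1 : ZMod s) = 0
          · have h2 : ((sg (!t.2) : ℤ) : ZMod n) = -sg t.2 := by cases t.2 <;> simp [sg]
            simp [hl, h2, add_comm]
          · simp [Ne.symm hl]
        · by_cases hl : (lvl t X.1 : ZMod s) = 0 <;> simp [hj, hl]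

/-- An element of the group of permutations of all the vertices that maps some vertex of the
component to another one induces an automorphism of the component. -/
theorem exists_mem_CPMG (H : Admissible m s n r) {g : Equiv.Perm (CPMVertex m s n)}
    (hg : g ∈ CPMGbar m s n r) {x₀ : CPMVertex m s n} (hx₀ : x₀ ∈ CPMSet m s n r)
    (hgx₀ : g x₀ ∈ CPMSet m s n r) : ∃ φ ∈ CPMG m s n r, ∀ x, (φ x).1 = g x.1 := by
  let e : CPMbar m s n r ≃g CPMbar m s n r := ⟨g, adj_apply_iff H hg _ _⟩
  have hmem : ∀ x, x ∈ CPMSet m s n r ↔ (CPMbar m s n r).Reachable x x₀ := by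
    intro x
    rw [CPMSet, SimpleGraph.ConnectedComponent.mem_supp_iff] at hx₀ ⊢
    rw [← hx₀, SimpleGraph.ConnectedComponent.eq]
  have h1 : ∀ x, x ∈ CPMSet m s n r ↔ g x ∈ CPMSet m s n r := by
    intro x
    rw [hmem, hmem]
    have h2 : (CPMbar m s n r).Reachable (e x) (e x₀) ↔ _ := e.reachable_iff
    rw [← h2]
    exact ⟨fun h => h.trans ((hmem _).1 hgx₀), fun h => h.trans ((hmem _).1 hgx₀).symm⟩
  exact ⟨⟨g.subtypeEquiv h1, adj_apply_iff H hg _ _⟩, ⟨g, hg, fun x => rfl⟩, fun x => rfl⟩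

theorem sigmaBar_mem : (sigmaBar r : Equiv.Perm (CPMVertex m s n)) ∈ CPMGbar m s n r :=
  Subgroup.subset_closure (by simp)

theorem rhoBar_mem : (rhoBar 0 : Equiv.Perm (CPMVertex m s n)) ∈ CPMGbar m s n r :=
  Subgroup.subset_closure (by simp)

theorem tauBar_mem : (tauBar 0 : Equiv.Perm (CPMVertex m s n)) ∈ CPMGbar m s n r :=
  Subgroup.subset_closure (by simp)

theorem rhoBar_pow_apply (k : ℕ) (x : CPMVertex m s n) :
    (rhoBar 0 ^ k) x = (x.1, x.2 + Pi.single 0 (k : ZMod n)) := by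
  induction k with
  | zero => simp
  | succ k ih =>
    rw [pow_succ', Equiv.Perm.mul_apply, ih]
    simp [rhoBar, add_assoc, ← Pi.single_add]

theorem sigmaBar_pow_fst (k : ℕ) (x : CPMVertex m s n) : ((sigmaBar r ^ k) x).1 = x.1 + k := by
  induction k with
  | zero => simp
  | succ k ih =>
    rw [pow_succ', Equiv.Perm.mul_apply]
    change ((sigmaBar r ^ k) x).1 + 1 = _
    rw [ih]
    push_cast
    ring

theorem tauBar_one_mem : (tauBar 1 : Equiv.Perm (CPMVertex m 2 n)) ∈ CPMGbar m 2 n r := by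
  have : (tauBar 1 : Equiv.Perm (CPMVertex m 2 n)) = sigmaBar r * tauBar 0 * (sigmaBar r)⁻¹ := by
    ext1 x
    rw [Equiv.Perm.mul_apply, Equiv.Perm.mul_apply]
    refine Prod.ext ?_ (funext fun j => ?_)
    · simp [tauBar, sigmaBar, Equiv.Perm.inv_def]
    · have hj : j = 0 ∨ j = 1 := by revert j; decide
      have h1 : (0 : ZMod 2) - 1 ≠ 0 := by decide
      have h2 : (0 : ZMod 2) ≠ 1 := by decide
      have h3 : (1 : ZMod 2) + 1 = 0 := by decide
      rcases hj with rfl | rfl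
      · simp [tauBar, sigmaBar, Equiv.Perm.inv_def, h3]
      · simp [tauBar, sigmaBar, Equiv.Perm.inv_def]
  rw [this]
  exact mul_mem (mul_mem sigmaBar_mem tauBar_mem) (inv_mem sigmaBar_mem)

/-- The group generated by `σ`, `ρ₀` and `τ₀` is transitive. -/
theorem exists_apply_zero (H : Admissible m 2 n r) (w : CPMVertex m 2 n) :
    ∃ g ∈ CPMGbar m 2 n r, g (zero m 2 n) = w := by
  have h0 : NeZero n := ⟨by have := H.hn; omega⟩
  have h1 := H.neZero
  set k := (w.1 - 1).val with hk
  set w' := ((sigmaBar r ^ k)⁻¹ : Equiv.Perm (CPMVertex m 2 n)) w with hw'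
  have h2 : (sigmaBar r ^ k) w' = w := by
    rw [hw', ← Equiv.Perm.mul_apply, mul_inv_cancel, Equiv.Perm.one_apply]
  have h3 : w'.1 = 1 := by
    have h4 := sigmaBar_pow_fst (r := r) k w'
    rw [h2, hk, ZMod.natCast_zmod_val] at h4
    linear_combination -h4
  -- From `⟨0; (0, 0)⟩` one reaches `⟨1; (0, b)⟩` by `ρ₀` and `σ`, then `w' = ⟨1; (a, b)⟩` by `ρ₀`.
  refine ⟨sigmaBar r ^ k * rhoBar 0 ^ (w'.2 0).val * sigmaBar r *
    rhoBar 0 ^ (((r⁻¹ : (ZMod n)ˣ) : ZMod n) * w'.2 1).val,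
    mul_mem (mul_mem (mul_mem (pow_mem sigmaBar_mem _) (pow_mem rhoBar_mem _)) sigmaBar_mem)
      (pow_mem rhoBar_mem _), ?_⟩
  rw [Equiv.Perm.mul_apply, Equiv.Perm.mul_apply, Equiv.Perm.mul_apply, rhoBar_pow_apply,
    rhoBar_pow_apply, ← h2]
  congr 1
  refine Prod.ext ?_ (funext fun j => ?_)
  · simp [zero, sigmaBar, h3]
  · have hj : j = 0 ∨ j = 1 := by clear * -; revert j; decide
    have h5 : (0 : ZMod 2) - 1 ≠ 0 := by decide
    rcases hj with rfl | rfl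
    · simp [zero, sigmaBar]
    · simp [zero, sigmaBar]

/-- The vertex `⟨0; 0⟩` of the component. -/
def zeroSet (m s n : ℕ) (r : (ZMod n)ˣ) : CPMSet m s n r :=
  ⟨zero m s n, SimpleGraph.ConnectedComponent.mem_supp_iff _ _ |>.2 rfl⟩

theorem preconnected_CPM : (CPM m s n r).Preconnected :=
  ((CPMbar m s n r).connectedComponentMk (zero m s n)).connected_toSimpleGraph.preconnected

end CPMVertex

/-! ### Vertex stabilizers and generators -/

namespace CPMVertex

variable {m n : ℕ} {r : (ZMod n)ˣ}

/-- The restriction of `τ₀` or `τ₁` to the component interchanges the two colours of the edges that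
change the coordinate in question and fixes the other two. -/
theorem exists_mem_CPMG_swap (H : Admissible m 2 n r)
    (R : (CPM m 2 n r).RigidColouring Colour) {b : Bool} (hz : ∃ (i : ZMod (m * 2)) (a : ZMod n),
      ∀ c : Colour, c.1 = b → (R.st c (zeroSet m 2 n r)).1 = (i, Pi.single (ix c) (sg c.2 * a)))
    (hz' : ∃ (i : ZMod (m * 2)) (a : ZMod n),
      ∀ c : Colour, c.1 ≠ b → (R.st c (zeroSet m 2 n r)).1 = (i, Pi.single (ix c) (sg c.2 * a))) :
    ∃ φ ∈ CPMG m 2 n r, φ (zeroSet m 2 n r) = zeroSet m 2 n r ∧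
      R.Acts φ (Equiv.swap (b, true) (b, false)) := by
  have h1 : (tauBar (ix (b, true)) : Equiv.Perm (CPMVertex m 2 n)) ∈ CPMGbar m 2 n r := by
    cases b
    exacts [tauBar_mem, tauBar_one_mem]
  have h2 : (tauBar (ix (b, true)) : Equiv.Perm (CPMVertex m 2 n)) (zero m 2 n) = zero m 2 n := by
    refine Prod.ext rfl (funext fun j => ?_)
    simp [tauBar, zero]
  obtain ⟨φ, h3, h4⟩ := exists_mem_CPMG H h1 (zeroSet m 2 n r).2
    (x₀ := zero m 2 n) (by rw [h2]; exact (zeroSet m 2 n r).2)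
  have h5 : φ (zeroSet m 2 n r) = zeroSet m 2 n r := Subtype.ext ((h4 _).trans h2)
  obtain ⟨π, hπ⟩ := R.exists_acts preconnected_CPM (zeroSet m 2 n r) φ
  refine ⟨φ, h3, h5, hπ.of_apply (zeroSet m 2 n r) fun c => Subtype.ext ?_⟩
  rw [h4, h5]
  by_cases hc : c.1 = b
  · obtain ⟨i, a, h6⟩ := hz
    obtain ⟨c₁, ε⟩ := c
    obtain rfl : c₁ = b := hc
    have h7 : (Equiv.swap (c₁, true) (c₁, false)) (c₁, ε) = (c₁, !ε) := by
      cases ε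
      exacts [Equiv.swap_apply_right _ _, Equiv.swap_apply_left _ _]
    rw [h7, h6 _ rfl, h6 _ rfl]
    refine Prod.ext rfl (funext fun j => ?_)
    simp only [tauBar, Equiv.coe_fn_mk, Function.update_apply, Pi.single_apply, ix]
    cases ε <;> by_cases hj : j = if c₁ = true then 1 else 0 <;> simp [hj, sg]
  · obtain ⟨i, a, h6⟩ := hz'
    rw [Equiv.swap_apply_of_ne_of_ne (fun h => hc (by rw [h])) (fun h => hc (by rw [h])), h6 _ hc]
    have h8 : ix c ≠ ix (b, true) := by
      rcases c with ⟨_ | _, _⟩ <;> cases b <;> simp [ix] at hc ⊢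
    refine Prod.ext rfl (funext fun j => ?_)
    simp only [tauBar, Equiv.coe_fn_mk, Function.update_apply, Pi.single_apply]
    by_cases hj : j = ix (b, true)
    · simp [hj, Ne.symm h8]
    · simp [hj]

/-- The consequences of a rigid colouring in which the two edges of each type at `⟨0; 0⟩` change the
same coordinate by opposite values. -/
theorem exists_acts_and_closure (H : Admissible m 2 n r) (h2 : (CPM m 2 n r).IsTwoArcTransitive)
    (R : (CPM m 2 n r).RigidColouring Colour) (hz : ∀ b, ∃ (i : ZMod (m * 2)) (a : ZMod n),
      ∀ c : Colour, c.1 = b → (R.st c (zeroSet m 2 n r)).1 = (i, Pi.single (ix c) (sg c.2 * a))) :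
    (∀ v π, ∃ φ : CPMAut m 2 n r, φ v = v ∧ R.Acts φ π) ∧
    (∀ x : CPMSet m 2 n r, Nat.card (MulAction.stabilizer (CPMAut m 2 n r) x) = 24) ∧
    ∀ (ν : CPMAut m 2 n r) (ε : Bool), ν (zeroSet m 2 n r) = zeroSet m 2 n r →
      R.Acts ν (Equiv.swap (false, false) (true, ε)) →
      orderOf ν = 2 ∧ Subgroup.closure ((CPMG m 2 n r : Set (CPMAut m 2 n r)) ∪ {ν}) = ⊤ := by
  have hc : (CPM m 2 n r).Preconnected := preconnected_CPM
  have hsw : ∀ b, ∃ φ ∈ CPMG m 2 n r, φ (zeroSet m 2 n r) = zeroSet m 2 n r ∧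
      R.Acts φ (Equiv.swap (b, true) (b, false)) := fun b => by
    refine exists_mem_CPMG_swap H R (hz b) ?_
    obtain ⟨i, a, h⟩ := hz !b
    exact ⟨i, a, fun c hc => h c (by cases b <;> simpa using hc)⟩
  have hall : ∀ v π, ∃ φ : CPMAut m 2 n r, φ v = v ∧ R.Acts φ π := by
    obtain ⟨φ, -, h3, h4⟩ := hsw true
    exact R.exists_acts_of_swap hc h2 (by decide) h3 h4
  refine ⟨hall, fun x => ?_, fun ν ε h3 h4 => ⟨?_, ?_⟩⟩
  · rw [R.card_stabilizer hc x (hall x)]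
    simp [Nat.factorial]
  · refine orderOf_eq_prime ?_ fun h => ?_
    · refine R.eq_of_acts (v₀ := zeroSet m 2 n r) hc (π := 1) ?_ R.acts_one ?_
      · rw [sq, ← Equiv.swap_mul_self (false, false) (true, ε)]
        exact h4.mul h4
      · rw [sq]
        change ν (ν _) = _
        rw [h3, h3]
        rfl
    · rw [h] at h4
      have h5 := h4 (false, false) (zeroSet m 2 n r)
      rw [Equiv.swap_apply_left] at h5
      have := R.inj _ _ _ h5
      simp at this
  · refine R.eq_top_of_swaps (v₀ := zeroSet m 2 n r) hc _ (fun v => ?_) ?_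
    · obtain ⟨g, hg, h5⟩ := exists_apply_zero H v.1
      obtain ⟨φ, h6, h7⟩ := exists_mem_CPMG H hg (zeroSet m 2 n r).2
        (show g (zero m 2 n) ∈ _ by rw [h5]; exact v.2)
      exact ⟨φ, Subgroup.subset_closure (Or.inl h6), Subtype.ext ((h7 _).trans h5)⟩
    · have e1 : ∀ b, Relation.EqvGen (fun a b : Colour => ∃ φ ∈ Subgroup.closure
          ((CPMG m 2 n r : Set (CPMAut m 2 n r)) ∪ {ν}), φ (zeroSet m 2 n r) = zeroSet m 2 n r ∧
            R.Acts φ (Equiv.swap a b)) (b, true) (b, false) := fun b => by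
        obtain ⟨φ, h5, h6⟩ := hsw b
        exact .rel _ _ ⟨φ, Subgroup.subset_closure (Or.inl h5), h6⟩
      have e2 : Relation.EqvGen (fun a b : Colour => ∃ φ ∈ Subgroup.closure
          ((CPMG m 2 n r : Set (CPMAut m 2 n r)) ∪ {ν}), φ (zeroSet m 2 n r) = zeroSet m 2 n r ∧
            R.Acts φ (Equiv.swap a b)) (false, false) (true, ε) :=
        .rel _ _ ⟨ν, Subgroup.subset_closure (Or.inr rfl), h3, h4⟩
      have e3 : ∀ c, Relation.EqvGen (fun a b : Colour => ∃ φ ∈ Subgroup.closure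
          ((CPMG m 2 n r : Set (CPMAut m 2 n r)) ∪ {ν}), φ (zeroSet m 2 n r) = zeroSet m 2 n r ∧
            R.Acts φ (Equiv.swap a b)) c (false, false) := by
        rintro ⟨_ | _, b⟩
        · cases b
          exacts [.refl _, e1 false]
        · refine .trans _ _ _ ?_ (.symm _ _ e2)
          cases b <;> cases ε
          exacts [.refl _, .symm _ _ (e1 true), e1 true, .refl _]
      exact fun a b => .trans _ _ _ (e3 a) (.symm _ _ (e3 b))

end CPMVertex

/-! ### The parameters -/

namespace CPMVertex

variable {m n : ℕ} {r : (ZMod n)ˣ} {δ : Bool}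

/-- A unit modulo `n` fixes the elements of order 2. -/
theorem unit_mul_of_two_mul_eq_zero [NeZero n] (u : (ZMod n)ˣ) {x : ZMod n} (hx : 2 * x = 0) :
    (u : ZMod n) * x = x := by
  rcases Nat.even_or_odd' n with ⟨t, ht | ht⟩
  · have h1 : (u : ZMod n).val.Coprime n := ZMod.val_coe_unit_coprime u
    have h2 : Odd (u : ZMod n).val := by
      rw [← Nat.not_even_iff_odd]
      intro h3
      have := Nat.dvd_gcd h3.two_dvd (Dvd.intro t ht.symm)
      rw [h1] at this
      omega
    obtain ⟨q, hq⟩ := h2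
    have h3 : (u : ZMod n) = 2 * q + 1 := by
      rw [← ZMod.natCast_zmod_val (u : ZMod n), hq]; push_cast; ring
    rw [h3]
    linear_combination (q : ZMod n) * hx
  · have h1 : ((2 * t + 1 : ℕ) : ZMod n) = 0 := by rw [← ht, ZMod.natCast_self]
    push_cast at h1
    have h2 : x = 0 := by linear_combination x * h1 - (t : ZMod n) * hx
    rw [h2, mul_zero]

theorem vst_zero (H : Admissible m 2 n r) (K : ColourData m r δ) (c : Colour) :
    (vst H δ c (zeroSet m 2 n r)).1 = proj m (cst δ r c (base 2 n)) :=
  vst_eq H K c (by simp [zeroSet, zero, proj, base])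

/-- An automorphism that permutes the colours by `π` maps a coloured walk to the walk with the
colours permuted by `π`. -/
theorem foldl_acts {H : Admissible m 2 n r} {R : (CPM m 2 n r).RigidColouring Colour}
    (hR : R.st = vst H δ) {φ : CPMAut m 2 n r} {π : Equiv.Perm Colour} (hφ : R.Acts φ π)
    (w : List Colour) (x : CPMSet m 2 n r) :
    φ (w.foldl (fun x c => vst H δ c x) x) = (w.map π).foldl (fun x c => vst H δ c x) (φ x) := by
  induction w generalizing x with
  | nil => rfl
  | cons c w ih =>
    rw [List.foldl_cons, ih, List.map_cons, List.foldl_cons]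
    congr 1
    rw [← hR]
    exact hφ c x

/-- A coloured walk from `⟨0; 0⟩` and the walk with permuted colours are closed simultaneously. -/
theorem closed_iff_closed_map {H : Admissible m 2 n r} (K : ColourData m r δ)
    {R : (CPM m 2 n r).RigidColouring Colour}
    (hR : R.st = vst H δ) {φ : CPMAut m 2 n r} {π : Equiv.Perm Colour} (hφ : R.Acts φ π)
    (h0 : φ (zeroSet m 2 n r) = zeroSet m 2 n r) (w : List Colour) :
    proj m (w.foldl (fun X c => cst δ r c X) (base 2 n)) = proj m (base 2 n) ↔
      proj m ((w.map π).foldl (fun X c => cst δ r c X) (base 2 n)) = proj m (base 2 n) := by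
  have e0 : (zeroSet m 2 n r).1 = proj m (base 2 n) := by simp [zeroSet, zero, proj, base]
  rw [← vst_foldl H K w e0, ← vst_foldl H K (w.map π) e0, ← e0, ← Subtype.ext_iff,
    ← Subtype.ext_iff, ← φ.injective.eq_iff, foldl_acts hR hφ, h0]

theorem wt_two_mul (j : ℤ) : wt δ r (2 * j) = kap δ r ^ j := by
  simp [wt]

theorem wt_two_mul_add_one (j : ℤ) : wt δ r (2 * j + 1) = kap δ r ^ j * r := by
  have h1 : (2 * j + 1) / 2 = j := by omega
  have h2 : (2 * j + 1) % 2 = 1 := by omega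
  rw [wt, h1, h2, zpow_one]

theorem cst_even (c : Colour) (j : ℤ) (v : ZMod 2 → ZMod n) :
    cst δ r c (2 * j, v) = if c.1 then (2 * (j - 1) + 1, v + Pi.single 1 (-(sg c.2 *
      ((kap δ r ^ (j - 1) : (ZMod n)ˣ) * r : ZMod n)))) else
      (2 * j + 1, v + Pi.single 0 (sg c.2 * ((kap δ r ^ j : (ZMod n)ˣ) : ZMod n))) := by
  have h1 : isUp c (2 * j) = !c.1 := by
    rcases c with ⟨_ | _, _⟩ <;> simp [isUp]
  refine Prod.ext ?_ ?_
  · rw [cst_fst, h1]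
    rcases c with ⟨_ | _, _⟩ <;> simp; ring
  · rw [cst_snd, h1]
    rcases c with ⟨_ | _, b⟩
    · simp [ix, sg, wt_two_mul]
    · cases b <;> simp [ix, sg, show 2 * j - 1 = 2 * (j - 1) + 1 by ring, wt_two_mul_add_one]

theorem cst_odd (c : Colour) (j : ℤ) (v : ZMod 2 → ZMod n) :
    cst δ r c (2 * j + 1, v) = if c.1 then (2 * (j + 1), v + Pi.single 1 (sg c.2 *
      ((kap δ r ^ j : (ZMod n)ˣ) * r : ZMod n))) else
      (2 * j, v + Pi.single 0 (-(sg c.2 * ((kap δ r ^ j : (ZMod n)ˣ) : ZMod n)))) := by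
  have h1 : isUp c (2 * j + 1) = c.1 := by
    rcases c with ⟨_ | _, _⟩ <;> simp [isUp, Int.add_emod]
  refine Prod.ext ?_ ?_
  · rw [cst_fst, h1]
    rcases c with ⟨_ | _, _⟩ <;> simp; ring
  · rw [cst_snd, h1]
    rcases c with ⟨_ | _, b⟩
    · cases b <;> simp [ix, sg, wt_two_mul]
    · simp [ix, sg, wt_two_mul_add_one]

/-- The vertex of the cover with height `h` and coordinates `y, z`. -/
def pt (h : ℤ) (y z : ZMod n) : ℤ × (ZMod 2 → ZMod n) := (h, Pi.single 0 y + Pi.single 1 z)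

theorem proj_pt_eq_iff (h : ℤ) (y z : ZMod n) : proj m (pt h y z) = proj m (base 2 n) ↔
    ((m * 2 : ℕ) : ℤ) ∣ h ∧ y = 0 ∧ z = 0 := by
  rw [← ZMod.intCast_zmod_eq_zero_iff_dvd, proj, proj, Prod.ext_iff]
  simp only [pt, base, Int.cast_zero]
  refine and_congr Iff.rfl ⟨fun h => ⟨?_, ?_⟩, ?_⟩
  · simpa using congrFun h 0
  · simpa using congrFun h 1
  · rintro ⟨rfl, rfl⟩; simp

theorem foldl_flatten_replicate {α β : Type*} (f : β → α → β) (w : List α) (N : ℕ) (b : β) :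
    (List.replicate N w).flatten.foldl f b = (fun b => w.foldl f b)^[N] b := by
  induction N generalizing b with
  | zero => rfl
  | succ N ih => rw [List.replicate_succ, List.flatten_cons, List.foldl_append, ih,
      Function.iterate_succ_apply]

theorem map_flatten_replicate {α β : Type*} (f : α → β) (w : List α) (N : ℕ) :
    (List.replicate N w).flatten.map f = (List.replicate N (w.map f)).flatten := by
  rw [List.map_flatten, List.map_replicate]

theorem iterate_eq_of_step {β : Type*} (f : β → β) (p : ℕ → β) (h : ∀ N, f (p N) = p (N + 1)) (N : ℕ) :
    f^[N] (p 0) = p N := by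
  induction N with
  | zero => rfl
  | succ N ih => rw [Function.iterate_succ_apply', ih, h]

/-- Since `κ - 1` is annihilated by `2`, it is fixed by all the units. -/
theorem ColourData.kap_mul_sub_one [NeZero n] (K : ColourData m r δ) (u : (ZMod n)ˣ) :
    (u : ZMod n) * (kap δ r - 1) = kap δ r - 1 :=
  unit_mul_of_two_mul_eq_zero u (by linear_combination K.two)

theorem ColourData.kap_pow [NeZero n] (K : ColourData m r δ) (j : ℕ) :
    (kap δ r : ZMod n) ^ j = 1 + j * (kap δ r - 1) := by
  induction j with
  | zero => simp
  | succ j ih =>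
    rw [pow_succ, ih]
    push_cast
    linear_combination (j : ZMod n) * K.kap_mul_sub_one (kap δ r)

/-- An automorphism that interchanges `y⁻` and `z⁺` maps the walk with the colours `y⁺, y⁻`,
repeated `N` times, to the walk with the colours `y⁺, z⁺`, repeated `N` times. Both are closed or
neither is. -/
theorem two_mul_eq_zero_iff_sum [NeZero n] {H : Admissible m 2 n r} (K : ColourData m r δ)
    {R : (CPM m 2 n r).RigidColouring Colour}
    (hR : R.st = vst H δ) {φ : CPMAut m 2 n r}
    (hφ : R.Acts φ (Equiv.swap (false, false) (true, true)))
    (h0 : φ (zeroSet m 2 n r) = zeroSet m 2 n r) (N : ℕ) :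
    ((2 * N : ℕ) : ZMod n) = 0 ↔
      m ∣ N ∧ ∑ j ∈ Finset.range N, (kap δ r : ZMod n) ^ j = 0 := by
  have h1 := closed_iff_closed_map K hR hφ h0
    (List.replicate N [(false, true), (false, false)]).flatten
  have h2 : [(false, true), (false, false)].map (Equiv.swap (false, false) (true, true)) =
      ([(false, true), (true, true)] : List Colour) := by decide
  rw [map_flatten_replicate, h2, foldl_flatten_replicate, foldl_flatten_replicate] at h1
  have e0 : base 2 n = pt 0 0 0 := by simp [base, pt]
  have h3 := iterate_eq_of_step (fun X => [(false, true), (false, false)].foldl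
    (fun X c => cst δ r c X) X) (fun N : ℕ => (pt 0 ((2 * N : ℕ) : ZMod n) 0)) (fun N => by
      simp only [pt, List.foldl_cons, List.foldl_nil]
      rw [show (0 : ℤ) = 2 * 0 by norm_num, cst_even]
      simp only [Bool.false_eq_true, if_false]
      rw [cst_odd]
      simp only [Bool.false_eq_true, if_false]
      refine Prod.ext rfl (funext fun i => ?_)
      have hi : i = 0 ∨ i = 1 := by clear * -; revert i; decide
      rcases hi with rfl | rfl
      · simp [sg]; ring
      · simp) N
  have h4 := iterate_eq_of_step (fun X => [(false, true), (true, true)].foldl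
    (fun X c => cst δ r c X) X) (fun N : ℕ => (pt (2 * N)
      (∑ j ∈ Finset.range N, (kap δ r : ZMod n) ^ j)
      ((∑ j ∈ Finset.range N, (kap δ r : ZMod n) ^ j) * r))) (fun N => by
      simp only [pt, List.foldl_cons, List.foldl_nil]
      rw [cst_even]
      simp only [Bool.false_eq_true, if_false]
      rw [cst_odd]
      simp only [if_true]
      refine Prod.ext (by simp) (funext fun i => ?_)
      have hi : i = 0 ∨ i = 1 := by clear * -; revert i; decide
      rcases hi with rfl | rfl
      · simp [sg, Finset.sum_range_succ]
      · simp [sg, Finset.sum_range_succ]; ring) N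
  simp only [Nat.cast_zero, mul_zero, Finset.range_zero, Finset.sum_empty, zero_mul] at h3 h4
  rw [e0, h3, h4, ← e0, proj_pt_eq_iff, proj_pt_eq_iff, Units.mul_left_eq_zero, and_self] at h1
  simp only [dvd_zero, true_and, and_true] at h1
  rw [h1]
  refine and_congr ?_ Iff.rfl
  rw [mul_comm m 2]
  push_cast
  rw [mul_dvd_mul_iff_left (by norm_num), Int.natCast_dvd_natCast]

/-- The analogue of `two_mul_eq_zero_iff_sum` for the walks with the colours `y⁺, y⁻, z⁺, z⁻` and
`y⁺, z⁺, y⁻, z⁻`, repeated `N` times. -/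
theorem two_mul_eq_zero_iff_mul [NeZero n] {H : Admissible m 2 n r} (K : ColourData m r δ)
    {R : (CPM m 2 n r).RigidColouring Colour}
    (hR : R.st = vst H δ) {φ : CPMAut m 2 n r}
    (hφ : R.Acts φ (Equiv.swap (false, false) (true, true)))
    (h0 : φ (zeroSet m 2 n r) = zeroSet m 2 n r) (N : ℕ) :
    ((2 * N : ℕ) : ZMod n) = 0 ↔ m ∣ 2 * N ∧ N * (kap δ r - 1 : ZMod n) = 0 := by
  have h1 := closed_iff_closed_map K hR hφ h0
    (List.replicate N [(false, true), (false, false), (true, true), (true, false)]).flatten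
  have h2 : [(false, true), (false, false), (true, true), (true, false)].map
      (Equiv.swap (false, false) (true, true)) =
      ([(false, true), (true, true), (false, false), (true, false)] : List Colour) := by decide
  rw [map_flatten_replicate, h2, foldl_flatten_replicate, foldl_flatten_replicate] at h1
  have e0 : base 2 n = pt 0 0 0 := by simp [base, pt]
  have h3 := iterate_eq_of_step (fun X =>
    [(false, true), (false, false), (true, true), (true, false)].foldl
    (fun X c => cst δ r c X) X) (fun N : ℕ => (pt 0 ((2 * N : ℕ) : ZMod n)
      (-((2 * N : ℕ) : ZMod n) * ((kap δ r ^ (-1 : ℤ) : (ZMod n)ˣ) * r : ZMod n)))) (fun N => by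
      simp only [pt, List.foldl_cons, List.foldl_nil]
      rw [show (0 : ℤ) = 2 * 0 by norm_num, cst_even]
      simp only [Bool.false_eq_true, if_false]
      rw [cst_odd]
      simp only [Bool.false_eq_true, if_false]
      rw [cst_even]
      simp only [if_true]
      rw [cst_odd]
      simp only [if_true]
      refine Prod.ext (by simp) (funext fun i => ?_)
      have hi : i = 0 ∨ i = 1 := by clear * -; revert i; decide
      rcases hi with rfl | rfl
      · simp [sg]; ring
      · simp [sg]; ring) N
  have h4 := iterate_eq_of_step (fun X =>
    [(false, true), (true, true), (false, false), (true, false)].foldl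
    (fun X c => cst δ r c X) X) (fun N : ℕ => (pt (2 * (2 * N : ℕ))
      (-(N * (kap δ r - 1 : ZMod n))) (-(N * (kap δ r - 1 : ZMod n)) * r))) (fun N => by
      have h5 := K.kap_mul_sub_one (kap δ r ^ (2 * N))
      simp only [pt, List.foldl_cons, List.foldl_nil]
      rw [cst_even]
      simp only [Bool.false_eq_true, if_false]
      rw [cst_odd]
      simp only [if_true]
      rw [cst_even]
      simp only [Bool.false_eq_true, if_false]
      rw [cst_odd]
      simp only [if_true]
      rw [zpow_add_one, zpow_natCast]
      push_cast at h5 ⊢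
      refine Prod.ext (by simp; ring) (funext fun i => ?_)
      have hi : i = 0 ∨ i = 1 := by clear * -; revert i; decide
      rcases hi with rfl | rfl
      · simp [sg]
        linear_combination -h5
      · simp [sg]
        linear_combination -(r : ZMod n) * h5) N
  simp only [Nat.cast_zero, mul_zero, neg_zero, zero_mul] at h3 h4
  rw [e0, h3, h4, ← e0, proj_pt_eq_iff, proj_pt_eq_iff, Units.mul_left_eq_zero, and_self] at h1
  simp only [dvd_zero, true_and, neg_eq_zero] at h1
  refine Iff.trans ⟨fun h => ⟨h, by rw [h, neg_zero, zero_mul]⟩, fun h => h.1⟩ (h1.trans ?_)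
  refine and_congr ?_ Iff.rfl
  rw [mul_comm m 2]
  push_cast
  rw [mul_dvd_mul_iff_left (by norm_num)]
  norm_cast

/-- The parameters of the graphs with an automorphism that fixes `⟨0; 0⟩` and interchanges the
colours `y⁻` and `z⁺`. -/
theorem parameters {H : Admissible m 2 n r} (K : ColourData m r δ)
    {R : (CPM m 2 n r).RigidColouring Colour}
    (hR : R.st = vst H δ) {φ : CPMAut m 2 n r}
    (hφ : R.Acts φ (Equiv.swap (false, false) (true, true)))
    (h0 : φ (zeroSet m 2 n r) = zeroSet m 2 n r) :
    (m = n ∧ Odd n ∧ kap δ r = 1) ∨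
    ∃ k, Odd k ∧ m = 2 * k ∧ n = 2 * m ∧ δ = false ∧ (kap δ r : ZMod n) = 1 + (m : ZMod n) := by
  have hn := H.hn
  have : NeZero n := ⟨by omega⟩
  have hA := two_mul_eq_zero_iff_sum K hR hφ h0
  have hB := two_mul_eq_zero_iff_mul K hR hφ h0
  have htwo : 2 * (kap δ r - 1 : ZMod n) = 0 := by linear_combination K.two
  have hmη : (m : ZMod n) * (kap δ r - 1 : ZMod n) = 0 := by
    have h1 := K.kap_pow m
    rw [← Units.val_pow_eq_pow_val, K.pow, Units.val_one] at h1
    linear_combination -h1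
  have hn2m : n ∣ 2 * m := by
    rw [← ZMod.natCast_eq_zero_iff]
    exact (hB m).2 ⟨Dvd.intro_left 2 rfl, hmη⟩
  rcases Nat.even_or_odd' n with ⟨p, hp | hp⟩
  · right
    have h1 : ((2 * p : ℕ) : ZMod n) = 0 := by rw [← hp, ZMod.natCast_self]
    obtain ⟨hmp, hsum⟩ := (hA p).1 h1
    have hpm : p ∣ m := by
      rw [hp] at hn2m
      exact (Nat.mul_dvd_mul_iff_left (by norm_num)).1 hn2m
    obtain rfl : m = p := Nat.dvd_antisymm hmp hpm
    have hsum' : ((m + (∑ j ∈ Finset.range m, j) : ℕ) : ZMod n) * 1 +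
        ((∑ j ∈ Finset.range m, j : ℕ) : ZMod n) * ((kap δ r : ZMod n) - 1 - 1) = 0 := by
      rw [← hsum, Finset.sum_congr rfl fun j _ => K.kap_pow j, Finset.sum_add_distrib,
        ← Finset.sum_mul]
      push_cast
      simp
      ring
    have hη : (kap δ r : ZMod n) - 1 = (m : ZMod n) := by
      set η := (kap δ r : ZMod n) - 1 with hηd
      have h3 : n ∣ 2 * η.val := by
        rw [← ZMod.natCast_eq_zero_iff]
        push_cast
        rw [ZMod.natCast_zmod_val, htwo]
      have h4 := ZMod.val_lt η
      obtain ⟨q, hq⟩ := h3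
      have h5 : q = 0 ∨ q = 1 := by
        have : q < 2 := by
          by_contra h6
          have : n * 2 ≤ n * q := Nat.mul_le_mul_left n (by omega)
          omega
        omega
      rcases h5 with rfl | rfl
      · exfalso
        have h6 : η = 0 := by
          rw [← ZMod.val_eq_zero]; omega
        rw [h6] at hsum'
        have h7 : ((m : ℕ) : ZMod n) = 0 := by
          push_cast at hsum'
          linear_combination hsum'
        rw [ZMod.natCast_eq_zero_iff] at h7
        have := Nat.le_of_dvd (by omega) h7
        omega
      · rw [← ZMod.natCast_zmod_val η]
        congr 1
        omega
    have hm2 : 2 ∣ m := by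
      have h3 := ((hB m).1 h1).2
      rw [hη, ← Nat.cast_mul, ZMod.natCast_eq_zero_iff] at h3
      exact (Nat.mul_dvd_mul_iff_right (by omega : 0 < m)).1 (hp ▸ h3)
    obtain ⟨k, hk⟩ := hm2
    have hkodd : Odd k := by
      rw [hη] at hsum'
      have h3 : ((m * (1 + ∑ j ∈ Finset.range m, j) : ℕ) : ZMod n) = 0 := by
        push_cast at hsum' ⊢
        linear_combination hsum'
      rw [ZMod.natCast_eq_zero_iff, hp, mul_comm 2 m,
        Nat.mul_dvd_mul_iff_left (by omega : 0 < m)] at h3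
      have h4 := Finset.sum_range_id_mul_two m
      have h5 : (∑ j ∈ Finset.range m, j) = k * (m - 1) := by
        apply Nat.eq_of_mul_eq_mul_right (show 0 < 2 by norm_num)
        rw [h4, hk]; ring
      rw [h5] at h3
      rw [← Nat.not_even_iff_odd]
      rintro ⟨l, rfl⟩
      have h6 : 2 ∣ (l + l) * (m - 1) := Dvd.dvd.mul_right ⟨l, by ring⟩ _
      omega
    have hκ : (kap δ r : ZMod n) = 1 + (m : ZMod n) := by linear_combination hη
    refine ⟨k, hkodd, hk, hp, ?_, hκ⟩
    -- Otherwise `r ^ 2 = 1 + m` would be congruent to `3` modulo `4`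
    by_contra hδ
    rw [Bool.not_eq_false] at hδ
    subst hδ
    have h4 : 4 ∣ n := ⟨k, by omega⟩
    have h5 := congrArg (ZMod.castHom h4 (ZMod 4)) hκ
    obtain ⟨l, rfl⟩ := hkodd
    simp only [kap, sgu, if_true, one_mul, Units.val_pow_eq_pow_val, map_pow, map_add, map_one,
      map_natCast, hk] at h5
    have h6 : (((2 * (2 * l + 1) : ℕ)) : ZMod 4) = 2 := by
      push_cast
      have : (4 : ZMod 4) = 0 := by decide
      linear_combination (l : ZMod 4) * this
    rw [h6] at h5
    revert h5
    generalize (ZMod.castHom h4 (ZMod 4)) (r : ZMod n) = a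
    revert a
    decide
  · left
    have hη : (kap δ r : ZMod n) - 1 = 0 := by
      have h1 : ((2 * p + 1 : ℕ) : ZMod n) = 0 := by rw [← hp, ZMod.natCast_self]
      push_cast at h1
      linear_combination ((kap δ r : ZMod n) - 1) * h1 - (p : ZMod n) * htwo
    refine ⟨Nat.dvd_antisymm ((hA n).1 ?_).1 ?_, ⟨p, hp⟩, Units.ext ?_⟩
    · push_cast; simp
    · have h1 : n.Coprime 2 := Nat.Coprime.symm (by rw [Nat.coprime_two_left]; exact ⟨p, hp⟩)
      exact h1.dvd_mul_left.1 hn2m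
    · rw [Units.val_one]; linear_combination hη

end CPMVertex

/-! ### The action of `ν` on coordinates -/

namespace CPMVertex

variable {m n : ℕ} {r : (ZMod n)ˣ} {δ : Bool}

/-- The height and the coordinates of a vertex of the cover, reduced modulo `d`. -/
def trip (d : ℕ) (X : ℤ × (ZMod 2 → ZMod n)) : ZMod d × ZMod d × ZMod d :=
  ((X.1 : ZMod d), (X.2 0).cast, (X.2 1).cast)

theorem cpmTriple_proj {d : ℕ} (hd : d ∣ m * 2) (X : ℤ × (ZMod 2 → ZMod n)) :
    cpmTriple d (proj m X) = trip d X :=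
  Prod.ext (ZMod.cast_intCast hd _) rfl

theorem trip_cst_even {d : ℕ} (hd : d ∣ n) (c : Colour) (j : ℤ) (v : ZMod 2 → ZMod n) :
    trip d (cst δ r c (2 * j, v)) = trip d (2 * j, v) + if c.1 then
      (-1, 0, -(sg c.2 * (ZMod.castHom hd (ZMod d) ((kap δ r ^ (j - 1) : (ZMod n)ˣ)) *
        ZMod.castHom hd (ZMod d) r)))
      else (1, sg c.2 * ZMod.castHom hd (ZMod d) ((kap δ r ^ j : (ZMod n)ˣ)), 0) := by
  rw [cst_even]
  split_ifs <;> simp only [trip, ← ZMod.castHom_apply (h := hd)] <;> ext <;>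
    simp [-ZMod.castHom_apply]
  ring

theorem trip_cst_odd {d : ℕ} (hd : d ∣ n) (c : Colour) (j : ℤ) (v : ZMod 2 → ZMod n) :
    trip d (cst δ r c (2 * j + 1, v)) = trip d (2 * j + 1, v) + if c.1 then
      (1, 0, sg c.2 * (ZMod.castHom hd (ZMod d) ((kap δ r ^ j : (ZMod n)ˣ)) *
        ZMod.castHom hd (ZMod d) r))
      else (-1, -(sg c.2 * ZMod.castHom hd (ZMod d) ((kap δ r ^ j : (ZMod n)ˣ))), 0) := by
  rw [cst_odd]
  split_ifs <;> simp only [trip, ← ZMod.castHom_apply (h := hd)] <;> ext <;>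
    simp [-ZMod.castHom_apply]
  ring

theorem castHom_kap_zpow {d : ℕ} (hd : d ∣ n) {u : (ZMod d)ˣ}
    (h : ZMod.castHom hd (ZMod d) (kap δ r) = u) (j : ℤ) :
    ZMod.castHom hd (ZMod d) ((kap δ r ^ j : (ZMod n)ˣ)) = (u ^ j : (ZMod d)ˣ) := by
  have h1 : Units.map (ZMod.castHom hd (ZMod d) : ZMod n →* ZMod d) (kap δ r) = u := Units.ext h
  rw [← h1, ← map_zpow]
  rfl

/-- The displacement modulo `d` along the edge of colour `c` from an even height, if `κ = 1` in
`ℤ_d`. -/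
def dispOne {d : ℕ} (a : ZMod d) (c : Colour) : ZMod d × ZMod d × ZMod d :=
  if c.1 then (-1, 0, -(sg c.2 * a)) else (1, sg c.2, 0)

theorem cpmBeta_add {d : ℕ} (q : ZMod d) (u w : ZMod d × ZMod d × ZMod d) :
    cpmBeta q (u + w) = cpmBeta q u + cpmBeta q w := by
  obtain ⟨a, b, c⟩ := u
  obtain ⟨a', b', c'⟩ := w
  simp only [cpmBeta, Prod.mk_add_mk]
  refine Prod.ext ?_ (Prod.ext ?_ ?_) <;> simp only <;> ring

theorem cpmBeta_neg {d : ℕ} (q : ZMod d) (u : ZMod d × ZMod d × ZMod d) :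
    cpmBeta q (-u) = -cpmBeta q u := by
  obtain ⟨a, b, c⟩ := u
  simp only [cpmBeta, Prod.neg_mk]
  refine Prod.ext ?_ (Prod.ext ?_ ?_) <;> simp only <;> ring

theorem two_mul_inv {d : ℕ} (hd : Odd d) : (2 : ZMod d) * 2⁻¹ = 1 := by
  exact_mod_cast ZMod.coe_mul_inv_eq_one (n := d) 2 (by rw [Nat.coprime_two_left]; exact hd)

/-- The map `β` interchanges the displacements of the colours `y⁻` and `z^ε` and fixes those of the
other two colours. -/
theorem cpmBeta_dispOne {d : ℕ} (hd : Odd d) {q a : ZMod d} {ε : Bool} (hq : q * (sg ε * a) = 1)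
    (c : Colour) :
    cpmBeta q (dispOne a c) = dispOne a (Equiv.swap (false, false) (true, ε) c) := by
  have h2 := two_mul_inv hd
  have hε := sg_sq (n := d) ε
  have hinv : q⁻¹ = sg ε * a := ZMod.inv_eq_of_mul_eq_one _ _ _ hq
  have ha : a = sg ε * q⁻¹ := by rw [hinv]; linear_combination -a * hε
  have hq' : q * q⁻¹ = 1 := by rw [hinv, hq]
  clear hinv hq
  subst ha
  have e1 : ∀ (ε : Bool) (c : Colour), c = (false, true) ∨ c = (false, false) ∨ c = (true, ε) ∨
      c = (true, !ε) := by decide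
  have h3 : ((sg (!ε) : ℤ) : ZMod d) = -sg ε := by cases ε <;> simp [sg]
  rcases e1 ε c with rfl | rfl | rfl | rfl
  · rw [Equiv.swap_apply_of_ne_of_ne (by simp) (by simp)]
    simp only [cpmBeta, dispOne, sg, if_true, Bool.false_eq_true, if_false]
    refine Prod.ext ?_ (Prod.ext ?_ ?_) <;> simp only <;> push_cast
    · ring
    · linear_combination h2
    · ring
  · rw [Equiv.swap_apply_left]
    simp only [cpmBeta, dispOne, sg, if_true, Bool.false_eq_true, if_false]
    refine Prod.ext ?_ (Prod.ext ?_ ?_) <;> simp only <;> push_cast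
    · ring
    · ring
    · cases ε <;> simp <;> linear_combination -q⁻¹ * h2
  · rw [Equiv.swap_apply_right]
    simp only [cpmBeta, dispOne, if_true, Bool.false_eq_true, if_false]
    refine Prod.ext ?_ (Prod.ext ?_ ?_) <;> simp only
    · simp [sg]; cases ε <;> simp <;> linear_combination hq'
    · simp [sg]; cases ε <;> simp <;> linear_combination -h2 - 2⁻¹ * hq'
    · cases ε <;> simp [sg]
  · rw [Equiv.swap_apply_of_ne_of_ne (by simp) (by cases ε <;> simp)]
    simp only [cpmBeta, dispOne, if_true, h3]
    refine Prod.ext ?_ (Prod.ext ?_ ?_) <;> simp only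
    · cases ε <;> simp [sg] <;> linear_combination hq'
    · cases ε <;> simp [sg] <;> linear_combination 2⁻¹ * hq'
    · cases ε <;> simp [sg] <;> linear_combination q⁻¹ * h2

/-- Modulo a divisor `d` of `n` with `κ = 1` in `ℤ_d` the displacement along an edge depends only
on its colour and on the parity of the height. -/
theorem trip_cst_of_kap_eq_one {d : ℕ} (hd : d ∣ n) (h : ZMod.castHom hd (ZMod d) (kap δ r) = 1)
    (c : Colour) (X : ℤ × (ZMod 2 → ZMod n)) :
    trip d (cst δ r c X) = trip d X + if X.1 % 2 = 0 then
      dispOne (ZMod.castHom hd (ZMod d) r) c else -dispOne (ZMod.castHom hd (ZMod d) r) c := by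
  obtain ⟨i, v⟩ := X
  have h1 := castHom_kap_zpow hd (u := 1) h
  rcases Int.even_or_odd' i with ⟨j, rfl | rfl⟩
  · rw [trip_cst_even hd, h1, h1, if_pos (show (2 * j) % 2 = 0 by omega)]
    simp only [dispOne, one_zpow, Units.val_one, one_mul, mul_one]
  · rw [trip_cst_odd hd, h1, if_neg (show ¬ (2 * j + 1) % 2 = 0 by omega)]
    simp only [dispOne, one_zpow, Units.val_one, one_mul, mul_one]
    split_ifs <;> simp

/-- The step of the induction that identifies `ν` modulo an odd number. -/
theorem trip_cst_beta {d : ℕ} (hd : d ∣ n) (hodd : Odd d)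
    (h : ZMod.castHom hd (ZMod d) (kap δ r) = 1) {q : ZMod d} {ε : Bool}
    (hq : q * (sg ε * ZMod.castHom hd (ZMod d) r) = 1) (c : Colour)
    {X Y : ℤ × (ZMod 2 → ZMod n)} (hpar : X.1 % 2 = Y.1 % 2) (hXY : trip d Y = cpmBeta q (trip d X)) :
    trip d (cst δ r (Equiv.swap (false, false) (true, ε) c) Y) =
      cpmBeta q (trip d (cst δ r c X)) := by
  rw [trip_cst_of_kap_eq_one hd h, trip_cst_of_kap_eq_one hd h, cpmBeta_add, ← hXY, ← hpar]
  split_ifs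
  · rw [cpmBeta_dispOne hodd hq]
  · rw [cpmBeta_neg, cpmBeta_dispOne hodd hq]

theorem emod_two_cst (c c' : Colour) {X Y : ℤ × (ZMod 2 → ZMod n)} (hpar : X.1 % 2 = Y.1 % 2) :
    (cst δ r c X).1 % 2 = (cst δ r c' Y).1 % 2 := by
  rw [cst_fst, cst_fst]
  split_ifs <;> omega

theorem cast_proj_fst (X : ℤ × (ZMod 2 → ZMod n)) : ((proj m X).1.cast : ZMod 2) = X.1 :=
  ZMod.cast_intCast (Dvd.intro_left m rfl) _

/-- By induction along the edges: `ν` and `β` agree at `⟨0; 0⟩` and interchange the same two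
colours. Since every step changes the parity of the height, `ν` preserves it. -/
theorem isNuOdd_of_acts {H : Admissible m 2 n r} (K : ColourData m r δ)
    {R : (CPM m 2 n r).RigidColouring Colour} (hR : R.st = vst H δ) {ν : CPMAut m 2 n r}
    (hν : R.Acts ν (Equiv.swap (false, false) (true, true)))
    (h0 : ν (zeroSet m 2 n r) = zeroSet m 2 n r) (hm : m = n) (hodd : Odd n) (hκ : kap δ r = 1) :
    IsNuOdd ν := by
  have hd : n ∣ m * 2 := hm ▸ Dvd.intro _ rfl
  have hcast : ZMod.castHom (dvd_refl n) (ZMod n) = RingHom.id _ := by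
    ext; simp
  suffices h : ∀ x, ∃ X Y : ℤ × (ZMod 2 → ZMod n), x.1 = proj m X ∧ (ν x).1 = proj m Y ∧
      X.1 % 2 = Y.1 % 2 ∧ trip n Y = cpmBeta ((r⁻¹ : (ZMod n)ˣ) : ZMod n) (trip n X) by
    intro x
    obtain ⟨X, Y, h1, h2, h3, h4⟩ := h x
    rw [h1, h2, cpmTriple_proj hd, cpmTriple_proj hd, cast_proj_fst, cast_proj_fst]
    exact ⟨((ZMod.intCast_eq_intCast_iff' _ _ _).2 h3).symm, h4⟩
  refine R.induct (v₀ := zeroSet m 2 n r) preconnected_CPM ?_ ?_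
  · refine ⟨base 2 n, base 2 n, by simp [zeroSet, zero, proj, base],
      by rw [h0]; simp [zeroSet, zero, proj, base], rfl, by simp [trip, base, cpmBeta]⟩
  · rintro c x ⟨X, Y, h1, h2, h3, h4⟩
    refine ⟨_, _, ?_, ?_, emod_two_cst c _ h3,
      trip_cst_beta (δ := δ) (r := r) (ε := true) (dvd_refl n) hodd ?_ ?_ c h3 h4⟩
    · rw [hR, vst_eq H K c h1]
    · rw [hν, hR, vst_eq H K _ h2]
    · rw [hκ, Units.val_one, map_one]
    · rw [hcast]; simp [sg]

/-- The step along the edge of colour `c` modulo `4` if `κ = -1` in `ℤ_4`, where `a` is the residue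
of `r`. -/
def stepFour (a : ZMod 4) (c : Colour) (u : ZMod 4 × ZMod 4 × ZMod 4) : ZMod 4 × ZMod 4 × ZMod 4 :=
  let (x, y, z) := u
  let e : ZMod 4 := sg c.2 * if x = 0 ∨ x = 1 then 1 else -1
  if x = 0 ∨ x = 2 then (if c.1 then (x - 1, y, z + e * a) else (x + 1, y + e, z))
  else if c.1 then (x + 1, y, z + e * a) else (x - 1, y - e, z)

/-- The height of a vertex of the 4-cube is determined by the parities of its coordinates. -/
def IsCubeVertex (u : ZMod 4 × ZMod 4 × ZMod 4) : Prop := u.1 = gray (oddFour u.2.1) (oddFour u.2.2)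

instance : DecidablePred IsCubeVertex := fun u => by unfold IsCubeVertex; infer_instance

/-- The sign `ε` such that `ν` interchanges the colours `y⁻` and `z^ε`, where `a` is the residue
of `r` modulo `4`. -/
def nuSign (a : ZMod 4) : Bool := a = 1

set_option synthInstance.maxSize 1000 in
/-- The permutation `ν₄` interchanges the colours `y⁻` and `z^ε` of the edges of the 4-cube. -/
theorem nuFour_stepFour : ∀ a ∈ ([1, 3] : List (ZMod 4)), ∀ (c : Colour) (x y z : ZMod 4),
    IsCubeVertex (x, y, z) → IsCubeVertex (stepFour a c (x, y, z)) ∧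
      nuFour (stepFour a c (x, y, z)) =
        stepFour a (Equiv.swap (false, false) (true, nuSign a) c) (nuFour (x, y, z)) := by
  decide +kernel

theorem trip_cst_of_kap_eq_neg_one (hd : 4 ∣ n) (h : ZMod.castHom hd (ZMod 4) (kap δ r) = -1)
    (c : Colour) (X : ℤ × (ZMod 2 → ZMod n)) :
    trip 4 (cst δ r c X) = stepFour (ZMod.castHom hd (ZMod 4) r) c (trip 4 X) := by
  obtain ⟨i, v⟩ := X
  have h1 := castHom_kap_zpow hd (u := -1) (by simpa using h)
  have h4 : (4 : ZMod 4) = 0 := by decide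
  rcases Int.even_or_odd' i with ⟨j, rfl | rfl⟩
  · rw [trip_cst_even hd, h1, h1, trip]
    rcases Int.even_or_odd' j with ⟨l, rfl | rfl⟩
    · have h2 : ((2 * (2 * l) : ℤ) : ZMod 4) = 0 := by
        push_cast; linear_combination (l : ZMod 4) * h4
      have h3 : (-1 : (ZMod 4)ˣ) ^ (2 * l) = 1 := by rw [zpow_mul]; simp
      rw [h2, zpow_sub_one, h3]
      simp only [stepFour]
      rcases c with ⟨_ | _, b⟩ <;> simp
    · have h2 : ((2 * (2 * l + 1) : ℤ) : ZMod 4) = 2 := by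
        push_cast; linear_combination (l : ZMod 4) * h4
      have h3 : (-1 : (ZMod 4)ˣ) ^ (2 * l) = 1 := by rw [zpow_mul]; simp
      have h5 : (2 : ZMod 4) ≠ 0 ∧ (2 : ZMod 4) ≠ 1 := by decide
      rw [h2, add_sub_cancel_right, zpow_add_one, h3]
      simp only [stepFour]
      rcases c with ⟨_ | _, b⟩ <;> simp [h5, sub_eq_add_neg]
  · rw [trip_cst_odd hd, h1, trip]
    rcases Int.even_or_odd' j with ⟨l, rfl | rfl⟩
    · have h2 : ((2 * (2 * l) + 1 : ℤ) : ZMod 4) = 1 := by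
        push_cast; linear_combination (l : ZMod 4) * h4
      have h3 : (-1 : (ZMod 4)ˣ) ^ (2 * l) = 1 := by rw [zpow_mul]; simp
      have h5 : ¬ ((1 : ZMod 4) = 0 ∨ (1 : ZMod 4) = 2) := by decide
      rw [h2, h3]
      simp only [stepFour]
      rcases c with ⟨_ | _, b⟩ <;> simp [h5, sub_eq_add_neg]
    · have h2 : ((2 * (2 * l + 1) + 1 : ℤ) : ZMod 4) = 3 := by
        push_cast; linear_combination (l : ZMod 4) * h4
      have h3 : (-1 : (ZMod 4)ˣ) ^ (2 * l) = 1 := by rw [zpow_mul]; simp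
      have h5 : ¬ ((3 : ZMod 4) = 0 ∨ (3 : ZMod 4) = 2) := by decide
      have h6 : ¬ ((3 : ZMod 4) = 0 ∨ (3 : ZMod 4) = 1) := by decide
      rw [h2, zpow_add_one, h3]
      simp only [stepFour]
      rcases c with ⟨_ | _, b⟩ <;> simp [h5, h6, sub_eq_add_neg]

/-- As `n = 4 k` with `k` odd, a vertex is determined by its residues modulo `4`, where `κ = -1`,
and modulo `k`, where `κ = 1`. On the former `ν` acts as `ν₄`, on the latter as `β`. -/
theorem isNuEven_of_acts {k : ℕ} {H : Admissible m 2 n r} (K : ColourData m r δ)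
    {R : (CPM m 2 n r).RigidColouring Colour} (hR : R.st = vst H δ) {ν : CPMAut m 2 n r}
    (hν : R.Acts ν (Equiv.swap (false, false) (true, nuSign ((r : ZMod n).cast : ZMod 4))))
    (h0 : ν (zeroSet m 2 n r) = zeroSet m 2 n r) (hk : Odd k) (hm : m = 2 * k) (hn : n = 2 * m)
    (hδ : δ = false) (hκ : (kap δ r : ZMod n) = 1 + (m : ZMod n)) :
    IsNuEven k ν := by
  have d4 : 4 ∣ n := ⟨k, by omega⟩
  have dk : k ∣ n := ⟨4, by omega⟩
  have d4' : 4 ∣ m * 2 := ⟨k, by omega⟩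
  have dk' : k ∣ m * 2 := ⟨4, by omega⟩
  have hκ4 : ZMod.castHom d4 (ZMod 4) (kap δ r) = -1 := by
    rw [hκ, map_add, map_one, map_natCast, hm]
    obtain ⟨l, rfl⟩ := hk
    have h4 : (4 : ZMod 4) = 0 := by decide
    push_cast
    linear_combination ((l : ZMod 4) + 1) * h4
  have hκk : ZMod.castHom dk (ZMod k) (kap δ r) = 1 := by
    rw [hκ, map_add, map_one, map_natCast, hm]
    simp
  have hr4 : ((r : ZMod n).cast : ZMod 4) ∈ ([1, 3] : List (ZMod 4)) := by
    have h1 : IsUnit (ZMod.castHom d4 (ZMod 4) r) := r.isUnit.map _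
    rw [ZMod.castHom_apply] at h1
    have h2 : ∀ a b : ZMod 4, a * b = 1 → a ∈ ([1, 3] : List (ZMod 4)) := by decide
    obtain ⟨b, hb⟩ := h1.exists_right_inv
    exact h2 _ _ hb
  -- Modulo `k` the equation `κ = 1` reads `-r ^ 2 = 1`, so that `q = ±r` is the inverse of `∓r`.
  have hq : nuEvenQ k r * (sg (nuSign ((r : ZMod n).cast : ZMod 4)) *
      ZMod.castHom dk (ZMod k) r) = 1 := by
    have h1 : -(ZMod.castHom dk (ZMod k) r * ZMod.castHom dk (ZMod k) r) = 1 := by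
      have h2 : (kap δ r : ZMod n) = -(r * r) := by rw [hδ]; simp [kap, sgu, sq]
      rw [← hκk, h2, map_neg, map_mul]
    change (if ((r : ZMod n).cast : ZMod 4) = 3 then ZMod.castHom dk (ZMod k) r else
      -ZMod.castHom dk (ZMod k) r) * _ = 1
    generalize ZMod.castHom dk (ZMod k) r = a at h1 ⊢
    rcases List.mem_pair.1 hr4 with h | h <;> rw [h]
    · rw [if_neg (by decide)]
      simpa [nuSign, sg] using h1
    · have h3 : (3 : ZMod 4) ≠ 1 := by decide
      rw [if_pos rfl]
      simpa [nuSign, sg, h3] using h1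
  suffices h : ∀ x, ∃ X Y : ℤ × (ZMod 2 → ZMod n), x.1 = proj m X ∧ (ν x).1 = proj m Y ∧
      X.1 % 2 = Y.1 % 2 ∧ IsCubeVertex (trip 4 X) ∧ trip 4 Y = nuFour (trip 4 X) ∧
        trip k Y = cpmBeta (nuEvenQ k r) (trip k X) by
    intro x
    obtain ⟨X, Y, h1, h2, -, -, h3, h4⟩ := h x
    rw [h1, h2, cpmTriple_proj d4', cpmTriple_proj d4', cpmTriple_proj dk', cpmTriple_proj dk']
    exact ⟨h3, h4⟩
  refine R.induct (v₀ := zeroSet m 2 n r) preconnected_CPM ?_ ?_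
  · refine ⟨base 2 n, base 2 n, by simp [zeroSet, zero, proj, base],
      by rw [h0]; simp [zeroSet, zero, proj, base], rfl, ?_, ?_, by simp [trip, base, cpmBeta]⟩
    · simp [trip, base]; decide
    · simp [trip, base]; decide
  · rintro c x ⟨X, Y, h1, h2, h3, h4, h5, h6⟩
    obtain ⟨e1, e2⟩ := nuFour_stepFour _ hr4 c _ _ _ h4
    refine ⟨_, _, ?_, ?_, emod_two_cst c _ h3, ?_, ?_,
      trip_cst_beta (δ := δ) (r := r) dk hk hκk hq c h3 h6⟩
    · rw [hR, vst_eq H K c h1]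
    · rw [hν, hR, vst_eq H K _ h2]
    · rw [trip_cst_of_kap_eq_neg_one d4 hκ4]
      exact e1
    · rw [trip_cst_of_kap_eq_neg_one d4 hκ4, trip_cst_of_kap_eq_neg_one d4 hκ4, h5]
      exact e2.symm

end CPMVertex

/-! ### The 4-cube with `m = 1` -/

namespace CPMVertex

/-- The coordinates of the neighbour along the edge of colour `c` in `CPM(1, 2, 4; r)`. The
colours are those of the 4-cube `CPM(2, 2, 4; r)`, whose heights are recovered from the
coordinates by `gray`. -/
def cubeStep (a : ZMod 4) (c : Colour) (y z : ZMod 4) : ZMod 4 × ZMod 4 :=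
  (stepFour a c (gray (oddFour y) (oddFour z), y, z)).2

/-- The vector with the coordinates `y, z`. -/
def vec (p : ZMod 4 × ZMod 4) : ZMod 2 → ZMod 4 := Pi.single 0 p.1 + Pi.single 1 p.2

@[simp] theorem vec_zero (p : ZMod 4 × ZMod 4) : vec p 0 = p.1 := by simp [vec]

@[simp] theorem vec_one (p : ZMod 4 × ZMod 4) : vec p 1 = p.2 := by simp [vec]

theorem eq_vec_iff (v : ZMod 2 → ZMod 4) (p : ZMod 4 × ZMod 4) : v = vec p ↔ (v 0, v 1) = p := by
  constructor
  · rintro rfl; simp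
  · rintro rfl
    funext i
    have hi : i = 0 ∨ i = 1 := by clear * -; revert i; decide
    rcases hi with rfl | rfl <;> simp

variable {r : (ZMod 4)ˣ}

theorem mem_units_four (r : (ZMod 4)ˣ) : (r : ZMod 4) ∈ ([1, 3] : List (ZMod 4)) := by
  revert r; decide

theorem adj_cube_iff (H : Admissible 1 2 4 r) (x w : CPMVertex 1 2 4) :
    (CPMbar 1 2 4 r).Adj x w ↔ w.1 = x.1 + 1 ∧ ∃ b : Bool,
      (w.2 0, w.2 1) = (x.2 0 + sg b, x.2 1) ∨ (w.2 0, w.2 1) = (x.2 0, x.2 1 + sg b * r) := by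
  obtain ⟨i, v⟩ := x
  have hinv : r⁻¹ = r := by clear * -; revert r; decide
  have h2 : (-1 : ZMod (1 * 2)) = 1 := by decide
  have h3 : (1 : ZMod (1 * 2)) + 1 = 0 := by decide
  have hi : i = ((0 : ℤ) : ZMod (1 * 2)) ∨ i = ((1 : ℤ) : ZMod (1 * 2)) := by
    clear * -; revert i; decide
  have hv : ∀ u : ZMod 2 → ZMod 4, w.2 = u ↔ (w.2 0, w.2 1) = (u 0, u 1) := fun u => by
    rw [show u = vec (u 0, u 1) from (eq_vec_iff _ _).2 rfl, eq_vec_iff]; simp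
  rcases hi with rfl | rfl
  · change (CPMbar 1 2 4 r).Adj (proj 1 ((0 : ℤ), v)) w ↔ _
    rw [adj_proj_iff H, Prod.exists, Bool.exists_bool]
    simp only [move, nxt, lvl, proj, Prod.ext_iff (x := w), hv]
    simp [hinv, h2]
    tauto
  · change (CPMbar 1 2 4 r).Adj (proj 1 ((1 : ℤ), v)) w ↔ _
    rw [adj_proj_iff H, Prod.exists, Bool.exists_bool]
    simp only [move, nxt, lvl, proj, Prod.ext_iff (x := w), hv]
    simp [h3]
    tauto

theorem cubeStep_iff : ∀ a ∈ ([1, 3] : List (ZMod 4)), ∀ y z y' z' : ZMod 4,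
    (∃ b : Bool, (y', z') = (y + sg b, z) ∨ (y', z') = (y, z + sg b * a)) ↔
      ∃ c, (y', z') = cubeStep a c y z := by
  decide +kernel

theorem cubeStep_cubeStep : ∀ a ∈ ([1, 3] : List (ZMod 4)), ∀ (c : Colour) (y z : ZMod 4),
    cubeStep a c (cubeStep a c y z).1 (cubeStep a c y z).2 = (y, z) := by
  decide +kernel

theorem cubeStep_inj : ∀ a ∈ ([1, 3] : List (ZMod 4)), ∀ (c c' : Colour) (y z : ZMod 4),
    cubeStep a c y z = cubeStep a c' y z → c = c' := by
  decide +kernel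

/-- The ends of a path of length 3 in the 4-cube are adjacent if and only if its first and its
last edge have the same direction. -/
theorem cubeStep_path : ∀ a ∈ ([1, 3] : List (ZMod 4)), ∀ (c d c' : Colour) (y z : ZMod 4),
    c ≠ d → c' ≠ d →
      ((∃ e, cubeStep a c' (cubeStep a d y z).1 (cubeStep a d y z).2 =
        cubeStep a e (cubeStep a c y z).1 (cubeStep a c y z).2) ↔ c = c') := by
  decide +kernel

/-- The neighbour of a vertex of `CPM(1, 2, 4; r)` along the edge of colour `c`. -/
def cubeSt (H : Admissible 1 2 4 r) (c : Colour) (x : CPMSet 1 2 4 r) : CPMSet 1 2 4 r :=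
  ⟨(x.1.1 + 1, vec (cubeStep r c (x.1.2 0) (x.1.2 1))), mem_cpmSet_of_adj x.2
    ((adj_cube_iff H _ _).2 ⟨rfl, (cubeStep_iff _ (mem_units_four r) _ _ _ _).2
      ⟨c, by simp⟩⟩)⟩

theorem adj_iff_cubeSt (H : Admissible 1 2 4 r) (x w : CPMSet 1 2 4 r) :
    (CPM 1 2 4 r).Adj x w ↔ ∃ c, w = cubeSt H c x := by
  change (CPMbar 1 2 4 r).Adj x.1 w.1 ↔ _
  rw [adj_cube_iff H, cubeStep_iff _ (mem_units_four r)]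
  simp only [Subtype.ext_iff, cubeSt, Prod.ext_iff (x := w.1), eq_vec_iff]
  simp

/-- The colouring of the 4-cube `CPM(1, 2, 4; r)` by the four directions. -/
def cubeColouring (H : Admissible 1 2 4 r) : (CPM 1 2 4 r).RigidColouring Colour :=
  SimpleGraph.RigidColouring.ofInvariant (cubeSt H) (adj_iff_cubeSt H)
    (fun c x => by
      have h3 : ∀ i : ZMod (1 * 2), i + 1 + 1 = i := by decide
      refine Subtype.ext (Prod.ext (h3 _) ?_)
      simp only [cubeSt, vec_zero, vec_one]
      rw [cubeStep_cubeStep _ (mem_units_four r)]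
      exact ((eq_vec_iff _ _).2 rfl).symm)
    (fun c c' x h => by
      refine cubeStep_inj _ (mem_units_four r) c c' (x.1.2 0) (x.1.2 1) ?_
      have h1 : vec _ = vec _ := (Prod.ext_iff.1 (Subtype.ext_iff.1 h)).2
      have h2 := (eq_vec_iff _ _).1 h1
      simpa using h2)
    (fun p₀ _ _ p₃ => (CPM 1 2 4 r).Adj p₀ p₃) (fun φ _ _ _ _ h => φ.map_rel_iff.2 h)
    (fun x c d c' hcd hcd' => by
      rw [adj_iff_cubeSt H, ← cubeStep_path _ (mem_units_four r) c d c' (x.1.2 0) (x.1.2 1) hcd hcd']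
      simp only [Subtype.ext_iff, cubeSt, Prod.mk.injEq, true_and, eq_vec_iff]
      simp)

theorem nuFour_snd : ∀ x x' y z : ZMod 4, (nuFour (x, y, z)).2 = (nuFour (x', y, z)).2 := by
  decide +kernel

theorem gray_cubeStep : ∀ a ∈ ([1, 3] : List (ZMod 4)), ∀ (c : Colour) (y z : ZMod 4),
    ((gray (oddFour (cubeStep a c y z).1) (oddFour (cubeStep a c y z).2)).cast : ZMod 2) =
      (gray (oddFour y) (oddFour z)).cast + 1 := by
  decide +kernel

/-- By induction along the edges `ν` agrees with `ν₄` on the coordinates, which determine the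
vertex. -/
theorem isNuCube_of_acts (H : Admissible 1 2 4 r) {ν : CPMAut 1 2 4 r}
    (hν : (cubeColouring H).Acts ν (Equiv.swap (false, false) (true, nuSign r)))
    (h0 : ν (zeroSet 1 2 4 r) = zeroSet 1 2 4 r) : IsNuCube ν := by
  have hcast : ∀ i : ZMod (1 * 2), ((i + 1).cast : ZMod 2) = i.cast + 1 := by decide
  have hpar : ∀ x : CPMSet 1 2 4 r, (x.1.1.cast : ZMod 2) =
      (gray (oddFour (x.1.2 0)) (oddFour (x.1.2 1))).cast := by
    refine (cubeColouring H).induct (v₀ := zeroSet 1 2 4 r) preconnected_CPM ?_ fun c x hx => ?_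
    · simp [zeroSet, zero]; decide
    · change (((cubeSt H c x).1.1.cast : ZMod 2)) = (gray (oddFour ((cubeSt H c x).1.2 0))
        (oddFour ((cubeSt H c x).1.2 1))).cast
      simp only [cubeSt, vec_zero, vec_one]
      rw [hcast, hx, gray_cubeStep _ (mem_units_four r)]
  have hcoord : ∀ x : CPMSet 1 2 4 r, ((ν x).1.2 0, (ν x).1.2 1) =
      (nuFour (gray (oddFour (x.1.2 0)) (oddFour (x.1.2 1)), x.1.2 0, x.1.2 1)).2 := by
    refine (cubeColouring H).induct (v₀ := zeroSet 1 2 4 r) preconnected_CPM ?_ fun c x hx => ?_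
    · rw [h0]; simp [zeroSet, zero]; decide
    · rw [hν]
      change ((cubeSt H _ (ν x)).1.2 0, (cubeSt H _ (ν x)).1.2 1) = (nuFour (gray
        (oddFour ((cubeSt H c x).1.2 0)) (oddFour ((cubeSt H c x).1.2 1)), (cubeSt H c x).1.2 0,
          (cubeSt H c x).1.2 1)).2
      simp only [cubeSt, vec_zero, vec_one]
      obtain ⟨e1, e2⟩ := Prod.ext_iff.1 hx
      simp only at e1 e2
      obtain ⟨-, h4⟩ := nuFour_stepFour _ (mem_units_four r) c
        (gray (oddFour (x.1.2 0)) (oddFour (x.1.2 1))) (x.1.2 0) (x.1.2 1) rfl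
      rw [e1, e2]
      refine Eq.trans ?_ ((congrArg Prod.snd h4).symm.trans (nuFour_snd _ _ _ _))
      rfl
  intro x
  have h1 : nuFour (cpmTriple 4 x.1) = nuFour (gray (oddFour (x.1.2 0)) (oddFour (x.1.2 1)),
      x.1.2 0, x.1.2 1) := by simp [cpmTriple, nuFour]
  simp only [h1]
  have h2 := hcoord x
  refine ⟨?_, ?_, ?_⟩
  · rw [hpar]
    obtain ⟨e1, e2⟩ := Prod.ext_iff.1 h2
    simp only at e1 e2
    rw [e1, e2]
    rfl
  · rw [← h2]; simp
  · rw [← h2]; simp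

end CPMVertex

/-! ### Assembly of the classification -/

/-- If `Γ = CPM(m, s, n; r)` is 2-arc-transitive, then the vertex stabilizers in `Aut Γ` have
order `24`, and `Aut Γ` is generated by `G` and the explicit involution `ν`. The parameters for
which `ν` is defined are part of the conclusion. -/
theorem mainTheorem4 (m s n : ℕ) (hm : 1 ≤ m) (hs : 2 ≤ s) (hn : 3 ≤ n) (r : (ZMod n)ˣ)
    (hr : r ^ (m * s) = 1 ∨ r ^ (m * s) = -1)
    (h2AT : (CPM m s n r).IsTwoArcTransitive) :
    (∀ x : CPMSet m s n r, Nat.card (MulAction.stabilizer (CPMAut m s n r) x) = 24) ∧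
    s = 2 ∧
    ∃ ν : CPMAut m s n r,
      ((m = 1 ∧ n = 4 ∧ IsNuCube ν) ∨
       (m = n ∧ Odd n ∧ (r ^ 2 = 1 ∨ r ^ 2 = -1) ∧ IsNuOdd ν) ∨
       (∃ k : ℕ, Odd k ∧ m = 2 * k ∧ n = 2 * m ∧ 1 + (r : ZMod n) ^ 2 = (m : ZMod n) ∧
          IsNuEven k ν)) ∧
      orderOf ν = 2 ∧
      Subgroup.closure ((CPMG m s n r : Set (CPMAut m s n r)) ∪ {ν}) = ⊤ := by
  have H : CPMVertex.Admissible m s n r := ⟨hm, hs, hn, hr⟩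
  obtain rfl : s = 2 := CPMVertex.eq_two H h2AT
  by_cases hcase : n ≠ 4 ∨ m = 2
  · obtain ⟨δ, K, R, hR⟩ := CPMVertex.exists_rigidColouring H h2AT hcase
    obtain ⟨hall, hcard, hν⟩ := CPMVertex.exists_acts_and_closure H h2AT R fun b => by
      refine ⟨(((if b then -1 else 1 : ℤ) : ℤ) : ZMod (m * 2)),
        if b then -(((CPMVertex.kap δ r ^ (-1 : ℤ) : (ZMod n)ˣ) : ZMod n) * r) else 1, ?_⟩
      rintro ⟨c, ε⟩ rfl
      rw [hR, CPMVertex.vst_zero H K, show CPMVertex.base 2 n = (2 * 0, 0) from rfl,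
        CPMVertex.cst_even]
      cases c <;> simp [CPMVertex.proj, CPMVertex.ix]
    refine ⟨hcard, rfl, ?_⟩
    obtain ⟨φ, hφ0, hφ⟩ := hall (CPMVertex.zeroSet m 2 n r)
      (Equiv.swap (false, false) (true, true))
    rcases CPMVertex.parameters K hR hφ hφ0 with ⟨h1, h2, h3⟩ | ⟨k, h1, h2, h3, h4, h5⟩
    · refine ⟨φ, Or.inr (Or.inl ⟨h1, h2, ?_, CPMVertex.isNuOdd_of_acts K hR hφ hφ0 h1 h2 h3⟩),
        hν φ true hφ0 hφ⟩
      rw [CPMVertex.kap] at h3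
      cases δ
      · right
        simpa [CPMVertex.sgu, neg_eq_iff_eq_neg] using h3
      · left
        simpa [CPMVertex.sgu] using h3
    · obtain ⟨ν, hν0, hν'⟩ := hall (CPMVertex.zeroSet m 2 n r)
        (Equiv.swap (false, false) (true, CPMVertex.nuSign ((r : ZMod n).cast : ZMod 4)))
      refine ⟨ν, Or.inr (Or.inr ⟨k, h1, h2, h3, ?_,
        CPMVertex.isNuEven_of_acts K hR hν' hν0 h1 h2 h3 h4 h5⟩), hν ν _ hν0 hν'⟩
      have h6 : ((2 * m : ℕ) : ZMod n) = 0 := by rw [← h3, ZMod.natCast_self]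
      have h7 : (CPMVertex.kap δ r : ZMod n) = -(r : ZMod n) ^ 2 := by
        rw [h4]; simp [CPMVertex.kap, CPMVertex.sgu]
      push_cast at h6
      linear_combination h7 - h5 - h6
  · obtain ⟨hn4, hm2⟩ := not_or.1 hcase
    obtain rfl := not_not.1 hn4
    obtain rfl : m = 1 := by have := CPMVertex.le_two_of_eq_four H h2AT rfl; omega
    obtain ⟨hall, hcard, hν⟩ := CPMVertex.exists_acts_and_closure H h2AT
      (CPMVertex.cubeColouring H) fun b => by
        refine ⟨1, if b then r else 1, ?_⟩
        rintro ⟨c, ε⟩ rfl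
        have key : ∀ a : ZMod 4, ∀ c ε : Bool, CPMVertex.cubeStep a (c, ε) 0 0 =
            if c then (0, CPMVertex.sg ε * a) else ((CPMVertex.sg ε : ZMod 4), 0) := by decide +kernel
        refine Prod.ext rfl ?_
        change CPMVertex.vec (CPMVertex.cubeStep r (c, ε) 0 0) = _
        rw [key]
        cases c <;> simp [CPMVertex.vec, CPMVertex.ix]
    refine ⟨hcard, rfl, ?_⟩
    obtain ⟨ν, hν0, hν'⟩ := hall (CPMVertex.zeroSet 1 2 4 r)
      (Equiv.swap (false, false) (true, CPMVertex.nuSign r))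
    exact ⟨ν, Or.inl ⟨rfl, rfl, CPMVertex.isNuCube_of_acts H hν' hν0⟩, hν ν _ hν0 hν'⟩
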